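/- Let $n\ge 1$. Let $A\in\mathbb R^{(n-1)\times(n-1)}$ be symmetric and invertible, let $b\in\mathbb R^{n-1}$ with $\|b\|<1$, and let $h_{\lambda,(x,z)}\in\mathbb R^{n\times n}$ be a family of matrices, with $\lambda\in\mathbb R$, $(x,z)\in\mathbb R^{n-1}\times\mathbb R$, such that $(\epsilon,x,z)\mapsto h_{\epsilon^2,(x,z)}$ is smooth with symmetric values and $h_{0,(0,0)}=0$. For $\epsilon>0$ define $R_\epsilon=(R^x_\epsilon,R^z_\epsilon):\mathbb R^n\to\mathbb R^n$ by $$\begin{pmatrix}\epsilon R_\epsilon^x(x,z)\\ R_\epsilon^z(x,z)\end{pmatrix}=-h_{\epsilon^2,(\epsilon^2x,\epsilon z)}\begin{pmatrix}Ax\\ z^2-1\end{pmatrix},$$ and consider the equation for $\gamma=(\gamma_x,\gamma_z):\mathbb R\to\mathbb R^{n-1}\times\mathbb R$ $$\begin{cases}\epsilon\dot\gamma_x=-A\gamma_x+b(1-\gamma_z^2)+\epsilon R^x_\epsilon(\gamma),\\ \dot\gamma_z=-\langle A\gamma_x,b\rangle+(1-\gamma_z^2)+R^z_\epsilon(\gamma),\\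 \lim_{t\to\pm\infty}\gamma(t)=(0,\pm1).\end{cases}\tag{1}$$ Put $$\gamma_0(t)=\left(\frac{A^{-1}b}{\cosh^2((1-\|b\|^2)t)},\ \tanh((1-\|b\|^2)t)\right),\qquad Q_\epsilon=\begin{pmatrix}A/\epsilon&2(\gamma_0)_z\,b/\epsilon\\ b^\top A&2(\gamma_0)_z\end{pmatrix},$$ and $D_\epsilon^*\eta=-\dot\eta+Q_\epsilon\eta$ for $\eta\in W^{1,2}(\mathbb R,\mathbb R^n)$. For $\eta=(\xi,\zeta)$ let $\|\eta\|_\epsilon^2=\epsilon^2\|\xi\|^2+\frac1{1-\|b\|^2}(\zeta-\epsilon\langle b,\xi\rangle)^2$ pointwise, and $$\|\eta\|_{W^{1,2}_\epsilon}^2=\int_{\mathbb R}\|\dot\eta(t)\|_\epsilon^2\,dt+\int_{\mathbb R}\|\eta(t)\|_\epsilon^2\,dt,\qquad \|\eta\|_{L^\infty_\epsilon}=\epsilon\|\xi\|_{L^\infty}+\|\zeta\|_{L^\infty}.$$ Define $\mathcal F_\epsilon:W^{1,2}(\mathbb R,\mathbb R^n)\to L^2(\mathbb R,\mathbb R^n)$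 by $$\mathcal F_\epsilon(\eta)=\dot\eta+Q_\epsilon\eta+\begin{pmatrix}b/\epsilon\\1\end{pmatrix}\zeta^2-R_\epsilon(\gamma_0+\eta)+\begin{pmatrix}(\dot\gamma_0)_x\\0\end{pmatrix},$$ so that $\mathcal F_\epsilon(\eta)=0$ if and only if $\gamma_0+\eta$ solves (1). For $C>0$ and $\epsilon>0$, say that $\eta\in W^{1,2}(\mathbb R,\mathbb R^n)$ has property $P(C,\epsilon)$ if $\gamma_0+\eta$ is (after modification on a null set) a smooth solution of (1), $\eta$ lies in the image $D_\epsilon^*(W^{1,2}(\mathbb R,\mathbb R^n))$, and $\|\eta\|_{W^{1,2}_\epsilon}+\epsilon^{1/2}\|\eta\|_{L^\infty_\epsilon}\le C\epsilon$. Then: 1. There are $C,\epsilon_0>0$ such that for every $0<\epsilon<\epsilon_0$ there exists $\eta_\epsilon\in W^{1,2}(\mathbb R,\mathbb R^n)$ with property $P(C,\epsilon)$, i.e. a solution $\gamma_\epsilon=\gamma_0+\eta_\epsilon$ of (1) near $\gamma_0$. 2. Such solutions are transverse for small $\epsilon$: for every $C>0$ there is $\epsilon_0>0$ such that for every $0<\epsilon<\epsilon_0$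 and every $\eta_\epsilon$ with property $P(C,\epsilon)$, the map $\mathcal F_\epsilon$ is Fréchet differentiable at $\eta_\epsilon$ and its linearisation $d\mathcal F_\epsilon(\eta_\epsilon):W^{1,2}(\mathbb R,\mathbb R^n)\to L^2(\mathbb R,\mathbb R^n)$ is surjective. -/

import Mathlib

open MeasureTheory Filter Topology
open scoped ContDiff RealInnerProductSpace

namespace BirthDeath

noncomputable section

/-! ### Phase space -/

/-- The space `ℝ^(n-1)` of the `x`-coordinates, with `m = n - 1`. -/
abbrev XSpace (m : ℕ) := EuclideanSpace ℝ (Fin m)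

/-- The space `ℝ^n = ℝ^(n-1) × ℝ`, with `m = n - 1`: the coordinates `Sum.inl i` are those of `x`,
the coordinate `Sum.inr ()` is `z`. -/
abbrev Phase (m : ℕ) := EuclideanSpace ℝ (Fin m ⊕ Unit)

/-- The vector `(x, z)`. -/
def vec {m : ℕ} (x : XSpace m) (z : ℝ) : Phase m :=
  WithLp.toLp 2 (Sum.elim (fun i => x i) (fun _ => z))

/-- The `x`-part of `p = (x, z)`. -/
def xPart {m : ℕ} (p : Phase m) : XSpace m := WithLp.toLp 2 (fun i => p (Sum.inl i))

/-- The `z`-part of `p = (x, z)`. -/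
def zPart {m : ℕ} (p : Phase m) : ℝ := p (Sum.inr ())

/-- The action of a square matrix on column vectors. -/
def act {ι : Type} [Fintype ι] [DecidableEq ι] (M : Matrix ι ι ℝ) (v : EuclideanSpace ℝ ι) :
    EuclideanSpace ℝ ι :=
  WithLp.toLp 2 (M.mulVec (WithLp.ofLp v))

/-! ### The data and the gradient equation -/

/-- The triples `(A, b, h)`: `A` is symmetric and invertible, `‖b‖ < 1`, and `h` takes symmetric
values, vanishes at the origin for `λ = 0`, and `(ε, x, z) ↦ h_{ε², (x, z)}` is smooth.
Here `h lam p` is the matrix `h_{lam, p}`. -/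
structure Triple (m : ℕ) where
  A : Matrix (Fin m) (Fin m) ℝ
  b : XSpace m
  h : ℝ → Phase m → Matrix (Fin m ⊕ Unit) (Fin m ⊕ Unit) ℝ
  A_symm : A.IsSymm
  A_inv : IsUnit A
  b_norm : ‖b‖ < 1
  h_smooth : ∀ i j, ContDiff ℝ ∞ (fun q : ℝ × Phase m => h (q.1 ^ 2) q.2 i j)
  h_symm : ∀ (ε : ℝ) (p : Phase m), (h (ε ^ 2) p).IsSymm
  h_zero : h 0 0 = 0

variable {m : ℕ}

/-- The vector `(A x, z² - 1)`. -/
def gradVec (T : Triple m) (p : Phase m) : Phase m :=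
  vec (act T.A (xPart p)) (zPart p ^ 2 - 1)

/-- `(ε R^x_ε, R^z_ε)(x, z) = - h_{ε², (ε² x, ε z)} (A x, z² - 1)`. -/
def scaledR (T : Triple m) (ε : ℝ) (p : Phase m) : Phase m :=
  - act (T.h (ε ^ 2) (vec (ε ^ 2 • xPart p) (ε * zPart p))) (gradVec T p)

/-- The error term `R_ε = (R^x_ε, R^z_ε)`. -/
def R (T : Triple m) (ε : ℝ) (p : Phase m) : Phase m :=
  vec (ε⁻¹ • xPart (scaledR T ε p)) (zPart (scaledR T ε p))

/-- `γ` is a smooth solution of the gradient equation with parameter `ε`, connecting `(0, -1)`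
to `(0, 1)`. -/
structure IsSmoothSolution (T : Triple m) (ε : ℝ) (γ : ℝ → Phase m) : Prop where
  smooth : ContDiff ℝ ∞ γ
  eq_x : ∀ t, ε • xPart (deriv γ t) =
    -act T.A (xPart (γ t)) + (1 - zPart (γ t) ^ 2) • T.b + ε • xPart (R T ε (γ t))
  eq_z : ∀ t, zPart (deriv γ t) =
    -⟪act T.A (xPart (γ t)), T.b⟫ + (1 - zPart (γ t) ^ 2) + zPart (R T ε (γ t))
  lim_top : Tendsto γ atTop (𝓝 (vec 0 1))
  lim_bot : Tendsto γ atBot (𝓝 (vec 0 (-1)))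

/-- The adiabatic limit solution
`γ₀(t) = (A⁻¹ b / cosh² ((1 - ‖b‖²) t), tanh ((1 - ‖b‖²) t))`. -/
def gamma0 (T : Triple m) (t : ℝ) : Phase m :=
  vec ((Real.cosh ((1 - ‖T.b‖ ^ 2) * t) ^ 2)⁻¹ • act T.A⁻¹ T.b)
    (Real.tanh ((1 - ‖T.b‖ ^ 2) * t))

/-- `Q_ε(t) (ξ, ζ)`, where
`Q_ε = [[A / ε, 2 (γ₀)_z b / ε], [bᵀ A, 2 (γ₀)_z]]`. -/
def Q (T : Triple m) (ε t : ℝ) (p : Phase m) : Phase m :=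
  vec (ε⁻¹ • act T.A (xPart p) + (ε⁻¹ * (2 * zPart (gamma0 T t) * zPart p)) • T.b)
    (⟪T.b, act T.A (xPart p)⟫ + 2 * zPart (gamma0 T t) * zPart p)

/-! ### The space `W^{1,2}(ℝ, ℝⁿ)` -/

/-- `v` is a weak derivative of `u` on the real line. -/
def IsWeakDeriv {E : Type} [NormedAddCommGroup E] [NormedSpace ℝ E] (u v : ℝ → E) : Prop :=
  ∀ φ : ℝ → ℝ, ContDiff ℝ ∞ φ → HasCompactSupport φ →
    ∫ t, deriv φ t • u t = - ∫ t, φ t • v t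

/-- `L²(ℝ, ℝⁿ)`. -/
abbrev L2 (m : ℕ) := Lp (Phase m) 2 (volume : Measure ℝ)

lemma integrable_test_smul {φ : ℝ → ℝ} (hφ : Continuous φ) (hc : HasCompactSupport φ)
    {u : ℝ → Phase m} (hu : MemLp u 2 (volume : Measure ℝ)) :
    Integrable (fun t => φ t • u t) :=
  (hu.locallyIntegrable (by norm_num)).integrable_smul_left_of_hasCompactSupport hφ hc

/-- `W^{1,2}(ℝ, ℝⁿ)`, realised as the space of pairs `(u, u̇)` in `L² × L²` such that `u̇` is the
weak derivative of `u`, with the norm `(‖u‖² + ‖u̇‖²)^(1/2)`. -/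
def W12 (m : ℕ) : Submodule ℝ (WithLp 2 (L2 m × L2 m)) where
  carrier := {w | IsWeakDeriv (w.fst : ℝ → Phase m) (w.snd : ℝ → Phase m)}
  add_mem' := by
    intro w w' hw hw' φ hφ hc
    have hd : Continuous (deriv φ) := hφ.continuous_deriv (by simp)
    have h1 : ∫ t, deriv φ t • (w + w').fst t
        = ∫ t, (deriv φ t • w.fst t + deriv φ t • w'.fst t) := by
      refine integral_congr_ae ?_
      filter_upwards [Lp.coeFn_add w.fst w'.fst] with t ht
      rw [WithLp.add_fst, ht, Pi.add_apply, smul_add]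
    have h2 : ∫ t, φ t • (w + w').snd t = ∫ t, (φ t • w.snd t + φ t • w'.snd t) := by
      refine integral_congr_ae ?_
      filter_upwards [Lp.coeFn_add w.snd w'.snd] with t ht
      rw [WithLp.add_snd, ht, Pi.add_apply, smul_add]
    rw [h1, h2, integral_add (integrable_test_smul hd hc.deriv (Lp.memLp _))
      (integrable_test_smul hd hc.deriv (Lp.memLp _)),
      integral_add (integrable_test_smul hφ.continuous hc (Lp.memLp _))
      (integrable_test_smul hφ.continuous hc (Lp.memLp _)), hw φ hφ hc, hw' φ hφ hc]
    abel
  zero_mem' := by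
    intro φ hφ hc
    have h1 : ∫ t, deriv φ t • (0 : WithLp 2 (L2 m × L2 m)).fst t = ∫ _ : ℝ, (0 : Phase m) := by
      refine integral_congr_ae ?_
      filter_upwards [Lp.coeFn_zero (Phase m) 2 (volume : Measure ℝ)] with t ht
      rw [WithLp.zero_fst, ht, Pi.zero_apply, smul_zero]
    have h2 : ∫ t, φ t • (0 : WithLp 2 (L2 m × L2 m)).snd t = ∫ _ : ℝ, (0 : Phase m) := by
      refine integral_congr_ae ?_
      filter_upwards [Lp.coeFn_zero (Phase m) 2 (volume : Measure ℝ)] with t ht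
      rw [WithLp.zero_snd, ht, Pi.zero_apply, smul_zero]
    rw [h1, h2]
    simp
  smul_mem' := by
    intro c w hw φ hφ hc
    have h1 : ∫ t, deriv φ t • (c • w).fst t = ∫ t, c • deriv φ t • w.fst t := by
      refine integral_congr_ae ?_
      filter_upwards [Lp.coeFn_smul c w.fst] with t ht
      rw [WithLp.smul_fst, ht, Pi.smul_apply, smul_comm]
    have h2 : ∫ t, φ t • (c • w).snd t = ∫ t, c • φ t • w.snd t := by
      refine integral_congr_ae ?_
      filter_upwards [Lp.coeFn_smul c w.snd] with t ht
      rw [WithLp.smul_snd, ht, Pi.smul_apply, smul_comm]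
    rw [h1, h2, integral_smul, integral_smul, hw φ hφ hc, smul_neg]

/-- The function underlying an element of `W^{1,2}` (determined almost everywhere). -/
def fn (η : W12 m) : ℝ → Phase m := η.1.fst

/-- The weak derivative of an element of `W^{1,2}` (determined almost everywhere). -/
def dot (η : W12 m) : ℝ → Phase m := η.1.snd

/-! ### The functional is well defined on `W^{1,2}` -/

/-- Elements of `W^{1,2}` are essentially bounded. -/
lemma W12_bounded (η : W12 m) : ∃ K : ℝ, 0 ≤ K ∧ ∀ᵐ t, ‖fn η t‖ ≤ K := by
  classical
  set u := fn η with hu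
  set v := dot η with hv
  have hu2 : MemLp u 2 (volume : Measure ℝ) := Lp.memLp η.1.fst
  have hv2 : MemLp v 2 (volume : Measure ℝ) := Lp.memLp η.1.snd
  have hw : IsWeakDeriv u v := η.2
  have hul : LocallyIntegrable u := hu2.locallyIntegrable (by norm_num)
  have hus : Integrable (fun t => ‖u t‖ ^ 2) := (memLp_two_iff_integrable_sq_norm hu2.1).1 hu2
  have hvs : Integrable (fun t => ‖v t‖ ^ 2) := (memLp_two_iff_integrable_sq_norm hv2.1).1 hv2
  set U := ∫ t, ‖u t‖ ^ 2
  set V := ∫ t, ‖v t‖ ^ 2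
  -- a smooth function supported in a unit ball is controlled by its supremum
  have key : ∀ (w : ℝ → Phase m), Integrable (fun t => ‖w t‖ ^ 2) → ∀ (x B : ℝ) (φ : ℝ → ℝ), 0 ≤ B →
      (∀ s, |φ s| ≤ B) → (∀ s, s ∉ Set.Icc (x - 1) (x + 1) → φ s = 0) →
      ‖∫ s, φ s • w s‖ ≤ B * (2 + ∫ t, ‖w t‖ ^ 2) := by
    intro w hws x B φ hB hφ hφ0
    have hi : Integrable (fun s => B * (Set.indicator (Set.Icc (x - 1) (x + 1)) (fun _ => (1 : ℝ)) s
        + ‖w s‖ ^ 2)) := by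
      refine (Integrable.add ?_ hws).const_mul B
      exact (integrable_indicator_iff measurableSet_Icc).2 (by simp)
    refine (norm_integral_le_of_norm_le hi (Eventually.of_forall fun s => ?_)).trans ?_
    · by_cases hs : s ∈ Set.Icc (x - 1) (x + 1)
      · rw [Set.indicator_of_mem hs, norm_smul, Real.norm_eq_abs]
        refine mul_le_mul (hφ s) ?_ (norm_nonneg _) hB
        nlinarith [sq_nonneg (‖w s‖ - 1)]
      · rw [hφ0 s hs, zero_smul, norm_zero, Set.indicator_of_notMem hs]
        positivity
    · rw [integral_const_mul, integral_add ((integrable_indicator_iff measurableSet_Icc).2 (by simp))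
        hws, integral_indicator measurableSet_Icc]
      simp
      refine mul_le_mul_of_nonneg_left ?_ hB
      norm_num
  let θ : ContDiffBump (0 : ℝ) := ⟨1 / 2, 1, by norm_num, by norm_num⟩
  obtain ⟨B, hB⟩ : ∃ B, ∀ s, ‖θ.normed volume s‖ ≤ B :=
    (θ.continuous_normed (μ := volume)).bounded_above_of_compact_support θ.hasCompactSupport_normed
  have hB0 : 0 ≤ B := (norm_nonneg _).trans (hB 0)
  have hrad : ∀ (ρ : ContDiffBump (0 : ℝ)), ρ.rOut ≤ 1 → ∀ (x s : ℝ), s ∉ Set.Ioo (x - 1) (x + 1) →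
      ρ.normed volume (x - s) = 0 := by
    intro ρ hρ x s hs
    by_contra h
    have : x - s ∈ Function.support (ρ.normed volume) := h
    rw [ρ.support_normed_eq, Metric.mem_ball, dist_zero_right, Real.norm_eq_abs, abs_lt] at this
    exact hs ⟨by linarith [this.2], by linarith [this.1]⟩
  have hbd : ∀ (ρ : ContDiffBump (0 : ℝ)), ρ.rOut ≤ 1 → ∀ x : ℝ,
      ‖∫ s, ρ.normed volume (x - s) • u s‖ ≤ B * (2 + U) + 2 * (2 + V) := by
    intro ρ hρ x
    have hρc : Continuous fun s => ρ.normed volume (x - s) := ρ.continuous_normed.comp (by fun_prop)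
    have hθc : Continuous fun s => θ.normed volume (x - s) := θ.continuous_normed.comp (by fun_prop)
    set g : ℝ → ℝ := fun s => ρ.normed volume (x - s) - θ.normed volume (x - s) with hg
    have hgc : Continuous g := hρc.sub hθc
    have hρi : Integrable fun s => ρ.normed volume (x - s) :=
      (ρ.integrable_normed (μ := volume)).comp_sub_left x
    have hθi : Integrable fun s => θ.normed volume (x - s) :=
      (θ.integrable_normed (μ := volume)).comp_sub_left x
    have hρ1 : ∫ s, ρ.normed volume (x - s) = 1 := by
      rw [integral_sub_left_eq_self (fun s => ρ.normed volume s) volume x]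
      exact ρ.integral_normed
    have hθ1 : ∫ s, θ.normed volume (x - s) = 1 := by
      rw [integral_sub_left_eq_self (fun s => θ.normed volume s) volume x]
      exact θ.integral_normed
    have hgi : Integrable g := hρi.sub hθi
    have hg0 : ∫ s, g s = 0 := by
      rw [hg, integral_sub hρi hθi, hρ1, hθ1, sub_self]
    have hgs : ∀ s, s ∉ Set.Ioo (x - 1) (x + 1) → g s = 0 := by
      intro s hs
      rw [hg]
      simp only
      rw [hrad ρ hρ x s hs, hrad θ le_rfl x s hs, sub_self]
    set φ : ℝ → ℝ := fun s => ∫ r in (x - 1)..s, g r with hφ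
    have hφd : ∀ s, HasDerivAt φ (g s) s := fun s =>
      intervalIntegral.integral_hasDerivAt_right (hgc.intervalIntegrable _ _)
        (hgc.stronglyMeasurableAtFilter _ _) hgc.continuousAt
    have hφderiv : deriv φ = g := funext fun s => (hφd s).deriv
    have hgsm : ContDiff ℝ ∞ g := by
      have h1 : ContDiff ℝ ∞ fun s => ρ.normed volume (x - s) :=
        (ρ.contDiff_normed (μ := volume) (n := ⊤)).comp (contDiff_const.sub contDiff_id)
      have h2 : ContDiff ℝ ∞ fun s => θ.normed volume (x - s) :=
        (θ.contDiff_normed (μ := volume) (n := ⊤)).comp (contDiff_const.sub contDiff_id)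
      exact h1.sub h2
    have hφsm : ContDiff ℝ ∞ φ :=
      contDiff_infty_iff_deriv.2 ⟨fun s => (hφd s).differentiableAt, by rw [hφderiv]; exact hgsm⟩
    have hφ0 : ∀ s, s ∉ Set.Icc (x - 1) (x + 1) → φ s = 0 := by
      intro s hs
      rw [Set.mem_Icc, not_and_or, not_le, not_le] at hs
      rcases hs with hs | hs
      · rw [hφ]
        simp only
        rw [intervalIntegral.integral_symm, intervalIntegral.integral_of_le hs.le,
          setIntegral_eq_zero_of_forall_eq_zero, neg_zero]
        intro r hr
        exact hgs r fun h => absurd h.1 (not_lt.2 hr.2)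
      · rw [hφ]
        simp only
        rw [intervalIntegral.integral_of_le (by linarith), setIntegral_eq_integral_of_forall_compl_eq_zero, hg0]
        intro r hr
        exact hgs r fun h => hr ⟨h.1, (h.2.trans hs).le⟩
    have hφc : HasCompactSupport φ :=
      HasCompactSupport.intro isCompact_Icc hφ0
    have hφb : ∀ s, |φ s| ≤ 2 := by
      intro s
      have h1 : |φ s| ≤ ∫ r, |g r| := by
        by_cases hs : x - 1 ≤ s
        · rw [hφ]
          simp only
          rw [intervalIntegral.integral_of_le hs]
          refine (norm_integral_le_integral_norm (μ := volume.restrict (Set.Ioc (x - 1) s)) g).trans ?_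
          exact setIntegral_le_integral hgi.norm (Eventually.of_forall fun r => norm_nonneg _)
        · rw [hφ0 s (fun h => hs h.1), abs_zero]
          exact integral_nonneg fun r => abs_nonneg _
      refine h1.trans ?_
      have h2 : ∫ r, |g r| ≤ ∫ r, (ρ.normed volume (x - r) + θ.normed volume (x - r)) := by
        refine integral_mono hgi.norm (hρi.add hθi) fun r => ?_
        refine (abs_sub _ _).trans (le_of_eq ?_)
        rw [abs_of_nonneg (ρ.nonneg_normed _), abs_of_nonneg (θ.nonneg_normed _)]
      rw [integral_add hρi hθi, hρ1, hθ1] at h2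
      linarith
    have e : ∫ s, ρ.normed volume (x - s) • u s
        = (∫ s, θ.normed volume (x - s) • u s) - ∫ s, φ s • v s := by
      have h1 := hw φ hφsm hφc
      rw [hφderiv] at h1
      have hθs : HasCompactSupport fun s => θ.normed volume (x - s) :=
        HasCompactSupport.intro (isCompact_Icc (a := x - 1) (b := x + 1)) fun s hs =>
          hrad θ le_rfl x s fun h => hs (Set.Ioo_subset_Icc_self h)
      have hρs : HasCompactSupport fun s => ρ.normed volume (x - s) :=
        HasCompactSupport.intro (isCompact_Icc (a := x - 1) (b := x + 1)) fun s hs =>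
          hrad ρ hρ x s fun h => hs (Set.Ioo_subset_Icc_self h)
      have h2 : ∫ s, g s • u s = (∫ s, ρ.normed volume (x - s) • u s)
          - ∫ s, θ.normed volume (x - s) • u s := by
        rw [← integral_sub (integrable_test_smul hρc hρs hu2) (integrable_test_smul hθc hθs hu2)]
        simp only [hg, sub_smul]
      rw [sub_eq_add_neg, ← h1, h2]
      abel
    rw [e]
    refine (norm_sub_le _ _).trans (add_le_add ?_ ?_)
    · exact key u hus x B _ hB0 (fun s => hB _) fun s hs =>
        hrad θ le_rfl x s fun h => hs (Set.Ioo_subset_Icc_self h)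
    · exact key v hvs x 2 φ (by norm_num) hφb hφ0
  have hU : 0 ≤ U := integral_nonneg fun t => by positivity
  have hV : 0 ≤ V := integral_nonneg fun t => by positivity
  refine ⟨B * (2 + U) + 2 * (2 + V), by positivity, ?_⟩
  let ρ : ℕ → ContDiffBump (0 : ℝ) := fun n =>
    ⟨1 / (2 * ((n : ℝ) + 1)), 1 / ((n : ℝ) + 1), by positivity, by
      apply one_div_lt_one_div_of_lt <;> linarith [(Nat.cast_nonneg n : (0 : ℝ) ≤ n)]⟩
  have hlim : Tendsto (fun n => (ρ n).rOut) atTop (𝓝 0) := tendsto_one_div_add_atTop_nhds_zero_nat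
  have hK : ∀ᶠ n in atTop, (ρ n).rOut ≤ 2 * (ρ n).rIn := Eventually.of_forall fun n => by
    change 1 / ((n : ℝ) + 1) ≤ 2 * (1 / (2 * ((n : ℝ) + 1)))
    have : (n : ℝ) + 1 ≠ 0 := by positivity
    apply le_of_eq
    field_simp
  filter_upwards [ContDiffBump.ae_convolution_tendsto_right_of_locallyIntegrable
    (μ := volume) hlim hK hul] with x hx
  refine le_of_tendsto hx.norm (Eventually.of_forall fun n => ?_)
  simp only [convolution_eq_swap, ContinuousLinearMap.lsmul_apply]
  refine hbd (ρ n) ?_ x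
  change 1 / ((n : ℝ) + 1) ≤ 1
  rw [div_le_one (by positivity)]
  linarith [(Nat.cast_nonneg n : (0 : ℝ) ≤ n)]

lemma memLp_fn (η : W12 m) : MemLp (fn η) 2 (volume : Measure ℝ) := Lp.memLp η.1.fst

lemma memLp_dot (η : W12 m) : MemLp (dot η) 2 (volume : Measure ℝ) := Lp.memLp η.1.snd

lemma memLp_vec {x : ℝ → XSpace m} {z : ℝ → ℝ} (hx : MemLp x 2 (volume : Measure ℝ))
    (hz : MemLp z 2 (volume : Measure ℝ)) :
    MemLp (fun t => vec (x t) (z t)) 2 (volume : Measure ℝ) :=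
  memLp_piLp_iff.2 fun i => match i with
    | Sum.inl i => hx.eval_piLp i
    | Sum.inr _ => hz

lemma memLp_xPart {u : ℝ → Phase m} (hu : MemLp u 2 (volume : Measure ℝ)) :
    MemLp (fun t => xPart (u t)) 2 (volume : Measure ℝ) :=
  memLp_piLp_iff.2 fun i => hu.eval_piLp (Sum.inl i)

lemma memLp_zPart {u : ℝ → Phase m} (hu : MemLp u 2 (volume : Measure ℝ)) :
    MemLp (fun t => zPart (u t)) 2 (volume : Measure ℝ) :=
  hu.eval_piLp (Sum.inr ())

lemma memLp_bdd_mul {f g : ℝ → ℝ} {K : ℝ} (hf : AEStronglyMeasurable f (volume : Measure ℝ))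
    (hK : ∀ᵐ t, |f t| ≤ K) (hg : MemLp g 2 (volume : Measure ℝ)) :
    MemLp (fun t => f t * g t) 2 (volume : Measure ℝ) := by
  refine hg.of_le_mul (c := K) (hf.mul hg.1) ?_
  filter_upwards [hK] with t ht
  rw [norm_mul, Real.norm_eq_abs]
  exact mul_le_mul_of_nonneg_right ht (norm_nonneg _)

lemma memLp_act {ι : Type} [Fintype ι] [DecidableEq ι] {M : ℝ → Matrix ι ι ℝ} {K : ι → ι → ℝ}
    (hM : ∀ i j, AEStronglyMeasurable (fun t => M t i j) (volume : Measure ℝ))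
    (hK : ∀ i j, ∀ᵐ t, |M t i j| ≤ K i j) {v : ℝ → EuclideanSpace ℝ ι}
    (hv : MemLp v 2 (volume : Measure ℝ)) :
    MemLp (fun t => act (M t) (v t)) 2 (volume : Measure ℝ) :=
  memLp_piLp_iff.2 fun i =>
    memLp_finsetSum (f := fun j t => M t i j * v t j) Finset.univ fun j _ =>
      memLp_bdd_mul (hM i j) (hK i j) (hv.eval_piLp j)

lemma memLp_act_const {ι : Type} [Fintype ι] [DecidableEq ι] (M : Matrix ι ι ℝ)
    {v : ℝ → EuclideanSpace ℝ ι} (hv : MemLp v 2 (volume : Measure ℝ)) :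
    MemLp (fun t => act M (v t)) 2 (volume : Measure ℝ) :=
  memLp_act (M := fun _ => M) (K := fun i j => |M i j|) (fun _ _ => aestronglyMeasurable_const)
    (fun _ _ => Eventually.of_forall fun _ => le_rfl) hv

lemma memLp_smul_vector {f : ℝ → ℝ} (hf : MemLp f 2 (volume : Measure ℝ)) {ι : Type} [Fintype ι]
    (b : EuclideanSpace ℝ ι) : MemLp (fun t => f t • b) 2 (volume : Measure ℝ) :=
  memLp_piLp_iff.2 fun i => by simpa [mul_comm] using hf.const_mul (b i)

lemma continuous_vec : Continuous fun q : XSpace m × ℝ => vec q.1 q.2 :=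
  (PiLp.continuous_toLp 2 _).comp <| continuous_pi fun i => match i with
    | Sum.inl i => (PiLp.continuous_apply 2 _ i).comp continuous_fst
    | Sum.inr _ => continuous_snd

lemma continuous_xPart : Continuous (xPart : Phase m → XSpace m) :=
  (PiLp.continuous_toLp 2 _).comp <| continuous_pi fun i => PiLp.continuous_apply 2 _ (Sum.inl i)

lemma continuous_zPart : Continuous (zPart : Phase m → ℝ) :=
  PiLp.continuous_apply 2 _ (Sum.inr ())

lemma rate_pos (T : Triple m) : 0 < 1 - ‖T.b‖ ^ 2 := by
  nlinarith [T.b_norm, norm_nonneg T.b]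

lemma abs_tanh_le_one (s : ℝ) : |Real.tanh s| ≤ 1 := by
  have h := Real.cosh_pos s
  rw [Real.tanh_eq_sinh_div_cosh, abs_div, abs_of_pos h, div_le_one h]
  exact abs_le_of_sq_le_sq (by nlinarith [Real.cosh_sq s]) h.le

lemma continuous_sech (c : ℝ) : Continuous fun t => (Real.cosh (c * t) ^ 2)⁻¹ :=
  ((Real.continuous_cosh.comp (continuous_const.mul continuous_id)).pow 2).inv₀
    fun _ => pow_ne_zero _ (Real.cosh_pos _).ne'

lemma sech_le_one (s : ℝ) : (Real.cosh s ^ 2)⁻¹ ≤ 1 :=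
  inv_le_one_of_one_le₀ (by nlinarith [Real.one_le_cosh s])

lemma memLp_sech {c : ℝ} (hc : 0 < c) :
    MemLp (fun t => (Real.cosh (c * t) ^ 2)⁻¹) 2 (volume : Measure ℝ) := by
  rw [memLp_two_iff_integrable_sq (continuous_sech c).aestronglyMeasurable]
  refine (integrable_inv_one_add_sq.comp_mul_left' hc.ne').mono'
    ((continuous_sech c).pow 2).aestronglyMeasurable (Eventually.of_forall fun t => ?_)
  have h0 : 0 ≤ (Real.cosh (c * t) ^ 2)⁻¹ := by positivity
  rw [Real.norm_of_nonneg (by positivity)]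
  refine (mul_le_of_le_one_right h0 (sech_le_one _) |>.trans' (by rw [sq])).trans ?_
  have h1 : (c * t) ^ 2 ≤ Real.sinh (c * t) ^ 2 := by
    rw [sq_le_sq]
    rcases le_total 0 (c * t) with h | h
    · rw [abs_of_nonneg h]
      exact (Real.self_le_sinh_iff.2 h).trans (le_abs_self _)
    · rw [abs_of_nonpos h]
      exact (neg_le_neg (Real.sinh_le_self_iff.2 h)).trans (neg_le_abs _)
  exact inv_anti₀ (by positivity) (by linarith [Real.cosh_sq (c * t)])

lemma xPart_gamma0 (T : Triple m) (t : ℝ) : xPart (gamma0 T t) =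
    (Real.cosh ((1 - ‖T.b‖ ^ 2) * t) ^ 2)⁻¹ • act T.A⁻¹ T.b := rfl

lemma zPart_gamma0 (T : Triple m) (t : ℝ) :
    zPart (gamma0 T t) = Real.tanh ((1 - ‖T.b‖ ^ 2) * t) := rfl

lemma continuous_tanh_mul (c : ℝ) : Continuous fun t => Real.tanh (c * t) := by
  simp only [Real.tanh_eq_sinh_div_cosh]
  exact (Real.continuous_sinh.comp (continuous_const.mul continuous_id)).div
    (Real.continuous_cosh.comp (continuous_const.mul continuous_id)) fun _ => (Real.cosh_pos _).ne'

lemma continuous_gamma0 (T : Triple m) : Continuous (gamma0 T) :=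
  continuous_vec.comp
    (((continuous_sech _).smul continuous_const).prodMk (continuous_tanh_mul _))

lemma gamma0_bounded (T : Triple m) : ∃ K : ℝ, ∀ t, ‖gamma0 T t‖ ≤ K := by
  refine ⟨‖act T.A⁻¹ T.b‖ + 1, fun t => ?_⟩
  have h : gamma0 T t = vec (xPart (gamma0 T t)) 0 + vec 0 (zPart (gamma0 T t)) := by
    ext i
    rcases i with i | i <;> simp [vec, xPart, zPart]
  have h1 : ∀ x : XSpace m, ‖vec x 0‖ = ‖x‖ := fun x => by
    simp [EuclideanSpace.norm_eq, vec]
  have h2 : ∀ z : ℝ, ‖(vec 0 z : Phase m)‖ = |z| := fun z => by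
    simp [EuclideanSpace.norm_eq, vec, Real.sqrt_sq_eq_abs]
  rw [h]
  refine (norm_add_le _ _).trans (add_le_add ?_ ?_)
  · rw [h1, xPart_gamma0, norm_smul, Real.norm_of_nonneg (by positivity)]
    exact mul_le_of_le_one_left (norm_nonneg _) (sech_le_one _)
  · rw [h2]
    exact abs_tanh_le_one _

lemma hasDerivAt_sech (c t : ℝ) : HasDerivAt (fun t => (Real.cosh (c * t) ^ 2)⁻¹)
    (-2 * c * Real.tanh (c * t) * (Real.cosh (c * t) ^ 2)⁻¹) t := by
  have h := (Real.cosh_pos (c * t)).ne'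
  have h1 : HasDerivAt (fun t => Real.cosh (c * t)) (Real.sinh (c * t) * c) t := by
    simpa using ((hasDerivAt_id t).const_mul c).cosh
  have h2 := (h1.pow 2).inv (pow_ne_zero 2 h)
  refine h2.congr_deriv ?_
  rw [Real.tanh_eq_sinh_div_cosh]
  simp only [Pi.pow_apply]
  field_simp
  norm_num
  ring

lemma xPart_deriv_gamma0 (T : Triple m) (t : ℝ) : xPart (deriv (gamma0 T) t) =
    (-2 * (1 - ‖T.b‖ ^ 2) * Real.tanh ((1 - ‖T.b‖ ^ 2) * t) *
      (Real.cosh ((1 - ‖T.b‖ ^ 2) * t) ^ 2)⁻¹) • act T.A⁻¹ T.b := by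
  have ht : DifferentiableAt ℝ (gamma0 T) t := by
    refine (differentiableAt_piLp 2).2 fun i => ?_
    rcases i with i | i
    · exact ((hasDerivAt_sech _ t).differentiableAt.smul_const (act T.A⁻¹ T.b)
        |>.hasDerivAt.differentiableAt |> (differentiableAt_piLp 2).1) i
    · change DifferentiableAt ℝ (fun t => Real.tanh ((1 - ‖T.b‖ ^ 2) * t)) t
      simp only [Real.tanh_eq_sinh_div_cosh]
      exact DifferentiableAt.div (by fun_prop) (by fun_prop) (Real.cosh_pos _).ne'
  ext i
  have h1 : HasDerivAt (fun s => gamma0 T s (Sum.inl i)) (deriv (gamma0 T) t (Sum.inl i)) t :=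
    ((EuclideanSpace.proj (𝕜 := ℝ) (Sum.inl i : Fin m ⊕ Unit)).hasFDerivAt.comp_hasDerivAt t
      ht.hasDerivAt :)
  have h2 : HasDerivAt (fun s => gamma0 T s (Sum.inl i)) _ t :=
    (hasDerivAt_sech (1 - ‖T.b‖ ^ 2) t).mul_const (act T.A⁻¹ T.b i)
  exact h1.unique h2

lemma memLp_Q (T : Triple m) (ε : ℝ) {u : ℝ → Phase m} (hu : MemLp u 2 (volume : Measure ℝ)) :
    MemLp (fun t => Q T ε t (u t)) 2 (volume : Measure ℝ) := by
  have hA := memLp_act_const T.A (memLp_xPart hu)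
  have hz : MemLp (fun t => 2 * zPart (gamma0 T t) * zPart (u t)) 2 (volume : Measure ℝ) := by
    refine memLp_bdd_mul (K := 2) ?_ (Eventually.of_forall fun t => ?_) (memLp_zPart hu)
    · exact (continuous_const.mul
        (continuous_zPart.comp (continuous_gamma0 T))).aestronglyMeasurable
    · rw [zPart_gamma0, abs_mul, abs_two]
      linarith [abs_tanh_le_one ((1 - ‖T.b‖ ^ 2) * t)]
  have hi : MemLp (fun t => ⟪T.b, act T.A (xPart (u t))⟫) 2 (volume : Measure ℝ) :=
    hA.const_inner (𝕜 := ℝ) T.b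
  have hb : MemLp (fun t => (ε⁻¹ * (2 * zPart (gamma0 T t) * zPart (u t))) • T.b) 2
      (volume : Measure ℝ) := memLp_smul_vector (hz.const_mul ε⁻¹) T.b
  exact memLp_vec ((hA.const_smul ε⁻¹).add hb) (hi.add hz)

lemma memLp_R (T : Triple m) (ε : ℝ) (η : W12 m) :
    MemLp (fun t => R T ε (gamma0 T t + fn η t)) 2 (volume : Measure ℝ) := by
  obtain ⟨K, hK0, hK⟩ := W12_bounded η
  obtain ⟨L, hL⟩ := gamma0_bounded T
  have hη := memLp_fn η
  have hp : AEStronglyMeasurable (fun t => gamma0 T t + fn η t) (volume : Measure ℝ) :=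
    (continuous_gamma0 T).aestronglyMeasurable.add hη.1
  have hz : MemLp (fun t => zPart (fn η t)) 2 (volume : Measure ℝ) := memLp_zPart hη
  have hg : MemLp (fun t => gradVec T (gamma0 T t + fn η t)) 2 (volume : Measure ℝ) := by
    refine memLp_vec (memLp_act_const T.A ?_) ?_
    · exact (memLp_smul_vector (memLp_sech (rate_pos T)) (act T.A⁻¹ T.b)).add (memLp_xPart hη)
    · have h1 : MemLp (fun t => (2 * zPart (gamma0 T t) + zPart (fn η t)) * zPart (fn η t)) 2
          (volume : Measure ℝ) := by
        refine memLp_bdd_mul (K := 2 + K) ?_ ?_ hz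
        · exact (continuous_const.mul
            (continuous_zPart.comp (continuous_gamma0 T))).aestronglyMeasurable.add hz.1
        · filter_upwards [hK] with t ht
          refine (abs_add_le _ _).trans (add_le_add ?_ ?_)
          · rw [zPart_gamma0, abs_mul, abs_two]
            linarith [abs_tanh_le_one ((1 - ‖T.b‖ ^ 2) * t)]
          · exact (PiLp.norm_apply_le (fn η t) (Sum.inr ())).trans ht
      refine (h1.sub (memLp_sech (rate_pos T))).ae_eq (Eventually.of_forall fun t => ?_)
      have h2 : zPart (gamma0 T t + fn η t) = zPart (gamma0 T t) + zPart (fn η t) := rfl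
      have h3 : (Real.cosh ((1 - ‖T.b‖ ^ 2) * t) ^ 2)⁻¹ = 1 - zPart (gamma0 T t) ^ 2 := by
        have := (Real.cosh_pos ((1 - ‖T.b‖ ^ 2) * t)).ne'
        rw [zPart_gamma0, Real.tanh_eq_sinh_div_cosh]
        field_simp
        linarith [Real.cosh_sq ((1 - ‖T.b‖ ^ 2) * t)]
      simp only [Pi.sub_apply]
      rw [h2, h3]
      ring
  have hc : ∀ i j, Continuous fun p : Phase m =>
      T.h (ε ^ 2) (vec (ε ^ 2 • xPart p) (ε * zPart p)) i j := fun i j =>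
    (T.h_smooth i j).continuous.comp (continuous_const.prodMk (continuous_vec.comp
      ((continuous_xPart.const_smul (ε ^ 2)).prodMk (continuous_const.mul continuous_zPart))))
  have hbd : ∀ i j, ∃ B, ∀ p ∈ Metric.closedBall (0 : Phase m) (L + K),
      |T.h (ε ^ 2) (vec (ε ^ 2 • xPart p) (ε * zPart p)) i j| ≤ B := fun i j =>
    (isCompact_closedBall _ _).exists_bound_of_continuousOn (hc i j).continuousOn
  choose B hB using hbd
  have hs : MemLp (fun t => scaledR T ε (gamma0 T t + fn η t)) 2 (volume : Measure ℝ) := by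
    refine MemLp.neg (memLp_act (K := B) (fun i j => (hc i j).comp_aestronglyMeasurable hp)
      (fun i j => ?_) hg)
    filter_upwards [hK] with t ht
    refine hB i j _ ?_
    rw [mem_closedBall_zero_iff]
    exact (norm_add_le _ _).trans (add_le_add (hL t) ht)
  exact memLp_vec ((memLp_xPart hs).const_smul ε⁻¹) (memLp_zPart hs)

/-- The value `𝓕_ε(η) = η̇ + Q_ε η + ζ² (b / ε, 1) - R_ε(γ₀ + η) + ((γ̇₀)_x, 0)`, where
`η = (ξ, ζ)`, as a function of time. For `ε > 0` it vanishes almost everywhere precisely if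
`γ₀ + η` solves the gradient equation. -/
def functionalFun (T : Triple m) (ε : ℝ) (η : W12 m) (t : ℝ) : Phase m :=
  dot η t + Q T ε t (fn η t) + zPart (fn η t) ^ 2 • vec (ε⁻¹ • T.b) 1
    - R T ε (gamma0 T t + fn η t) + vec (xPart (deriv (gamma0 T) t)) 0

lemma memLp_functionalFun (T : Triple m) (ε : ℝ) (η : W12 m) :
    MemLp (functionalFun T ε η) 2 (volume : Measure ℝ) := by
  obtain ⟨K, hK0, hK⟩ := W12_bounded η
  have hz := memLp_zPart (memLp_fn η)
  have h1 : MemLp (fun t => zPart (fn η t) ^ 2) 2 (volume : Measure ℝ) := by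
    simp only [sq]
    refine memLp_bdd_mul (K := K) hz.1 ?_ hz
    filter_upwards [hK] with t ht
    exact (PiLp.norm_apply_le (fn η t) (Sum.inr ())).trans ht
  have h2 : MemLp (fun t => xPart (deriv (gamma0 T) t)) 2 (volume : Measure ℝ) := by
    simp only [xPart_deriv_gamma0]
    refine memLp_smul_vector (memLp_bdd_mul (K := 2 * (1 - ‖T.b‖ ^ 2)) ?_
      (Eventually.of_forall fun t => ?_) (memLp_sech (rate_pos T))) _
    · exact (continuous_const.mul (continuous_tanh_mul _)).aestronglyMeasurable
    · have := rate_pos T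
      rw [abs_mul, abs_mul, abs_neg, abs_two, abs_of_pos this]
      exact mul_le_of_le_one_right (by positivity) (abs_tanh_le_one _)
  exact ((((memLp_dot η).add (memLp_Q T ε (memLp_fn η))).add
    (memLp_smul_vector h1 _)).sub (memLp_R T ε η)).add (memLp_vec h2 MemLp.zero')

/-- The functional `𝓕_ε : W^{1,2} → L²`. -/
def functional (T : Triple m) (ε : ℝ) (η : W12 m) : L2 m :=
  (memLp_functionalFun T ε η).toLp

/-- The formal adjoint `D_ε^* υ = - υ̇ + Q_ε υ`, as an operator `W^{1,2} → L²`. -/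
def adjointOp (T : Triple m) (ε : ℝ) (υ : W12 m) : L2 m :=
  ((memLp_dot υ).neg.add (memLp_Q T ε (memLp_fn υ))).toLp
    (fun t => - dot υ t + Q T ε t (fn υ t))

/-! ### The `ε`-weighted norms and the solutions near `γ₀` -/

/-- `‖(ξ, ζ)‖_ε² = ε² ‖ξ‖² + (ζ - ε ⟨b, ξ⟩)² / (1 - ‖b‖²)`. -/
def normSqEps (T : Triple m) (ε : ℝ) (p : Phase m) : ℝ :=
  ε ^ 2 * ‖xPart p‖ ^ 2 + (1 - ‖T.b‖ ^ 2)⁻¹ * (zPart p - ε * ⟪T.b, xPart p⟫) ^ 2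

/-- `‖η‖_{W^{1,2}_ε}`, the square root of `∫ ‖η̇(t)‖_ε² dt + ∫ ‖η(t)‖_ε² dt`. -/
def normW12Eps (T : Triple m) (ε : ℝ) (η : W12 m) : ℝ :=
  √((∫ t, normSqEps T ε (dot η t)) + ∫ t, normSqEps T ε (fn η t))

/-- `‖η‖_{L^∞_ε} = ε ‖ξ‖_{L^∞} + ‖ζ‖_{L^∞}` (both terms are finite on `W^{1,2}`). -/
def normLinftyEps (ε : ℝ) (η : W12 m) : ℝ :=
  ε * (eLpNorm (fun t => xPart (fn η t)) ⊤ (volume : Measure ℝ)).toReal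
    + (eLpNorm (fun t => zPart (fn η t)) ⊤ (volume : Measure ℝ)).toReal

/-- `η ∈ W^{1,2}` is such that `γ₀ + η` is (almost everywhere equal to) a smooth solution of the
gradient equation with parameter `ε`, `η` lies in the image of `D_ε^*`, and
`‖η‖_{W^{1,2}_ε} + ε^(1/2) ‖η‖_{L^∞_ε} ≤ C ε`. -/
structure IsNearbySolution (T : Triple m) (C ε : ℝ) (η : W12 m) : Prop where
  solution : ∃ γ : ℝ → Phase m, IsSmoothSolution T ε γ ∧
    γ =ᵐ[volume] fun t => gamma0 T t + fn η t
  mem_image : η.1.fst ∈ Set.range (adjointOp T ε)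
  bound : normW12Eps T ε η + √ε * normLinftyEps ε η ≤ C * ε

end

end BirthDeath

namespace BirthDeath

noncomputable section

variable {m : ℕ}

/-! ### Primitives of locally integrable functions -/

/-! Write `c = 1 - ‖b‖²` and `β = (b, √c)`, a unit vector. The coordinates `Phi T ε` turn `‖·‖_ε`
into the Euclidean norm (`norm_sq_Phi`) and conjugate `Q` to the symmetric family `opP = diag(A,
0)/ε + 2 tanh(ct) ββᵀ` (`Phi_Q`). The linear operator `d/dt + Q_ε` thus becomes `d/dt + opP`, with
adjoint `-d/dt + opP`.

Linear theory. Squaring the `x`-part of the equation kills the cross term `⟪y', Ay⟫`, a total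
derivative since `A` is symmetric; invertibility of `A` then gives `‖x‖ = O(ε)` in `L²`, whatever
the signature of `A`. In the `z`-direction the adjoint is `-d/dt + 2c tanh(ct)` up to a coupling to
`x`; integrating by parts against `tanh` shows that it is bounded below. For small `ε` the two
estimates combine into a lower bound for the adjoint, uniform in `ε` (`adjoint_bound`). Lax-Milgram
applied to the square of the adjoint yields a right inverse of `d/dt + opP` with values in the image
of the adjoint (`exists_rightInverse`), so the image condition costs nothing. Its `x`-component
gains a factor `ε`, which pays for the `ε⁻¹` in `PhiInv`, and the right inverse is bounded even into
unweighted `L²` (`exists_solutionOp`).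

Nonlinear theory. Relative to `γ₀`, the equation in these coordinates is `d/dt + opP` plus `nl`,
made of `ζ² β` and the error term. In `region`, the set described by the required sup bound, `nl` is
Lipschitz with constant `O(√ε)` (`exists_nl_lipschitz`), while the residual of `γ₀` is `O(ε)` in
`L²` (`exists_nl_zero_bound`). For existence, `η = S g` is inserted and the contraction principle is
applied to `g` in an `L²`-ball of radius `O(ε)` (`exists_zero`); zeros of the functional are then
smooth by bootstrapping. For transversality, the linearisation composed with `S` differs from the
identity by at most `1/2`, by the same Lipschitz constant (`exists_surjective_linearisation`). -/

/-- `U` is a primitive of the locally integrable function `v`. -/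
structure IsPrimitive {E : Type} [NormedAddCommGroup E] [NormedSpace ℝ E] (U v : ℝ → E) :
    Prop where
  locInt : LocallyIntegrable v
  sub_eq : ∀ a b, U b - U a = ∫ t in a..b, v t

namespace IsPrimitive

variable {E : Type} [NormedAddCommGroup E] [NormedSpace ℝ E] {U v : ℝ → E}

lemma intervalIntegrable (h : IsPrimitive U v) (a b : ℝ) : IntervalIntegrable v volume a b :=
  intervalIntegrable_iff.2
    ((h.locInt.integrableOn_isCompact isCompact_uIcc).mono_set Set.uIoc_subset_uIcc)

lemma eq_add (h : IsPrimitive U v) (a : ℝ) : U = fun t => (∫ s in a..t, v s) + U a :=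
  funext fun t => by rw [← h.sub_eq]; abel

lemma continuous (h : IsPrimitive U v) : Continuous U := by
  rw [h.eq_add 0]
  exact (intervalIntegral.continuous_primitive h.intervalIntegrable 0).add continuous_const

lemma ae_hasDerivAt [CompleteSpace E] (h : IsPrimitive U v) : ∀ᵐ t, HasDerivAt U (v t) t := by
  filter_upwards [_root_.LocallyIntegrable.ae_hasDerivAt_integral h.locInt] with t ht
  rw [h.eq_add 0]
  exact (ht 0).add_const _

lemma clm {F : Type} [NormedAddCommGroup F] [NormedSpace ℝ F] [CompleteSpace E] [CompleteSpace F]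
    (h : IsPrimitive U v) (L : E →L[ℝ] F) :
    IsPrimitive (fun t => L (U t)) (fun t => L (v t)) where
  locInt := by
    intro t
    obtain ⟨s, hs, hi⟩ := h.locInt t
    exact ⟨s, hs, L.integrable_comp hi⟩
  sub_eq a b := by
    rw [← map_sub, h.sub_eq, L.intervalIntegral_comp_comm (h.intervalIntegrable a b)]

lemma absolutelyContinuous {f g : ℝ → ℝ} (h : IsPrimitive f g) (a b : ℝ) :
    AbsolutelyContinuousOnInterval f a b := by
  have h1 := (h.intervalIntegrable a b).absolutelyContinuousOnInterval_intervalIntegral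
    (c := a) (by simp)
  have h2 : AbsolutelyContinuousOnInterval (fun _ : ℝ => f a) a b :=
    (LipschitzWith.const (f a)).lipschitzOnWith.absolutelyContinuousOnInterval
  rw [h.eq_add a]
  exact h1.add h2

/-- Primitives of locally integrable functions are absolutely continuous on intervals, and there the
fundamental theorem of calculus holds for products. -/
lemma mul {f g f' g' : ℝ → ℝ} (h : IsPrimitive f f') (h' : IsPrimitive g g') :
    IsPrimitive (fun t => f t * g t) (fun t => f' t * g t + f t * g' t) where
  locInt := by
    rw [locallyIntegrable_iff]
    intro k hk
    exact ((h.locInt.integrableOn_isCompact hk).mul_continuousOn h'.continuous.continuousOn hk).add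
      ((h'.locInt.integrableOn_isCompact hk).continuousOn_mul h.continuous.continuousOn hk)
  sub_eq a b := by
    rw [← (h.absolutelyContinuous a b).integral_deriv_mul_eq_sub (h'.absolutelyContinuous a b)]
    refine intervalIntegral.integral_congr_ae ?_
    filter_upwards [h.ae_hasDerivAt, h'.ae_hasDerivAt] with t h1 h2 _
    rw [h1.deriv, h2.deriv]

lemma sum {ι : Type} (s : Finset ι) {U v : ι → ℝ → E} (h : ∀ i, IsPrimitive (U i) (v i)) :
    IsPrimitive (fun t => ∑ i ∈ s, U i t) (fun t => ∑ i ∈ s, v i t) where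
  locInt := by
    rw [locallyIntegrable_iff]
    intro k hk
    exact integrable_finsetSum _ fun i _ => (h i).locInt.integrableOn_isCompact hk
  sub_eq a b := by
    rw [intervalIntegral.integral_finsetSum fun i _ => (h i).intervalIntegrable a b,
      ← Finset.sum_sub_distrib]
    exact Finset.sum_congr rfl fun i _ => (h i).sub_eq a b

lemma inner {U v U' v' : ℝ → Phase m} (h : IsPrimitive U v) (h' : IsPrimitive U' v') :
    IsPrimitive (fun t => ⟪U t, U' t⟫) (fun t => ⟪v t, U' t⟫ + ⟪U t, v' t⟫) := by
  have := IsPrimitive.sum Finset.univ fun i =>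
    (h.clm (EuclideanSpace.proj (𝕜 := ℝ) i)).mul (h'.clm (EuclideanSpace.proj (𝕜 := ℝ) i))
  convert this using 2 with t t
  · simp [PiLp.inner_apply, mul_comm]
  · simp only [PiLp.inner_apply, ← Finset.sum_add_distrib]
    refine Finset.sum_congr rfl fun i _ => ?_
    simp [mul_comm]

lemma of_contDiff {f : ℝ → ℝ} (h : ContDiff ℝ ∞ f) : IsPrimitive f (deriv f) where
  locInt := (h.continuous_deriv (by simp)).locallyIntegrable
  sub_eq a b := (intervalIntegral.integral_deriv_eq_sub
    (fun t _ => (h.differentiable (by simp)) t)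
    ((h.continuous_deriv (by simp)).intervalIntegrable a b)).symm

/-- Integrability of `g` gives `f` a limit at each end; integrability of `f` forces both limits to
be zero, and then `g` integrates to their difference. -/
lemma tendsto_integral {f g : ℝ → ℝ} (h : IsPrimitive f g) (hf : Integrable f)
    (hg : Integrable g) : ∫ t, g t = 0 ∧ Tendsto f atTop (𝓝 0) ∧ Tendsto f atBot (𝓝 0) := by
  have h1 : Tendsto f atTop (𝓝 ((∫ t in Set.Ioi 0, g t) + f 0)) := by
    rw [h.eq_add 0]
    simpa using (intervalIntegral_tendsto_integral_Ioi 0 hg.integrableOn tendsto_id).add_const (f 0)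
  have h2 : Tendsto f atBot (𝓝 (-(∫ t in Set.Iic 0, g t) + f 0)) := by
    rw [h.eq_add 0]
    have := (intervalIntegral_tendsto_integral_Iic 0 hg.integrableOn tendsto_id).neg.add_const (f 0)
    simpa [← intervalIntegral.integral_symm] using this
  have e1 := IntegrableAtFilter.eq_zero_of_tendsto (μ := volume) (hf.integrableAtFilter _)
    (by
      intro s hs
      rw [mem_atTop_sets] at hs
      obtain ⟨b, hb⟩ := hs
      rw [← top_le_iff, ← Real.volume_Ici (a := b)]
      exact measure_mono hb) h1
  have e2 := IntegrableAtFilter.eq_zero_of_tendsto (μ := volume) (hf.integrableAtFilter _)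
    (by
      intro s hs
      rw [mem_atBot_sets] at hs
      obtain ⟨b, hb⟩ := hs
      rw [← top_le_iff, ← Real.volume_Iic (a := b)]
      exact measure_mono hb) h2
  refine ⟨?_, e1 ▸ h1, e2 ▸ h2⟩
  rw [← intervalIntegral.integral_Iic_add_Ioi (b := 0) hg.integrableOn hg.integrableOn]
  linarith

lemma congr_ae {w : ℝ → E} (h : IsPrimitive U v) (hv : v =ᵐ[volume] w) : IsPrimitive U w where
  locInt := h.locInt.congr hv
  sub_eq a b := by
    rw [h.sub_eq]
    exact intervalIntegral.integral_congr_ae (hv.mono fun t ht _ => ht)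

lemma integral_test {f g φ : ℝ → ℝ} (h : IsPrimitive f g) (hφ : ContDiff ℝ ∞ φ)
    (hc : HasCompactSupport φ) : ∫ t, deriv φ t * f t = - ∫ t, φ t * g t := by
  have h1 := (of_contDiff hφ).mul h
  have hd : Continuous (deriv φ) := hφ.continuous_deriv (by simp)
  have i1 : Integrable fun t => deriv φ t * f t :=
    (hd.mul h.continuous).integrable_of_hasCompactSupport hc.deriv.mul_right
  have i2 : Integrable fun t => φ t * g t :=
    h.locInt.integrable_smul_left_of_hasCompactSupport hφ.continuous hc
  have i3 : Integrable fun t => φ t * f t :=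
    (hφ.continuous.mul h.continuous).integrable_of_hasCompactSupport hc.mul_right
  have := (h1.tendsto_integral i3 (i1.add i2)).1
  rw [integral_add i1 i2] at this
  linarith

end IsPrimitive

/-! ### Continuous representatives -/

/-- The du Bois-Reymond lemma. -/
lemma IsWeakDeriv.exists_primitive {u v : ℝ → Phase m} (hw : IsWeakDeriv u v)
    (hu : LocallyIntegrable u) (hv : LocallyIntegrable v) :
    ∃ U : ℝ → Phase m, u =ᵐ[volume] U ∧ IsPrimitive U v := by
  set V : ℝ → Phase m := fun t => ∫ s in (0 : ℝ)..t, v s with hV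
  have hVp : IsPrimitive V v := by
    refine ⟨hv, fun a b => ?_⟩
    have hi : ∀ a b, IntervalIntegrable v volume a b := fun a b => intervalIntegrable_iff.2
      ((hv.integrableOn_isCompact isCompact_uIcc).mono_set Set.uIoc_subset_uIcc)
    rw [hV]
    exact intervalIntegral.integral_interval_sub_left (hi _ _) (hi _ _)
  have hVw : ∀ φ : ℝ → ℝ, ContDiff ℝ ∞ φ → HasCompactSupport φ →
      ∫ t, deriv φ t • V t = - ∫ t, φ t • v t := by
    intro φ hφ hc
    have i1 : Integrable fun t => deriv φ t • V t :=
      ((hφ.continuous_deriv (by simp)).smul hVp.continuous).integrable_of_hasCompactSupport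
        hc.deriv.smul_right
    have i2 : Integrable fun t => φ t • v t :=
      hv.integrable_smul_left_of_hasCompactSupport hφ.continuous hc
    ext i
    have := (hVp.clm (EuclideanSpace.proj (𝕜 := ℝ) i)).integral_test hφ hc
    have e1 := (EuclideanSpace.proj (𝕜 := ℝ) i).integral_comp_comm i1
    have e2 := (EuclideanSpace.proj (𝕜 := ℝ) i).integral_comp_comm i2
    simp only [map_smul, smul_eq_mul] at e1 e2
    rw [e1, e2] at this
    exact this
  have hdl : LocallyIntegrable fun t => u t - V t := hu.sub hVp.continuous.locallyIntegrable
  let θ : ContDiffBump (0 : ℝ) := ⟨1 / 2, 1, by norm_num, by norm_num⟩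
  set ψ : ℝ → ℝ := θ.normed volume with hψ
  have hψs : ContDiff ℝ ∞ ψ := θ.contDiff_normed (n := ⊤)
  have hψc : HasCompactSupport ψ := θ.hasCompactSupport_normed
  have hψ1 : ∫ t, ψ t = 1 := θ.integral_normed
  have hψi : Integrable ψ := θ.integrable_normed
  set e := ∫ t, ψ t • (u t - V t) with he
  have key : ∀ φ : ℝ → ℝ, ContDiff ℝ ∞ φ → HasCompactSupport φ →
      ∫ t, φ t • (u t - V t - e) = 0 := by
    intro φ hφ hc
    have hφi : Integrable φ := hφ.continuous.integrable_of_hasCompactSupport hc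
    set a := ∫ t, φ t
    -- Subtracting a multiple of the fixed bump makes the mean vanish, so that the primitive of `g`
    -- has compact support and is an admissible test function.
    set g : ℝ → ℝ := fun t => φ t - a * ψ t with hg
    have hgs : ContDiff ℝ ∞ g := hφ.sub (contDiff_const.mul hψs)
    have hgc : HasCompactSupport g := hc.sub hψc.mul_left
    have hgi : Integrable g := hφi.sub (hψi.const_mul a)
    have hg0 : ∫ t, g t = 0 := by
      rw [hg, integral_sub hφi (hψi.const_mul a), integral_const_mul, hψ1, mul_one, sub_self]
    obtain ⟨r, hr⟩ : ∃ r : ℝ, ∀ t, r < |t| → g t = 0 := by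
      obtain ⟨r, hr⟩ := hgc.isCompact.isBounded.subset_closedBall (0 : ℝ)
      refine ⟨r, fun t ht => ?_⟩
      by_contra h
      have := hr (subset_tsupport g h)
      rw [mem_closedBall_zero_iff, Real.norm_eq_abs] at this
      linarith
    -- A nonnegative radius with a non-strict inequality, so that `g` also vanishes at the endpoints
    -- `±ρ`.
    obtain ⟨ρ, hρ, hr'⟩ : ∃ ρ : ℝ, 0 ≤ ρ ∧ ∀ t, ρ ≤ |t| → g t = 0 :=
      ⟨|r| + 1, by positivity, fun t ht => hr t (by linarith [le_abs_self r])⟩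
    set G : ℝ → ℝ := fun t => ∫ s in (-ρ)..t, g s with hG
    have hGd : ∀ s, HasDerivAt G (g s) s := fun s =>
      intervalIntegral.integral_hasDerivAt_right (hgs.continuous.intervalIntegrable _ _)
        (hgs.continuous.stronglyMeasurableAtFilter _ _) hgs.continuous.continuousAt
    have hGderiv : deriv G = g := funext fun s => (hGd s).deriv
    have hGs : ContDiff ℝ ∞ G :=
      contDiff_infty_iff_deriv.2 ⟨fun s => (hGd s).differentiableAt, by rw [hGderiv]; exact hgs⟩
    have hGc : HasCompactSupport G := by
      refine HasCompactSupport.intro (isCompact_Icc (a := -ρ) (b := ρ)) fun s hs => ?_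
      rw [Set.mem_Icc, not_and_or, not_le, not_le] at hs
      rcases hs with hs | hs
      · simp only [hG]
        rw [intervalIntegral.integral_symm, intervalIntegral.integral_of_le hs.le,
          setIntegral_eq_zero_of_forall_eq_zero, neg_zero]
        intro t ht
        exact hr' t ((neg_le_neg ht.2).trans (neg_le_abs t) |>.trans' (neg_neg ρ).ge)
      · simp only [hG]
        rw [intervalIntegral.integral_of_le (by linarith), ← hg0,
          ← integral_Icc_eq_integral_Ioc, setIntegral_eq_integral_of_forall_compl_eq_zero]
        intro t ht
        apply hr'
        rw [Set.mem_Icc, not_and_or, not_le, not_le] at ht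
        rcases ht with h | h
        · linarith [neg_le_abs t]
        · linarith [le_abs_self t]
    have h1 := hw G hGs hGc
    have h2 := hVw G hGs hGc
    rw [hGderiv] at h1 h2
    have iu := hu.integrable_smul_left_of_hasCompactSupport hgs.continuous hgc
    have iV := hVp.continuous.locallyIntegrable.integrable_smul_left_of_hasCompactSupport
      (μ := volume) hgs.continuous hgc
    have h3 : ∫ t, g t • (u t - V t) = 0 := by
      simp only [smul_sub]
      rw [integral_sub iu iV, h1, h2, sub_self]
    have iφ := hdl.integrable_smul_left_of_hasCompactSupport hφ.continuous hc
    have iψ := hdl.integrable_smul_left_of_hasCompactSupport hψs.continuous hψc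
    have h4 : ∫ t, g t • (u t - V t) = (∫ t, φ t • (u t - V t)) - a • e := by
      rw [he, ← integral_smul, ← integral_sub iφ (by exact iψ.smul a)]
      refine integral_congr_ae (Eventually.of_forall fun t => ?_)
      simp only [hg, sub_smul, mul_smul]
    have h5 : ∫ t, φ t • (u t - V t - e) = (∫ t, φ t • (u t - V t)) - a • e := by
      rw [← integral_smul_const, ← integral_sub iφ (hφi.smul_const e)]
      refine integral_congr_ae (Eventually.of_forall fun t => ?_)
      simp only [smul_sub]
    rw [h5, ← h4, h3]
  refine ⟨fun t => V t + e, ?_, hv, fun a b => ?_⟩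
  · filter_upwards [ae_eq_zero_of_integral_contDiff_smul_eq_zero
      (hdl.sub (locallyIntegrable_const e)) key] with t ht
    rw [Pi.sub_apply] at ht
    rw [← sub_eq_zero, ← sub_sub]
    exact ht
  · rw [← hVp.sub_eq a b]
    abel

/-! ### The structure of `W^{1,2}` -/

/-- The inclusion `W^{1,2} → L²`. -/
def incl : W12 m →L[ℝ] L2 m := (WithLp.fstL 2 ℝ (L2 m) (L2 m)).comp (W12 m).subtypeL

/-- The weak derivative as an operator `W^{1,2} → L²`. -/
def wderiv : W12 m →L[ℝ] L2 m := (WithLp.sndL 2 ℝ (L2 m) (L2 m)).comp (W12 m).subtypeL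

lemma incl_coe (η : W12 m) : (incl η : ℝ → Phase m) = fn η := rfl

lemma wderiv_coe (η : W12 m) : (wderiv η : ℝ → Phase m) = dot η := rfl

lemma W12_norm_sq (η : W12 m) : ‖η‖ ^ 2 = ‖incl η‖ ^ 2 + ‖wderiv η‖ ^ 2 :=
  WithLp.prod_norm_sq_eq_of_L2 η.1

lemma W12_ext {η η' : W12 m} (h : incl η = incl η') (h' : wderiv η = wderiv η') : η = η' := by
  have : ‖η - η'‖ ^ 2 = 0 := by rw [W12_norm_sq, map_sub, map_sub, h, h']; simp
  exact sub_eq_zero.1 (norm_eq_zero.1 (pow_eq_zero_iff two_ne_zero |>.1 this))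

lemma locallyIntegrable_Lp (f : L2 m) : LocallyIntegrable (f : ℝ → Phase m) :=
  (Lp.memLp f).locallyIntegrable (by norm_num)

lemma exists_W12 {u v : L2 m} (h : IsWeakDeriv (u : ℝ → Phase m) v) :
    ∃ η : W12 m, incl η = u ∧ wderiv η = v :=
  ⟨⟨WithLp.toLp 2 (u, v), h⟩, rfl, rfl⟩

lemma IsWeakDeriv.congr {u v u' v' : ℝ → Phase m} (h : IsWeakDeriv u v) (hu : u =ᵐ[volume] u')
    (hv : v =ᵐ[volume] v') : IsWeakDeriv u' v' := by
  intro φ hφ hc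
  have h1 : ∫ t, deriv φ t • u' t = ∫ t, deriv φ t • u t :=
    integral_congr_ae (hu.mono fun t ht => by simp only [ht])
  have h2 : ∫ t, φ t • v' t = ∫ t, φ t • v t :=
    integral_congr_ae (hv.mono fun t ht => by simp only [ht])
  rw [h1, h2]
  exact h φ hφ hc

/-- The continuous representative of an element of `W^{1,2}`. -/
lemma exists_rep (η : W12 m) : ∃ U : ℝ → Phase m, fn η =ᵐ[volume] U ∧ IsPrimitive U (dot η) :=
  IsWeakDeriv.exists_primitive η.2 (locallyIntegrable_Lp _) (locallyIntegrable_Lp _)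

lemma integrable_inner_of_ae {f g : L2 m} {F G : ℝ → Phase m} (hf : f =ᵐ[volume] F)
    (hg : g =ᵐ[volume] G) : Integrable (fun t => ⟪F t, G t⟫) :=
  (L2.integrable_inner (𝕜 := ℝ) f g).congr (by
    filter_upwards [hf, hg] with t h1 h2
    rw [h1, h2])

lemma inner_eq_integral_of_ae {f g : L2 m} {F G : ℝ → Phase m} (hf : f =ᵐ[volume] F)
    (hg : g =ᵐ[volume] G) : ⟪f, g⟫ = ∫ t, ⟪F t, G t⟫ := by
  rw [L2.inner_def]
  refine integral_congr_ae ?_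
  filter_upwards [hf, hg] with t h1 h2
  rw [h1, h2]

lemma norm_sq_eq_integral_of_ae {f : L2 m} {F : ℝ → Phase m} (hf : f =ᵐ[volume] F) :
    ‖f‖ ^ 2 = ∫ t, ‖F t‖ ^ 2 := by
  rw [← real_inner_self_eq_norm_sq, inner_eq_integral_of_ae hf hf]
  simp

/-- Integration by parts. -/
lemma inner_wderiv_add (η η' : W12 m) : ⟪wderiv η, incl η'⟫ + ⟪incl η, wderiv η'⟫ = 0 := by
  obtain ⟨U, hU, hp⟩ := exists_rep η
  obtain ⟨U', hU', hp'⟩ := exists_rep η'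
  have h := hp.inner hp'
  have e1 : wderiv η =ᵐ[volume] dot η := ae_eq_rfl
  have e2 : wderiv η' =ᵐ[volume] dot η' := ae_eq_rfl
  have hU : incl η =ᵐ[volume] U := hU
  have hU' : incl η' =ᵐ[volume] U' := hU'
  have i1 := integrable_inner_of_ae e1 hU'
  have i2 := integrable_inner_of_ae hU e2
  rw [inner_eq_integral_of_ae e1 hU', inner_eq_integral_of_ae hU e2, ← integral_add i1 i2]
  exact (h.tendsto_integral (integrable_inner_of_ae hU hU') (i1.add i2)).1

/-- The Sobolev embedding, with decay at infinity. -/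
lemma rep_decay (η : W12 m) {U : ℝ → Phase m} (hU : fn η =ᵐ[volume] U)
    (hp : IsPrimitive U (dot η)) :
    Tendsto U atTop (𝓝 0) ∧ Tendsto U atBot (𝓝 0) ∧ ∀ t, ‖U t‖ ≤ ‖η‖ := by
  have h := hp.inner hp
  have e1 : wderiv η =ᵐ[volume] dot η := ae_eq_rfl
  have hU : incl η =ᵐ[volume] U := hU
  have i1 := integrable_inner_of_ae e1 hU
  have i2 := integrable_inner_of_ae hU e1
  have i3 := integrable_inner_of_ae hU hU
  have i4 := integrable_inner_of_ae e1 e1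
  obtain ⟨-, h1, h2⟩ := h.tendsto_integral i3 (i1.add i2)
  have hn : ∀ l : Filter ℝ, Tendsto (fun t => ⟪U t, U t⟫) l (𝓝 0) → Tendsto U l (𝓝 0) := by
    intro l hl
    rw [tendsto_zero_iff_norm_tendsto_zero]
    have := (Real.continuous_sqrt.tendsto 0).comp hl
    rw [Real.sqrt_zero] at this
    refine this.congr fun t => ?_
    rw [Function.comp_apply, real_inner_self_eq_norm_sq, Real.sqrt_sq (norm_nonneg _)]
  refine ⟨hn _ h1, hn _ h2, fun t => ?_⟩
  refine le_of_sq_le_sq ?_ (norm_nonneg _)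
  -- The difference is the integral of `2⟪U, U̇⟫ ≤ ‖U‖² + ‖U̇‖²`; letting `s → -∞` afterwards gives
  -- the embedding with constant `1`.
  have hb : ∀ s, ⟪U t, U t⟫ - ⟪U s, U s⟫ ≤ ‖η‖ ^ 2 := by
    intro s
    rw [h.sub_eq s t, W12_norm_sq, norm_sq_eq_integral_of_ae hU, norm_sq_eq_integral_of_ae e1]
    simp only [real_inner_self_eq_norm_sq] at i3 i4
    rw [← integral_add i3 i4]
    refine (Real.le_norm_self _).trans
      ((intervalIntegral.norm_integral_le_integral_norm_uIoc).trans ?_)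
    refine (setIntegral_le_integral (i1.add i2).norm
      (Eventually.of_forall fun _ => norm_nonneg _)).trans ?_
    refine integral_mono (i1.add i2).norm (i3.add i4) fun r => ?_
    simp only [Pi.add_apply]
    rw [real_inner_comm, ← two_mul, Real.norm_eq_abs, abs_mul, abs_two]
    nlinarith [abs_real_inner_le_norm (U r) (dot η r), sq_nonneg (‖U r‖ - ‖dot η r‖)]
  have := le_of_tendsto (tendsto_const_nhds.sub h2) (Eventually.of_forall hb)
  rwa [sub_zero, real_inner_self_eq_norm_sq] at this

lemma ae_norm_le (η : W12 m) : ∀ᵐ t, ‖fn η t‖ ≤ ‖η‖ := by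
  obtain ⟨U, hU, hp⟩ := exists_rep η
  filter_upwards [hU] with t ht
  rw [ht]
  exact (rep_decay η hU hp).2.2 t

/-! ### Pointwise multiplication operators on `L²` -/

/-- `P` is a measurable and essentially bounded family of operators. -/
structure EssBdd (P : ℝ → Phase m →L[ℝ] Phase m) : Prop where
  meas : AEStronglyMeasurable P (volume : Measure ℝ)
  bdd : ∃ K : ℝ, ∀ᵐ t, ‖P t‖ ≤ K

lemma EssBdd.const (L : Phase m →L[ℝ] Phase m) : EssBdd fun _ => L :=
  ⟨aestronglyMeasurable_const, ‖L‖, Eventually.of_forall fun _ => le_rfl⟩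

lemma EssBdd.memLp {P : ℝ → Phase m →L[ℝ] Phase m} (hP : EssBdd P) (f : L2 m) :
    MemLp (fun t => P t (f t)) 2 (volume : Measure ℝ) := by
  obtain ⟨K, hK⟩ := hP.bdd
  refine (Lp.memLp f).of_le_mul (c := K)
    (isBoundedBilinearMap_apply.continuous.comp_aestronglyMeasurable
      (hP.meas.prodMk (Lp.memLp f).1)) ?_
  filter_upwards [hK] with t ht
  exact (P t).le_of_opNorm_le ht _

/-- Pointwise application of the operators `P t`. -/
def mulOp (P : ℝ → Phase m →L[ℝ] Phase m) (hP : EssBdd P) : L2 m →L[ℝ] L2 m :=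
  LinearMap.mkContinuousOfExistsBound
    { toFun := fun f => (hP.memLp f).toLp
      map_add' := fun f g => by
        apply Lp.ext
        filter_upwards [(hP.memLp (f + g)).coeFn_toLp, (hP.memLp f).coeFn_toLp,
          (hP.memLp g).coeFn_toLp, Lp.coeFn_add f g,
          Lp.coeFn_add ((hP.memLp f).toLp) ((hP.memLp g).toLp)] with t h1 h2 h3 h4 h5
        rw [h1, h5, h4, Pi.add_apply, Pi.add_apply, h2, h3, map_add]
      map_smul' := fun c f => by
        apply Lp.ext
        filter_upwards [(hP.memLp (c • f)).coeFn_toLp, (hP.memLp f).coeFn_toLp,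
          Lp.coeFn_smul c f, Lp.coeFn_smul c ((hP.memLp f).toLp)] with t h1 h2 h3 h4
        rw [h1, RingHom.id_apply, h4, h3, Pi.smul_apply, Pi.smul_apply, h2, map_smul] }
    (by
      obtain ⟨K, hK⟩ := hP.bdd
      refine ⟨K, fun f => Lp.norm_le_mul_norm_of_ae_le_mul ?_⟩
      filter_upwards [hK, (hP.memLp f).coeFn_toLp] with t ht h1
      change ‖(hP.memLp f).toLp _ t‖ ≤ _
      rw [h1]
      exact (P t).le_of_opNorm_le ht _)

lemma coeFn_mulOp {P : ℝ → Phase m →L[ℝ] Phase m} (hP : EssBdd P) (f : L2 m) :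
    mulOp P hP f =ᵐ[volume] fun t => P t (f t) := (hP.memLp f).coeFn_toLp

lemma inner_mulOp {P P' : ℝ → Phase m →L[ℝ] Phase m} (hP : EssBdd P) (hP' : EssBdd P')
    (hs : ∀ t x y, ⟪P t x, y⟫ = ⟪x, P' t y⟫) (f g : L2 m) :
    ⟪mulOp P hP f, g⟫ = ⟪f, mulOp P' hP' g⟫ := by
  rw [inner_eq_integral_of_ae (coeFn_mulOp hP f) ae_eq_rfl,
    inner_eq_integral_of_ae ae_eq_rfl (coeFn_mulOp hP' g)]
  simp only [hs]

/-! ### Test functions and completeness -/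

/-- The test function `φ e`. -/
def test (φ : ℝ → ℝ) (hφ : Continuous φ) (hc : HasCompactSupport φ) (e : Phase m) : L2 m :=
  ((hφ.smul continuous_const).memLp_of_hasCompactSupport hc.smul_right :
    MemLp (fun t => φ t • e) 2 (volume : Measure ℝ)).toLp

lemma coeFn_test {φ : ℝ → ℝ} (hφ : Continuous φ) (hc : HasCompactSupport φ) (e : Phase m) :
    test φ hφ hc e =ᵐ[volume] fun t => φ t • e := MemLp.coeFn_toLp _

lemma inner_test {φ : ℝ → ℝ} (hφ : Continuous φ) (hc : HasCompactSupport φ) (e : Phase m)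
    (f : L2 m) : ⟪test φ hφ hc e, f⟫ = ⟪e, ∫ t, φ t • f t⟫ := by
  rw [inner_eq_integral_of_ae (coeFn_test hφ hc e) ae_eq_rfl,
    ← integral_inner (integrable_test_smul hφ hc (Lp.memLp f))]
  simp only [inner_smul_left, inner_smul_right, conj_trivial]

/-- Testing against `φ e` for all vectors `e` expresses the weak derivative through continuous
functionals on `L²`; this makes `W12` closed and matches the output of Lax-Milgram. -/
lemma isWeakDeriv_iff (u v : L2 m) : IsWeakDeriv (u : ℝ → Phase m) v ↔
    ∀ (φ : ℝ → ℝ) (hφ : ContDiff ℝ ∞ φ) (hc : HasCompactSupport φ) (e : Phase m),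
      ⟪test (deriv φ) (hφ.continuous_deriv (by simp)) hc.deriv e, u⟫
        = -⟪test φ hφ.continuous hc e, v⟫ := by
  constructor
  · intro h φ hφ hc e
    rw [inner_test, inner_test, h φ hφ hc, inner_neg_right]
  · intro h φ hφ hc
    refine ext_inner_left ℝ fun e => ?_
    have := h φ hφ hc e
    rwa [inner_test, inner_test, ← inner_neg_right] at this

lemma isClosed_W12 : IsClosed (W12 m : Set (WithLp 2 (L2 m × L2 m))) := by
  have : (W12 m : Set (WithLp 2 (L2 m × L2 m))) = ⋂ (φ : ℝ → ℝ) (hφ : ContDiff ℝ ∞ φ)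
      (hc : HasCompactSupport φ) (e : Phase m),
      {w | ⟪test (deriv φ) (hφ.continuous_deriv (by simp)) hc.deriv e,
          WithLp.fstL 2 ℝ (L2 m) (L2 m) w⟫
        = -⟪test φ hφ.continuous hc e, WithLp.sndL 2 ℝ (L2 m) (L2 m) w⟫} := by
    ext w
    simp only [Set.mem_iInter, Set.mem_ofPred_eq]
    exact isWeakDeriv_iff w.fst w.snd
  rw [this]
  exact isClosed_iInter fun φ => isClosed_iInter fun hφ => isClosed_iInter fun hc =>
    isClosed_iInter fun e => isClosed_eq (by fun_prop) (by fun_prop)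

instance : CompleteSpace (W12 m) := isClosed_W12.completeSpace_coe

lemma exists_W12_test {φ : ℝ → ℝ} (hφ : ContDiff ℝ ∞ φ) (hc : HasCompactSupport φ)
    (e : Phase m) : ∃ η : W12 m, incl η = test φ hφ.continuous hc e ∧
      wderiv η = test (deriv φ) (hφ.continuous_deriv (by simp)) hc.deriv e := by
  apply exists_W12
  refine IsWeakDeriv.congr (u := fun t => φ t • e) (v := fun t => deriv φ t • e) ?_
    (coeFn_test _ hc e).symm (coeFn_test _ hc.deriv e).symm
  intro ψ hψ hψc
  have := (IsPrimitive.of_contDiff hφ).integral_test hψ hψc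
  simp only [smul_smul]
  rw [integral_smul_const, integral_smul_const, this, neg_smul]

lemma isWeakDeriv_of_inner {u v : L2 m} (h : ∀ η : W12 m, ⟪wderiv η, u⟫ = -⟪incl η, v⟫) :
    IsWeakDeriv (u : ℝ → Phase m) v := by
  rw [isWeakDeriv_iff]
  intro φ hφ hc e
  obtain ⟨η, h1, h2⟩ := exists_W12_test hφ hc e
  have := h η
  rwa [h1, h2] at this

/-- If `φ` is a test function, so is `φ z`; inserting it into the definition of the weak derivative
gives the product rule. -/
lemma exists_mul_W12 {z : ℝ → ℝ} (hz : ContDiff ℝ ∞ z) (L : Phase m →L[ℝ] Phase m)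
    (h1 : EssBdd fun t => z t • L) (h2 : EssBdd fun t => deriv z t • L) (η : W12 m) :
    ∃ η' : W12 m, incl η' = mulOp _ h1 (incl η) ∧
      wderiv η' = mulOp _ h1 (wderiv η) + mulOp _ h2 (incl η) := by
  apply exists_W12
  refine IsWeakDeriv.congr (u := fun t => z t • L (fn η t))
    (v := fun t => z t • L (dot η t) + deriv z t • L (fn η t)) ?_ (coeFn_mulOp h1 _).symm ?_
  · intro φ hφ hc
    have hd : ∀ t, deriv (fun s => φ s * z s) t = deriv φ t * z t + φ t * deriv z t := fun t =>
      deriv_fun_mul (hφ.differentiable (by simp) t) (hz.differentiable (by simp) t)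
    have h := η.2 (fun t => φ t * z t) (hφ.mul hz) hc.mul_right
    change ∫ t, deriv (fun s => φ s * z s) t • fn η t = -∫ t, (φ t * z t) • dot η t at h
    simp only [hd] at h
    have hd1 : Continuous (deriv φ) := hφ.continuous_deriv (by simp)
    have hd2 : Continuous (deriv z) := hz.continuous_deriv (by simp)
    have i1 := integrable_test_smul (hd1.mul hz.continuous) hc.deriv.mul_right (memLp_fn η)
    have i2 := integrable_test_smul (hφ.continuous.mul hd2) hc.mul_right (memLp_fn η)
    have i3 := integrable_test_smul (hφ.continuous.mul hz.continuous) hc.mul_right (memLp_dot η)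
    simp only [add_smul] at h
    simp only [Pi.mul_apply] at i1 i2 i3
    rw [integral_add i1 i2] at h
    have h' := congrArg L h
    rw [map_add, map_neg, ← L.integral_comp_comm i1, ← L.integral_comp_comm i2,
      ← L.integral_comp_comm i3] at h'
    have e : ∫ t, φ t • (z t • L (dot η t) + deriv z t • L (fn η t))
        = (∫ t, L ((φ t * z t) • dot η t)) + ∫ t, L ((φ t * deriv z t) • fn η t) := by
      rw [← integral_add (L.integrable_comp i3) (L.integrable_comp i2)]
      simp only [map_smul, smul_add, smul_smul]
    rw [e]
    simp only [smul_smul, map_smul] at h' ⊢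
    rw [neg_add, ← h']
    abel
  · filter_upwards [coeFn_mulOp h1 (wderiv η), coeFn_mulOp h2 (incl η),
      Lp.coeFn_add (mulOp _ h1 (wderiv η)) (mulOp _ h2 (incl η))] with t e1 e2 e3
    rw [e3, Pi.add_apply, e1, e2]
    rfl

lemma exists_map_W12 (L : Phase m →L[ℝ] Phase m) (η : W12 m) :
    ∃ η' : W12 m, incl η' = mulOp _ (EssBdd.const L) (incl η) ∧
      wderiv η' = mulOp _ (EssBdd.const L) (wderiv η) := by
  apply exists_W12
  refine IsWeakDeriv.congr (u := fun t => L (fn η t)) (v := fun t => L (dot η t)) ?_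
    (coeFn_mulOp _ _).symm (coeFn_mulOp _ _).symm
  intro φ hφ hc
  have h := η.2 φ hφ hc
  change ∫ t, deriv φ t • fn η t = -∫ t, φ t • dot η t at h
  have h' := congrArg L h
  rw [map_neg, ← L.integral_comp_comm
      (integrable_test_smul (hφ.continuous_deriv (by simp)) hc.deriv (memLp_fn η)),
    ← L.integral_comp_comm (integrable_test_smul hφ.continuous hc (memLp_dot η))] at h'
  simpa only [map_smul] using h'

/-! ### Right inverses with values in the image of the adjoint -/

/-- A lift is unique once the function and its derivative are prescribed, so pointwise choices form
a linear map. Linearity matters later, where differences `S f - S g` are estimated as `S (f - g)`.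
-/
lemma exists_linear_W12 (X : L2 m →ₗ[ℝ] L2 m) (M : L2 m →L[ℝ] L2 m)
    (h : ∀ g, IsWeakDeriv (X g : ℝ → Phase m) (g - M (X g) : L2 m)) :
    ∃ S : L2 m →ₗ[ℝ] W12 m, (∀ g, incl (S g) = X g) ∧ ∀ g, wderiv (S g) + M (X g) = g := by
  choose S hS1 hS2 using fun g => exists_W12 (h g)
  refine ⟨{ toFun := S, map_add' := fun f g => ?_, map_smul' := fun c f => ?_ }, hS1, fun g => ?_⟩
  · apply W12_ext
    · simp only [map_add, hS1]
    · simp only [map_add, hS2]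
      abel
  · apply W12_ext
    · simp only [map_smul, hS1, RingHom.id_apply]
    · simp only [map_smul, hS2, RingHom.id_apply, smul_sub]
  · exact (congrArg (· + M (X g)) (hS2 g)).trans (sub_add_cancel g _)

/-- Let `B = -d + Mι` be the adjoint. The lower bound makes `⟪Bv, Bu⟫` coercive, so Lax-Milgram
solves `B*B V g = ι* g`. Then `Y = B V g` satisfies `⟪Y, Bu⟫ = ⟪g, ιu⟫` for all `u`, the weak form
of `Ẏ + MY = g`. -/
lemma exists_weak_solution {H K : Type*} [NormedAddCommGroup H] [InnerProductSpace ℝ H]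
    [CompleteSpace H] [NormedAddCommGroup K] [InnerProductSpace ℝ K] [CompleteSpace K]
    (ι d : H →L[ℝ] K) (hH : ∀ v, ‖v‖ ^ 2 = ‖ι v‖ ^ 2 + ‖d v‖ ^ 2) (M : K →L[ℝ] K)
    (hM : ∀ f g, ⟪M f, g⟫ = ⟪f, M g⟫) {C : ℝ} (hC0 : 0 ≤ C)
    (hC : ∀ v, ‖ι v‖ ≤ C * ‖-d v + M (ι v)‖) :
    ∃ (V : K →ₗ[ℝ] H) (Y : K →ₗ[ℝ] K), (∀ g, Y g = -d (V g) + M (ι (V g))) ∧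
      (∀ g u, ⟪d u, Y g⟫ = -⟪ι u, g - M (Y g)⟫) ∧ ∀ g, ‖Y g‖ ≤ C * ‖g‖ := by
  obtain ⟨B, hBv⟩ : ∃ B : H →L[ℝ] K, ∀ v, B v = -d v + M (ι v) :=
    ⟨-d + M.comp ι, fun v => rfl⟩
  simp only [← hBv] at hC ⊢
  set D := C ^ 2 + (1 + ‖M‖ * C) ^ 2 with hD
  have hD0 : 0 < D := by
    have : 0 < 1 + ‖M‖ * C := by positivity
    positivity
  have hB : ∀ v, ‖v‖ ^ 2 ≤ D * ‖B v‖ ^ 2 := by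
    intro v
    rw [hH]
    have h1 := hC v
    have h2 : ‖d v‖ ≤ (1 + ‖M‖ * C) * ‖B v‖ := by
      have e : d v = M (ι v) - B v := by rw [hBv]; abel
      rw [e]
      refine (norm_sub_le _ _).trans ?_
      have := (M.le_opNorm (ι v)).trans (mul_le_mul_of_nonneg_left h1 (norm_nonneg M))
      linarith
    have h3 := pow_le_pow_left₀ (norm_nonneg _) h1 2
    have h4 := pow_le_pow_left₀ (norm_nonneg _) h2 2
    rw [hD]
    linarith [mul_pow C ‖B v‖ 2, mul_pow (1 + ‖M‖ * C) ‖B v‖ 2]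
  set a : H →L[ℝ] H →L[ℝ] ℝ := (innerSL ℝ).bilinearComp B B with ha
  have hav : ∀ v u, a v u = ⟪B v, B u⟫ := fun v u => rfl
  have hcoer : IsCoercive a := by
    refine ⟨D⁻¹, inv_pos.2 hD0, fun v => ?_⟩
    rw [hav, real_inner_self_eq_norm_sq, mul_assoc, ← sq, inv_mul_le_iff₀ hD0]
    exact hB v
  set E := hcoer.continuousLinearEquivOfBilin with hE
  set V : K →ₗ[ℝ] H := (E.symm : H →ₗ[ℝ] H) ∘ₗ (ContinuousLinearMap.adjoint ι : K →L[ℝ] H)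
  have hV : ∀ g u, ⟪B (V g), B u⟫ = ⟪g, ι u⟫ := by
    intro g u
    rw [← hav, ← hcoer.continuousLinearEquivOfBilin_apply,
      ← ContinuousLinearMap.adjoint_inner_left]
    congr 1
    exact E.apply_symm_apply _
  refine ⟨V, (B : H →ₗ[ℝ] K) ∘ₗ V, fun g => rfl, fun g u => ?_, fun g => ?_⟩
  · have h1 := hV g u
    rw [hBv u, inner_add_right, inner_neg_right, ← hM] at h1
    change ⟪d u, B (V g)⟫ = -⟪ι u, g - M (B (V g))⟫
    rw [real_inner_comm, inner_sub_right, real_inner_comm g, real_inner_comm (M (B (V g)))]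
    linarith
  -- Taking `u = V g` gives `‖BVg‖² = ⟪g, ιVg⟫ ≤ ‖g‖ C ‖BVg‖`, from which one factor is cancelled.
  · have h1 := (hV g (V g)).le.trans (real_inner_le_norm _ _)
    have h2 := h1.trans (mul_le_mul_of_nonneg_left (hC (V g)) (norm_nonneg g))
    rw [real_inner_self_eq_norm_sq] at h2
    change ‖B (V g)‖ ≤ C * ‖g‖
    by_cases h0 : ‖B (V g)‖ = 0
    · rw [h0]; positivity
    · have : 0 < ‖B (V g)‖ := lt_of_le_of_ne (norm_nonneg _) (Ne.symm h0)
      nlinarith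

/-- If `-d/dt + P` is bounded below, then `d/dt + P` has a bounded right inverse with values in the
image of `-d/dt + P`. -/
theorem exists_rightInverse {P : ℝ → Phase m →L[ℝ] Phase m} (hP : EssBdd P)
    (hs : ∀ t x y, ⟪P t x, y⟫ = ⟪x, P t y⟫) {C : ℝ} (hC0 : 0 ≤ C)
    (hC : ∀ v : W12 m, ‖incl v‖ ≤ C * ‖-wderiv v + mulOp P hP (incl v)‖) :
    ∃ S : L2 m →ₗ[ℝ] W12 m, ∀ g, wderiv (S g) + mulOp P hP (incl (S g)) = g ∧
      (∃ v, incl (S g) = -wderiv v + mulOp P hP (incl v)) ∧ ‖incl (S g)‖ ≤ C * ‖g‖ := by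
  obtain ⟨V, Y, h1, h2, h3⟩ := exists_weak_solution incl wderiv W12_norm_sq (mulOp P hP)
    (inner_mulOp hP hP hs) hC0 hC
  obtain ⟨S, hS1, hS2⟩ := exists_linear_W12 Y (mulOp P hP) fun g => isWeakDeriv_of_inner (h2 g)
  refine ⟨S, fun g => ⟨?_, ⟨V g, (hS1 g).trans (h1 g)⟩, (congrArg norm (hS1 g)).trans_le (h3 g)⟩⟩
  rw [hS1]
  exact hS2 g

/-! ### Linear algebra in phase space -/

@[simp] lemma xPart_vec (x : XSpace m) (z : ℝ) : xPart (vec x z) = x := rfl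

@[simp] lemma zPart_vec (x : XSpace m) (z : ℝ) : zPart (vec x z) = z := rfl

lemma Phase.ext_parts {p q : Phase m} (hx : xPart p = xPart q) (hz : zPart p = zPart q) :
    p = q := by
  ext i
  rcases i with i | i
  · exact congrArg (fun x : XSpace m => x i) hx
  · exact hz

@[simp] lemma xPart_add (p q : Phase m) : xPart (p + q) = xPart p + xPart q := rfl
@[simp] lemma zPart_add (p q : Phase m) : zPart (p + q) = zPart p + zPart q := rfl
@[simp] lemma xPart_sub (p q : Phase m) : xPart (p - q) = xPart p - xPart q := rfl
@[simp] lemma zPart_sub (p q : Phase m) : zPart (p - q) = zPart p - zPart q := rfl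
@[simp] lemma xPart_neg (p : Phase m) : xPart (-p) = -xPart p := rfl
@[simp] lemma zPart_neg (p : Phase m) : zPart (-p) = -zPart p := rfl
@[simp] lemma xPart_smul (r : ℝ) (p : Phase m) : xPart (r • p) = r • xPart p := rfl
@[simp] lemma zPart_smul (r : ℝ) (p : Phase m) : zPart (r • p) = r * zPart p := rfl
@[simp] lemma xPart_zero : xPart (0 : Phase m) = 0 := rfl
@[simp] lemma zPart_zero : zPart (0 : Phase m) = 0 := rfl

lemma inner_eq_parts (p q : Phase m) : ⟪p, q⟫ = ⟪xPart p, xPart q⟫ + zPart p * zPart q := by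
  simp [PiLp.inner_apply, xPart, zPart, mul_comm]

lemma norm_sq_eq_parts (p : Phase m) : ‖p‖ ^ 2 = ‖xPart p‖ ^ 2 + zPart p ^ 2 := by
  rw [← real_inner_self_eq_norm_sq, inner_eq_parts, real_inner_self_eq_norm_sq, sq (zPart p)]

lemma norm_xPart_le (p : Phase m) : ‖xPart p‖ ≤ ‖p‖ :=
  le_of_sq_le_sq (by nlinarith [norm_sq_eq_parts p, sq_nonneg (zPart p)]) (norm_nonneg _)

lemma abs_zPart_le (p : Phase m) : |zPart p| ≤ ‖p‖ :=
  le_of_sq_le_sq (by rw [sq_abs]; nlinarith [norm_sq_eq_parts p, sq_nonneg ‖xPart p‖])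
    (norm_nonneg _)

lemma norm_le_parts (p : Phase m) : ‖p‖ ≤ ‖xPart p‖ + |zPart p| := by
  refine le_of_sq_le_sq ?_ (by positivity)
  rw [norm_sq_eq_parts, ← sq_abs (zPart p)]
  nlinarith [norm_nonneg (xPart p), abs_nonneg (zPart p)]

/-- A linear map of phase space given by its parts. -/
def mkL (f : Phase m → Phase m) (h1 : ∀ p q, f (p + q) = f p + f q)
    (h2 : ∀ (r : ℝ) p, f (r • p) = r • f p) : Phase m →L[ℝ] Phase m :=
  LinearMap.toContinuousLinearMap { toFun := f, map_add' := h1, map_smul' := h2 }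

section act

variable {ι : Type} [Fintype ι] [DecidableEq ι]

lemma act_add (M : Matrix ι ι ℝ) (v w : EuclideanSpace ℝ ι) :
    act M (v + w) = act M v + act M w := by
  ext i; simp [act, Matrix.mulVec_add]

lemma act_sub (M : Matrix ι ι ℝ) (v w : EuclideanSpace ℝ ι) :
    act M (v - w) = act M v - act M w := by
  ext i; simp [act, Matrix.mulVec_sub]

lemma act_smul (M : Matrix ι ι ℝ) (r : ℝ) (v : EuclideanSpace ℝ ι) :
    act M (r • v) = r • act M v := by
  ext i; simp [act, Matrix.mulVec_smul]

lemma sub_act (M N : Matrix ι ι ℝ) (v : EuclideanSpace ℝ ι) :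
    act (M - N) v = act M v - act N v := by
  ext i; simp [act, Matrix.sub_mulVec]

lemma inner_act {M : Matrix ι ι ℝ} (hM : M.IsSymm) (v w : EuclideanSpace ℝ ι) :
    ⟪act M v, w⟫ = ⟪v, act M w⟫ := by
  simp only [EuclideanSpace.inner_eq_star_dotProduct, act, star_trivial]
  rw [Matrix.dotProduct_mulVec, ← Matrix.mulVec_transpose, hM.eq]

lemma act_inv_act {M : Matrix ι ι ℝ} (hM : IsUnit M) (v : EuclideanSpace ℝ ι) :
    act M⁻¹ (act M v) = v := by
  ext i
  simp [act, Matrix.mulVec_mulVec, Matrix.nonsing_inv_mul _ ((Matrix.isUnit_iff_isUnit_det _).1 hM)]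

lemma act_act_inv {M : Matrix ι ι ℝ} (hM : IsUnit M) (v : EuclideanSpace ℝ ι) :
    act M (act M⁻¹ v) = v := by
  ext i
  simp [act, Matrix.mulVec_mulVec, Matrix.mul_nonsing_inv _ ((Matrix.isUnit_iff_isUnit_det _).1 hM)]

lemma norm_act_le (M : Matrix ι ι ℝ) (v : EuclideanSpace ℝ ι) :
    ‖act M v‖ ≤ (∑ i, ∑ j, |M i j|) * ‖v‖ := by
  have h1 : ‖act M v‖ ≤ ∑ i, |act M v i| := by
    refine le_of_sq_le_sq ?_ (Finset.sum_nonneg fun _ _ => abs_nonneg _)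
    rw [EuclideanSpace.norm_sq_eq]
    exact (Finset.sum_sq_le_sq_sum_of_nonneg fun i _ => abs_nonneg (act M v i))
  refine h1.trans ?_
  rw [Finset.sum_mul]
  refine Finset.sum_le_sum fun i _ => ?_
  rw [Finset.sum_mul]
  refine (Finset.abs_sum_le_sum_abs _ _).trans (Finset.sum_le_sum fun j _ => ?_)
  rw [abs_mul]
  exact mul_le_mul_of_nonneg_left (PiLp.norm_apply_le v j) (abs_nonneg _)

end act

/-! ### The unit vector `β` and the conjugated operator family -/

/-- The rate `1 - ‖b‖²`. -/
def rate (T : Triple m) : ℝ := 1 - ‖T.b‖ ^ 2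

lemma rate_pos' (T : Triple m) : 0 < rate T := rate_pos T

/-- The unit vector `(b, √(1 - ‖b‖²))`. -/
def unitVec (T : Triple m) : Phase m := vec T.b √(rate T)

lemma norm_unitVec (T : Triple m) : ‖unitVec T‖ = 1 := by
  have : ‖unitVec T‖ ^ 2 = 1 := by
    rw [norm_sq_eq_parts, unitVec, xPart_vec, zPart_vec, Real.sq_sqrt (rate_pos' T).le, rate]
    ring
  exact (pow_eq_one_iff_of_nonneg (norm_nonneg _) two_ne_zero).1 this

/-- `diag(A, 0)`. -/
def opA (T : Triple m) : Phase m →L[ℝ] Phase m :=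
  mkL (fun p => vec (act T.A (xPart p)) 0)
    (fun p q => Phase.ext_parts (by simp [act_add]) (by simp))
    (fun r p => Phase.ext_parts (by simp [act_smul]) (by simp))

@[simp] lemma opA_apply (T : Triple m) (p : Phase m) : opA T p = vec (act T.A (xPart p)) 0 := rfl

/-- The projection to the `z`-axis. -/
def projZ : Phase m →L[ℝ] Phase m :=
  mkL (fun p => vec 0 (zPart p))
    (fun p q => Phase.ext_parts (by simp) (by simp))
    (fun r p => Phase.ext_parts (by simp) (by simp))

@[simp] lemma projZ_apply (p : Phase m) : projZ p = vec 0 (zPart p) := rfl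

/-- The orthogonal projection to the line spanned by `(b, √(1 - ‖b‖²))`. -/
def opB (T : Triple m) : Phase m →L[ℝ] Phase m :=
  (innerSL ℝ (unitVec T)).smulRight (unitVec T)

@[simp] lemma opB_apply (T : Triple m) (p : Phase m) :
    opB T p = ⟪unitVec T, p⟫ • unitVec T := rfl

lemma norm_opB_apply_le (T : Triple m) (p : Phase m) : ‖opB T p‖ ≤ ‖p‖ := by
  rw [opB_apply, norm_smul, norm_unitVec, mul_one]
  exact (norm_inner_le_norm _ _).trans (by rw [norm_unitVec, one_mul])

/-- The profile `tanh((1 - ‖b‖²) t)`. -/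
def prof (T : Triple m) (t : ℝ) : ℝ := Real.tanh (rate T * t)

lemma abs_prof_le (T : Triple m) (t : ℝ) : |prof T t| ≤ 1 := abs_tanh_le_one _

lemma hasDerivAt_prof (T : Triple m) (t : ℝ) :
    HasDerivAt (prof T) (rate T * (1 - prof T t ^ 2)) t := by
  have h := (Real.cosh_pos (rate T * t)).ne'
  have h0 : HasDerivAt (fun t => rate T * t) (rate T) t := by
    simpa using (hasDerivAt_id t).const_mul (rate T)
  have h1 := h0.sinh.div h0.cosh h
  have e : prof T = fun t => Real.sinh (rate T * t) / Real.cosh (rate T * t) :=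
    funext fun t => Real.tanh_eq_sinh_div_cosh _
  rw [e]
  refine h1.congr_deriv ?_
  field_simp

lemma deriv_prof (T : Triple m) : deriv (prof T) = fun t => rate T * (1 - prof T t ^ 2) :=
  funext fun t => (hasDerivAt_prof T t).deriv

lemma contDiff_prof (T : Triple m) : ContDiff ℝ ∞ (prof T) := by
  have e : prof T = fun t => Real.sinh (rate T * t) / Real.cosh (rate T * t) :=
    funext fun t => Real.tanh_eq_sinh_div_cosh _
  rw [e]
  have : ContDiff ℝ ∞ fun t => rate T * t := contDiff_const.mul contDiff_id
  exact this.sinh.div this.cosh fun t => (Real.cosh_pos _).ne'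

/-- The family `P_ε = diag(A, 0) / ε + 2 (γ₀)_z β βᵀ` conjugate to `Q_ε`, with
`β = (b, √(1 - ‖b‖²))`. -/
def opP (T : Triple m) (ε t : ℝ) : Phase m →L[ℝ] Phase m :=
  ε⁻¹ • opA T + (2 * prof T t) • opB T

lemma opP_apply (T : Triple m) (ε t : ℝ) (p : Phase m) :
    opP T ε t p = ε⁻¹ • opA T p + (2 * prof T t) • opB T p := rfl

lemma continuous_opP (T : Triple m) (ε : ℝ) : Continuous (opP T ε) :=
  continuous_const.add ((continuous_const.mul (contDiff_prof T).continuous).smul continuous_const)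

lemma essBdd_opP (T : Triple m) (ε : ℝ) : EssBdd (opP T ε) where
  meas := (continuous_opP T ε).aestronglyMeasurable
  bdd := by
    refine ⟨‖ε⁻¹ • opA T‖ + 2 * ‖opB T‖, Eventually.of_forall fun t => ?_⟩
    refine (norm_add_le _ _).trans (add_le_add le_rfl ?_)
    rw [norm_smul, norm_mul, Real.norm_eq_abs, Real.norm_eq_abs, abs_two]
    exact mul_le_mul_of_nonneg_right (by linarith [abs_prof_le T t]) (norm_nonneg _)

lemma opP_symm (T : Triple m) (ε t : ℝ) (p q : Phase m) : ⟪opP T ε t p, q⟫ = ⟪p, opP T ε t q⟫ := by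
  have h1 : ⟪opA T p, q⟫ = ⟪p, opA T q⟫ := by
    simp [inner_eq_parts, inner_act T.A_symm]
  have h2 : ⟪opB T p, q⟫ = ⟪p, opB T q⟫ := by
    rw [opB_apply, opB_apply, inner_smul_left, inner_smul_right, real_inner_comm p (unitVec T)]
    simp [mul_comm]
  rw [opP_apply, opP_apply, inner_add_left, inner_add_right, inner_smul_left, inner_smul_left,
    inner_smul_right, inner_smul_right, h1, h2]
  simp

/-! ### Energy estimates for the linearised operators -/

/-- The integrand is half the derivative of `⟪Y, diag(A, 0) Y⟫`, by symmetry of `A`. -/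
lemma integral_inner_opA (T : Triple m) (Y : W12 m) :
    Integrable (fun t => ⟪dot Y t, opA T (fn Y t)⟫) ∧ ∫ t, ⟪dot Y t, opA T (fn Y t)⟫ = 0 := by
  obtain ⟨Y', h1, h2⟩ := exists_map_W12 (opA T) Y
  have h := inner_wderiv_add Y Y'
  rw [h1, h2] at h
  have e1 := coeFn_mulOp (EssBdd.const (opA T)) (incl Y)
  have e2 := coeFn_mulOp (EssBdd.const (opA T)) (wderiv Y)
  have e3 : wderiv Y =ᵐ[volume] dot Y := ae_eq_rfl
  have e4 : incl Y =ᵐ[volume] fn Y := ae_eq_rfl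
  have e5 : ∀ p q : Phase m, ⟪p, opA T q⟫ = ⟪q, opA T p⟫ := fun p q => by
    simp only [inner_eq_parts, opA_apply, xPart_vec, zPart_vec, mul_zero, add_zero]
    rw [← inner_act T.A_symm, real_inner_comm]
  rw [inner_eq_integral_of_ae e3 e1, inner_eq_integral_of_ae e4 e2] at h
  change (∫ t, ⟪dot Y t, opA T (fn Y t)⟫) + ∫ t, ⟪fn Y t, opA T (dot Y t)⟫ = 0 at h
  simp only [e5 (fn Y _)] at h
  exact ⟨integrable_inner_of_ae e3 e1, by linarith⟩

/-- The integrand is the derivative of `tanh(ct) ζ²`, since `tanh(ct)` solves `ż = c (1 - z²)`. -/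
lemma integral_prof_mul (T : Triple m) (Y : W12 m) :
    Integrable (fun t => 2 * prof T t * zPart (fn Y t) * zPart (dot Y t)
      + rate T * (1 - prof T t ^ 2) * zPart (fn Y t) ^ 2) ∧
    ∫ t, (2 * prof T t * zPart (fn Y t) * zPart (dot Y t)
      + rate T * (1 - prof T t ^ 2) * zPart (fn Y t) ^ 2) = 0 := by
  have hz := (contDiff_prof T).continuous
  have b1 : EssBdd fun t => prof T t • (projZ : Phase m →L[ℝ] Phase m) := by
    refine ⟨(hz.smul continuous_const).aestronglyMeasurable, 1 * ‖(projZ : Phase m →L[ℝ] Phase m)‖,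
      Eventually.of_forall fun t => ?_⟩
    rw [norm_smul]
    exact mul_le_mul_of_nonneg_right (abs_prof_le T t) (norm_nonneg _)
  have b2 : EssBdd fun t => deriv (prof T) t • (projZ : Phase m →L[ℝ] Phase m) := by
    refine ⟨((((contDiff_prof T).continuous_deriv (by simp))).smul
      continuous_const).aestronglyMeasurable,
      rate T * ‖(projZ : Phase m →L[ℝ] Phase m)‖, Eventually.of_forall fun t => ?_⟩
    rw [norm_smul, deriv_prof]
    refine mul_le_mul_of_nonneg_right ?_ (norm_nonneg _)
    have h1 := sq_abs (prof T t)
    have h2 := abs_prof_le T t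
    have h3 : 0 ≤ 1 - prof T t ^ 2 := by nlinarith [abs_nonneg (prof T t)]
    rw [Real.norm_of_nonneg (mul_nonneg (rate_pos' T).le h3)]
    exact mul_le_of_le_one_right (rate_pos' T).le (by nlinarith [sq_nonneg (prof T t)])
  obtain ⟨Y', h1, h2⟩ := exists_mul_W12 (contDiff_prof T) projZ b1 b2 Y
  have h := inner_wderiv_add Y Y'
  rw [h1, h2, inner_add_right] at h
  have e1 := coeFn_mulOp b1 (incl Y)
  have e2 := coeFn_mulOp b1 (wderiv Y)
  have e3 := coeFn_mulOp b2 (incl Y)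
  have e4 : wderiv Y =ᵐ[volume] dot Y := ae_eq_rfl
  have e5 : incl Y =ᵐ[volume] fn Y := ae_eq_rfl
  have i1 := integrable_inner_of_ae e4 e1
  have i2 := integrable_inner_of_ae e5 e2
  have i3 := integrable_inner_of_ae e5 e3
  have i23 : Integrable fun t => ⟪fn Y t, (prof T t • (projZ : Phase m →L[ℝ] Phase m)) (wderiv Y t)⟫
      + ⟪fn Y t, (deriv (prof T) t • (projZ : Phase m →L[ℝ] Phase m)) (incl Y t)⟫ := i2.add i3
  rw [inner_eq_integral_of_ae e4 e1, inner_eq_integral_of_ae e5 e2,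
    inner_eq_integral_of_ae e5 e3, ← integral_add i2 i3, ← integral_add i1 i23] at h
  have e : ∀ t, ⟪dot Y t, (prof T t • (projZ : Phase m →L[ℝ] Phase m)) (incl Y t)⟫
      + (⟪fn Y t, (prof T t • (projZ : Phase m →L[ℝ] Phase m)) (wderiv Y t)⟫
        + ⟪fn Y t, (deriv (prof T) t • (projZ : Phase m →L[ℝ] Phase m)) (incl Y t)⟫)
      = 2 * prof T t * zPart (fn Y t) * zPart (dot Y t)
        + rate T * (1 - prof T t ^ 2) * zPart (fn Y t) ^ 2 := by
    intro t
    rw [incl_coe, wderiv_coe, deriv_prof]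
    simp only [smul_apply, projZ_apply, inner_smul_right, inner_eq_parts,
      xPart_vec, zPart_vec, inner_zero_right, zero_add]
    ring
  have i4 := i1.add i23
  refine ⟨i4.congr (Eventually.of_forall e), ?_⟩
  rw [← h]
  exact integral_congr_ae (Eventually.of_forall fun t => (e t).symm)

lemma integrable_sq_parts {u : ℝ → Phase m} (hu : MemLp u 2 (volume : Measure ℝ)) :
    Integrable (fun t => ‖u t‖ ^ 2) ∧ Integrable (fun t => ‖xPart (u t)‖ ^ 2) ∧
      Integrable (fun t => zPart (u t) ^ 2) ∧
      ∫ t, ‖u t‖ ^ 2 = (∫ t, ‖xPart (u t)‖ ^ 2) + ∫ t, zPart (u t) ^ 2 := by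
  have h1 := (memLp_two_iff_integrable_sq_norm hu.1).1 hu
  have h2 := (memLp_two_iff_integrable_sq_norm (memLp_xPart hu).1).1 (memLp_xPart hu)
  have h3 := (memLp_zPart hu).integrable_sq
  refine ⟨h1, h2, h3, ?_⟩
  rw [← integral_add h2 h3]
  exact integral_congr_ae (Eventually.of_forall fun t => norm_sq_eq_parts _)

lemma sq_add_two_mul_le (u v : ℝ) : (u + 2 * v) ^ 2 ≤ 2 * u ^ 2 + 8 * v ^ 2 := by
  nlinarith [sq_nonneg (u - 2 * v)]

lemma exists_act_inv_bound (T : Triple m) : ∃ a > 0, ∀ x, ‖x‖ ≤ a * ‖act T.A x‖ := by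
  refine ⟨(∑ i, ∑ j, |T.A⁻¹ i j|) + 1, ?_, fun x => ?_⟩
  · have : 0 ≤ ∑ i, ∑ j, |T.A⁻¹ i j| :=
      Finset.sum_nonneg fun i _ => Finset.sum_nonneg fun j _ => abs_nonneg _
    linarith
  · have := norm_act_le T.A⁻¹ (act T.A x)
    rw [act_inv_act T.A_inv] at this
    linarith [norm_nonneg (act T.A x)]

lemma norm_prof_opB_le (T : Triple m) (t : ℝ) (y : Phase m) :
    ‖(2 * prof T t) • opB T y‖ ≤ 2 * ‖y‖ := by
  rw [norm_smul, Real.norm_eq_abs, abs_mul, abs_two]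
  exact mul_le_mul (by linarith [abs_prof_le T t]) (norm_opB_apply_le T _) (norm_nonneg _)
    (by norm_num)

/-- The `x`-part of the equation, multiplied by `ε`, reads `εσ y'_x + A y_x = ε (g - 2 tanh ββᵀ
y)_x`. Its square has a cross term that integrates to zero, so after integration `y_x` is `O(ε)`
without any sign condition on `A`. -/
lemma pointwise_x (T : Triple m) {a ε σ : ℝ} (ha : 0 < a)
    (hA : ∀ x, ‖x‖ ≤ a * ‖act T.A x‖) (hε : 0 < ε) (hσ : σ ^ 2 = 1) (t : ℝ) {y y' g : Phase m}
    (ht : g = σ • y' + opP T ε t y) :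
    ε ^ 2 * ‖xPart y'‖ ^ 2 + (a ^ 2)⁻¹ * ‖xPart y‖ ^ 2 + 2 * ε * σ * ⟪y', opA T y⟫
      ≤ ε ^ 2 * (2 * ‖g‖ ^ 2 + 8 * ‖y‖ ^ 2) := by
  have h1 : (ε * σ) • xPart y' + act T.A (xPart y)
      = ε • xPart (g - (2 * prof T t) • opB T y) := by
    have : xPart (g - (2 * prof T t) • opB T y) = σ • xPart y' + ε⁻¹ • act T.A (xPart y) := by
      rw [ht, opP_apply, ← add_assoc, add_sub_cancel_right]
      simp only [xPart_add, xPart_smul, opA_apply, xPart_vec]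
    rw [this, smul_add, smul_smul, smul_smul, mul_inv_cancel₀ hε.ne', one_smul]
  have h2 : ‖(ε * σ) • xPart y' + act T.A (xPart y)‖ ≤ ε * (‖g‖ + 2 * ‖y‖) := by
    rw [h1, norm_smul, Real.norm_of_nonneg hε.le]
    exact mul_le_mul_of_nonneg_left
      ((norm_xPart_le _).trans ((norm_sub_le _ _).trans
        (add_le_add le_rfl (norm_prof_opB_le T t y)))) hε.le
  have h3 := pow_le_pow_left₀ (norm_nonneg _) h2 2
  rw [norm_add_sq_real, norm_smul, inner_smul_left, conj_trivial, mul_pow, mul_pow,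
    Real.norm_eq_abs, sq_abs, mul_pow, hσ, mul_one] at h3
  have h4 : ⟪y', opA T y⟫ = ⟪xPart y', act T.A (xPart y)⟫ := by simp [inner_eq_parts]
  have h5 : (a ^ 2)⁻¹ * ‖xPart y‖ ^ 2 ≤ ‖act T.A (xPart y)‖ ^ 2 := by
    rw [inv_mul_le_iff₀ (by positivity), ← mul_pow]
    exact pow_le_pow_left₀ (norm_nonneg _) (hA _) 2
  have h7 := mul_le_mul_of_nonneg_left (sq_add_two_mul_le ‖g‖ ‖y‖) (sq_nonneg ε)
  rw [h4]
  linarith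

lemma pointwise_z (T : Triple m) {ε σ : ℝ} (hσ : σ ^ 2 = 1) (t : ℝ) {y y' g : Phase m}
    (ht : g = σ • y' + opP T ε t y) : zPart y' ^ 2 ≤ 2 * ‖g‖ ^ 2 + 8 * ‖y‖ ^ 2 := by
  have h1 : σ * zPart y' = zPart (g - (2 * prof T t) • opB T y) := by
    rw [ht, opP_apply, ← add_assoc, add_sub_cancel_right]
    simp only [zPart_add, zPart_smul, opA_apply, zPart_vec, mul_zero, add_zero]
  have h2 : |σ * zPart y'| ≤ ‖g‖ + 2 * ‖y‖ := by
    rw [h1]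
    exact (abs_zPart_le _).trans ((norm_sub_le _ _).trans
      (add_le_add le_rfl (norm_prof_opB_le T t y)))
  have h3 := pow_le_pow_left₀ (abs_nonneg _) h2 2
  rw [sq_abs, mul_pow, hσ, one_mul] at h3
  exact h3.trans (sq_add_two_mul_le _ _)

/-- The `z`-part is `-ζ' + 2c tanh(ct) ζ = g_z - 2 tanh(ct) √c ⟪b, x⟫`, because the `z`-entry of
`ββᵀ` is `c`. The parenthesised expression on the left integrates to zero, so integration leaves
control of `ζ` itself. The sign of the adjoint is essential: `d/dt + 2c tanh(ct)` annihilates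
`cosh⁻²(ct)`. -/
lemma pointwise_w (T : Triple m) {ε : ℝ} (t : ℝ) {y y' g : Phase m}
    (ht : g = (-1 : ℝ) • y' + opP T ε t y) :
    2 * rate T ^ 2 * zPart y ^ 2 - 2 * rate T * (2 * prof T t * zPart y * zPart y'
        + rate T * (1 - prof T t ^ 2) * zPart y ^ 2)
      ≤ 2 * ‖g‖ ^ 2 + 8 * ‖xPart y‖ ^ 2 := by
  have hz : |prof T t| ≤ 1 := abs_prof_le T t
  have h1 : zPart g = -zPart y'
      + 2 * prof T t * ((⟪T.b, xPart y⟫ + √(rate T) * zPart y) * √(rate T)) := by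
    rw [ht, opP_apply]
    simp only [opB_apply, opA_apply, inner_eq_parts, unitVec, zPart_add, zPart_smul, zPart_vec,
      xPart_vec]
    ring
  have hs : √(rate T) ^ 2 = rate T := Real.sq_sqrt (rate_pos' T).le
  have hs1 : |√(rate T)| ≤ 1 := by
    rw [abs_of_nonneg (Real.sqrt_nonneg _)]
    refine Real.sqrt_le_one.2 ?_ |>.trans le_rfl
    rw [rate]
    nlinarith [sq_nonneg ‖T.b‖]
  have hi : |⟪T.b, xPart y⟫| ≤ ‖xPart y‖ := (abs_real_inner_le_norm _ _).trans
    (mul_le_of_le_one_left (norm_nonneg _) T.b_norm.le)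
  generalize ⟪T.b, xPart y⟫ = i at h1 hi
  generalize √(rate T) = s at h1 hs hs1
  generalize prof T t = z at h1 hz ⊢
  have h2 : -zPart y' + 2 * rate T * z * zPart y = zPart g - 2 * (z * s * i) := by
    rw [h1, ← hs]; ring
  have h3 : |z * s * i| ≤ ‖xPart y‖ := by
    rw [abs_mul, abs_mul]
    have := mul_le_mul hz hs1 (abs_nonneg _) zero_le_one
    calc |z| * |s| * |i| ≤ 1 * ‖xPart y‖ :=
          mul_le_mul (by linarith) hi (abs_nonneg _) zero_le_one
      _ = _ := one_mul _
  have h5 : |zPart g - 2 * (z * s * i)| ≤ ‖g‖ + 2 * ‖xPart y‖ := by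
    refine (abs_sub _ _).trans (add_le_add (abs_zPart_le g) ?_)
    rw [abs_mul, abs_two]
    linarith
  have h4 := (pow_le_pow_left₀ (abs_nonneg _) h5 2).trans (sq_add_two_mul_le _ _)
  rw [sq_abs, ← h2] at h4
  -- With `z = tanh(ct)`, the left side equals `(-ζ' + 2czζ)² - ζ'² - 2c²z²ζ²`.
  nlinarith [sq_nonneg (zPart y'), sq_nonneg (rate T * z * zPart y)]

/-- Estimates for `G = σ Y' + P_ε Y`. -/
lemma linear_estimates (T : Triple m) {a ε : ℝ} (ha : 0 < a)
    (hA : ∀ x, ‖x‖ ≤ a * ‖act T.A x‖) (hε : 0 < ε) (Y : W12 m) {σ : ℝ} (hσ : σ ^ 2 = 1) {G : L2 m}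
    (hG : G = σ • wderiv Y + mulOp _ (essBdd_opP T ε) (incl Y)) :
    ∫ t, ‖xPart (fn Y t)‖ ^ 2 ≤ a ^ 2 * ε ^ 2 * (2 * ‖G‖ ^ 2 + 8 * ‖incl Y‖ ^ 2) ∧
    ‖wderiv Y‖ ^ 2 ≤ 4 * ‖G‖ ^ 2 + 16 * ‖incl Y‖ ^ 2 ∧
    (σ = -1 → 2 * rate T ^ 2 * ∫ t, zPart (fn Y t) ^ 2
      ≤ 2 * ‖G‖ ^ 2 + 8 * ∫ t, ‖xPart (fn Y t)‖ ^ 2) := by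
  have hGt : ∀ᵐ t, G t = σ • dot Y t + opP T ε t (fn Y t) := by
    filter_upwards [coeFn_mulOp (essBdd_opP T ε) (incl Y), Lp.coeFn_smul σ (wderiv Y),
      Lp.coeFn_add (σ • wderiv Y) (mulOp _ (essBdd_opP T ε) (incl Y))] with t h1 h2 h3
    rw [hG, h3, Pi.add_apply, h1, h2]
    rfl
  have eG : ‖G‖ ^ 2 = ∫ t, ‖G t‖ ^ 2 := norm_sq_eq_integral_of_ae ae_eq_rfl
  have eY : ‖incl Y‖ ^ 2 = ∫ t, ‖fn Y t‖ ^ 2 := norm_sq_eq_integral_of_ae ae_eq_rfl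
  have eY' : ‖wderiv Y‖ ^ 2 = ∫ t, ‖dot Y t‖ ^ 2 := norm_sq_eq_integral_of_ae ae_eq_rfl
  obtain ⟨iG, -, -, -⟩ := integrable_sq_parts (Lp.memLp G)
  obtain ⟨iY, iYx, iYz, -⟩ := integrable_sq_parts (memLp_fn Y)
  obtain ⟨iY', iYx', iYz', sY'⟩ := integrable_sq_parts (memLp_dot Y)
  obtain ⟨ic1, c1⟩ := integral_inner_opA T Y
  obtain ⟨ic2, c2⟩ := integral_prof_mul T Y
  have iR : Integrable fun t => 2 * ‖G t‖ ^ 2 + 8 * ‖fn Y t‖ ^ 2 :=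
    (iG.const_mul 2).add (iY.const_mul 8)
  have eR : ∫ t, (2 * ‖G t‖ ^ 2 + 8 * ‖fn Y t‖ ^ 2) = 2 * ‖G‖ ^ 2 + 8 * ‖incl Y‖ ^ 2 := by
    rw [integral_add (iG.const_mul 2) (iY.const_mul 8), integral_const_mul, integral_const_mul,
      eG, eY]
  have i12 : Integrable fun t => ε ^ 2 * ‖xPart (dot Y t)‖ ^ 2
      + (a ^ 2)⁻¹ * ‖xPart (fn Y t)‖ ^ 2 := (iYx'.const_mul (ε ^ 2)).add (iYx.const_mul (a ^ 2)⁻¹)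
  -- Integrating the pointwise bounds makes the cross terms disappear through `c1` here and `c2`
  -- below.
  have hX := integral_mono_ae (i12.add (ic1.const_mul (2 * ε * σ))) (iR.const_mul (ε ^ 2))
    (hGt.mono fun t ht => pointwise_x T ha hA hε hσ t ht)
  have hZ := integral_mono_ae iYz' iR (hGt.mono fun t ht => pointwise_z T hσ t ht)
  simp only [Pi.add_apply] at hX
  rw [integral_add i12 (ic1.const_mul (2 * ε * σ)),
    integral_add (iYx'.const_mul (ε ^ 2)) (iYx.const_mul (a ^ 2)⁻¹), integral_const_mul,
    integral_const_mul, integral_const_mul, integral_const_mul, c1, eR, mul_zero, add_zero] at hX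
  rw [eR] at hZ
  refine ⟨?_, ?_, ?_⟩
  · have n1 : 0 ≤ ε ^ 2 * ∫ t, ‖xPart (dot Y t)‖ ^ 2 :=
      mul_nonneg (sq_nonneg _) (integral_nonneg fun t => by positivity)
    have h := (le_add_of_nonneg_left n1).trans hX
    rw [inv_mul_le_iff₀ (by positivity)] at h
    rwa [mul_assoc]
  · have n2 : 0 ≤ (a ^ 2)⁻¹ * ∫ t, ‖xPart (fn Y t)‖ ^ 2 :=
      mul_nonneg (by positivity) (integral_nonneg fun t => by positivity)
    have h := le_of_mul_le_mul_left ((le_add_of_nonneg_right n2).trans hX) (by positivity)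
    rw [eY', sY']
    refine (add_le_add h hZ).trans (le_of_eq ?_)
    ring
  · intro hσ1
    have h := integral_mono_ae ((iYz.const_mul (2 * rate T ^ 2)).sub (ic2.const_mul (2 * rate T)))
      ((iG.const_mul 2).add (iYx.const_mul 8))
      (hGt.mono fun t ht => pointwise_w T t (hσ1 ▸ ht))
    simp only [Pi.add_apply, Pi.sub_apply] at h
    rw [integral_sub (iYz.const_mul _) (ic2.const_mul _),
      integral_add (iG.const_mul 2) (iYx.const_mul 8), integral_const_mul, integral_const_mul,
      integral_const_mul, integral_const_mul, c2, mul_zero, sub_zero, ← eG] at h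
    exact h

/-- The `z`-estimate loses a multiple of `X`, and `X` is at most `ε²` times the total. For small `ε`
this loss amounts to half of `c² y²`, which is moved to the left side. -/
lemma absorb_estimate {c a ε X W y g : ℝ} (hc : 0 < c)
    (hκ : (c ^ 2 + 4) * a ^ 2 / c ^ 2 * ε ^ 2 ≤ 1 / 16)
    (h1 : X ≤ a ^ 2 * ε ^ 2 * (2 * g ^ 2 + 8 * y ^ 2))
    (h3 : 2 * c ^ 2 * W ≤ 2 * g ^ 2 + 8 * X) (h4 : y ^ 2 = X + W) :
    y ^ 2 ≤ (2 / c ^ 2 + 1 / 4) * g ^ 2 := by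
  have h2 : (c ^ 2 + 4) * a ^ 2 * ε ^ 2 ≤ c ^ 2 / 16 := by
    have e : (c ^ 2 + 4) * a ^ 2 * ε ^ 2 = c ^ 2 * ((c ^ 2 + 4) * a ^ 2 / c ^ 2 * ε ^ 2) := by
      field_simp
    rw [e]
    nlinarith [sq_nonneg c]
  have h5 : (c ^ 2 + 4) * X ≤ (c ^ 2 + 4) * a ^ 2 * ε ^ 2 * (2 * g ^ 2 + 8 * y ^ 2) := by
    have := mul_le_mul_of_nonneg_left h1 (by positivity : 0 ≤ c ^ 2 + 4)
    linarith
  have h6 := mul_le_mul_of_nonneg_right h2 (by positivity : 0 ≤ 2 * g ^ 2 + 8 * y ^ 2)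
  have h7 : c ^ 2 * y ^ 2 ≤ c ^ 2 * ((2 / c ^ 2 + 1 / 4) * g ^ 2) := by
    have e : c ^ 2 * ((2 / c ^ 2 + 1 / 4) * g ^ 2) = (2 + c ^ 2 / 4) * g ^ 2 := by field_simp
    have e' : c ^ 2 * y ^ 2 = c ^ 2 * X + c ^ 2 * W := by rw [h4]; ring
    rw [e]
    linarith
  exact le_of_mul_le_mul_left h7 (by positivity)

lemma adjoint_bound (T : Triple m) {a ε E : ℝ} (ha : 0 < a)
    (hA : ∀ x, ‖x‖ ≤ a * ‖act T.A x‖) (hε : 0 < ε) (hE : E = 2 / rate T ^ 2 + 1 / 4)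
    (hκ : (rate T ^ 2 + 4) * a ^ 2 / rate T ^ 2 * ε ^ 2 ≤ 1 / 16) (v : W12 m) :
    ‖incl v‖ ≤ √E * ‖-wderiv v + mulOp _ (essBdd_opP T ε) (incl v)‖ := by
  obtain ⟨G, hG⟩ : ∃ G, G = -wderiv v + mulOp _ (essBdd_opP T ε) (incl v) := ⟨_, rfl⟩
  have hG' : G = (-1 : ℝ) • wderiv v + mulOp _ (essBdd_opP T ε) (incl v) := by
    rw [neg_one_smul, hG]
  obtain ⟨h1, -, h3⟩ := linear_estimates T ha hA hε v (by norm_num) hG'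
  have h4 : ‖incl v‖ ^ 2 = (∫ t, ‖xPart (fn v t)‖ ^ 2) + ∫ t, zPart (fn v t) ^ 2 :=
    (norm_sq_eq_integral_of_ae ae_eq_rfl).trans (integrable_sq_parts (memLp_fn v)).2.2.2
  have hc0 := rate_pos' T
  have hE0 : 0 < E := by rw [hE]; positivity
  rw [← hG]
  refine le_of_sq_le_sq ?_ (by positivity)
  rw [mul_pow, Real.sq_sqrt hE0.le, hE]
  exact absorb_estimate hc0 hκ h1 (h3 rfl) h4

/-- Once duality has given the `L²` bound, the equation with `σ = 1` bounds the derivative and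
yields the gain of `ε` in the `x`-part; no lower bound for `d/dt + opP` is required. `D` is the sum
of the two constants needed. -/
lemma solution_bound (T : Triple m) {a ε E D : ℝ} (ha : 0 < a)
    (hA : ∀ x, ‖x‖ ≤ a * ‖act T.A x‖) (hε : 0 < ε) (hE0 : 0 < E)
    (hD : D = 4 + 17 * E + a ^ 2 * (2 + 8 * E)) {Y : W12 m} {g : L2 m}
    (h1 : wderiv Y + mulOp _ (essBdd_opP T ε) (incl Y) = g) (h3 : ‖incl Y‖ ≤ √E * ‖g‖) :
    ‖Y‖ ≤ √D * ‖g‖ ∧ ∫ t, ‖xPart (fn Y t)‖ ^ 2 ≤ (√D * ε * ‖g‖) ^ 2 := by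
  have hD0 : 0 < D := by rw [hD]; positivity
  have hD1 : √D ^ 2 = D := Real.sq_sqrt hD0.le
  have hG : g = (1 : ℝ) • wderiv Y + mulOp _ (essBdd_opP T ε) (incl Y) :=
    h1.symm.trans (congrArg (· + _) (one_smul ℝ (wderiv Y)).symm)
  obtain ⟨h4, h5, -⟩ := linear_estimates T ha hA hε Y (one_pow 2) hG
  have h6 := pow_le_pow_left₀ (norm_nonneg _) h3 2
  rw [mul_pow, Real.sq_sqrt hE0.le] at h6
  have hn := W12_norm_sq Y
  generalize ‖incl Y‖ = y at h4 h5 h6 hn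
  generalize ‖wderiv Y‖ = y' at h5 hn
  have hr := norm_nonneg g
  generalize ‖g‖ = r at h4 h5 h6 hr ⊢
  have h7 : 0 ≤ a ^ 2 * (2 + 8 * E) * r ^ 2 := by positivity
  constructor
  · refine le_of_sq_le_sq ?_ (by positivity)
    rw [hn, mul_pow, hD1, hD]
    linarith
  · refine h4.trans ?_
    rw [mul_pow, mul_pow, hD1, hD]
    have h8 : a ^ 2 * ε ^ 2 * (2 * r ^ 2 + 8 * y ^ 2)
        ≤ a ^ 2 * ε ^ 2 * (2 * r ^ 2 + 8 * (E * r ^ 2)) :=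
      mul_le_mul_of_nonneg_left (by linarith) (by positivity)
    have h9 : 0 ≤ (4 + 17 * E) * ε ^ 2 * r ^ 2 := by positivity
    linarith

/-- For small `ε` the operator `d/dt + P_ε` has a right inverse with values in the image of
`-d/dt + P_ε`, with bounds uniform in `ε`. -/
theorem exists_uniform_rightInverse (T : Triple m) : ∃ C > 0, ∃ ε₀ > 0, ∀ ε : ℝ, 0 < ε → ε < ε₀ →
    ∃ S : L2 m →ₗ[ℝ] W12 m, ∀ g,
      wderiv (S g) + mulOp _ (essBdd_opP T ε) (incl (S g)) = g ∧
      (∃ v, incl (S g) = -wderiv v + mulOp _ (essBdd_opP T ε) (incl v)) ∧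
      ‖S g‖ ≤ C * ‖g‖ ∧ ∫ t, ‖xPart (fn (S g) t)‖ ^ 2 ≤ (C * ε * ‖g‖) ^ 2 := by
  obtain ⟨a, ha, hA⟩ := exists_act_inv_bound T
  set c := rate T with hc
  have hc0 : 0 < c := rate_pos' T
  set κ := (c ^ 2 + 4) * a ^ 2 / c ^ 2 with hκ
  have hκ0 : 0 < κ := by positivity
  set E := 2 / c ^ 2 + 1 / 4 with hE
  have hE0 : 0 < E := by positivity
  set D := 4 + 17 * E + a ^ 2 * (2 + 8 * E) with hD
  have hD0 : 0 < D := by positivity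
  -- For `ε < 1` one has `κ ε² ≤ κ ε`, so `ε ≤ 1/(16κ)` meets the smallness condition of
  -- `adjoint_bound`.
  refine ⟨√D, by positivity, min 1 (1 / (16 * κ)), by positivity, fun ε hε hε0 => ?_⟩
  have hκε : κ * ε ^ 2 ≤ 1 / 16 := by
    have h1 : ε < 1 := hε0.trans_le (min_le_left _ _)
    have h2 : ε ≤ 1 / (16 * κ) := hε0.le.trans (min_le_right _ _)
    rw [le_div_iff₀ (by positivity)] at h2
    nlinarith
  obtain ⟨S, hS⟩ := exists_rightInverse (essBdd_opP T ε) (opP_symm T ε) (Real.sqrt_nonneg E)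
    (fun v => adjoint_bound T ha hA hε hE hκε v)
  refine ⟨S, fun g => ?_⟩
  obtain ⟨h1, h2, h3⟩ := hS g
  exact ⟨h1, h2, solution_bound T ha hA hε hE0 hD h1 h3⟩

/-! ### The change of coordinates and the vector field -/

/-- The coordinates `(ε ξ, (ζ - ε ⟨b, ξ⟩) / √(1 - ‖b‖²))`, in which `‖·‖_ε` is Euclidean. -/
def Phi (T : Triple m) (ε : ℝ) : Phase m →L[ℝ] Phase m :=
  mkL (fun p => vec (ε • xPart p) ((√(rate T))⁻¹ * (zPart p - ε * ⟪T.b, xPart p⟫)))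
    (fun p q => Phase.ext_parts (by simp [smul_add]) (by simp [inner_add_right]; ring))
    (fun r p => Phase.ext_parts (by simp only [xPart_vec, xPart_smul]; exact smul_comm _ _ _)
      (by simp [inner_smul_right]; ring))

/-- The inverse of `Phi T ε`. -/
def PhiInv (T : Triple m) (ε : ℝ) : Phase m →L[ℝ] Phase m :=
  mkL (fun p => vec (ε⁻¹ • xPart p) ⟪unitVec T, p⟫)
    (fun p q => Phase.ext_parts (by simp [smul_add]) (by simp [inner_add_right]))
    (fun r p => Phase.ext_parts (by simp only [xPart_vec, xPart_smul]; exact smul_comm _ _ _)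
      (by simp [inner_smul_right]))

@[simp] lemma Phi_apply (T : Triple m) (ε : ℝ) (p : Phase m) : Phi T ε p =
    vec (ε • xPart p) ((√(rate T))⁻¹ * (zPart p - ε * ⟪T.b, xPart p⟫)) := rfl

@[simp] lemma PhiInv_apply (T : Triple m) (ε : ℝ) (p : Phase m) : PhiInv T ε p =
    vec (ε⁻¹ • xPart p) ⟪unitVec T, p⟫ := rfl

lemma sqrt_rate_pos (T : Triple m) : 0 < √(rate T) := Real.sqrt_pos.2 (rate_pos' T)

lemma inner_unitVec (T : Triple m) (p : Phase m) :
    ⟪unitVec T, p⟫ = ⟪T.b, xPart p⟫ + √(rate T) * zPart p := by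
  rw [inner_eq_parts, unitVec, xPart_vec, zPart_vec]

lemma PhiInv_Phi (T : Triple m) {ε : ℝ} (hε : 0 < ε) (p : Phase m) :
    PhiInv T ε (Phi T ε p) = p := by
  have := (sqrt_rate_pos T).ne'
  apply Phase.ext_parts
  · simp [smul_smul, hε.ne']
  · simp only [PhiInv_apply, zPart_vec, inner_unitVec, Phi_apply, xPart_vec, inner_smul_right]
    field_simp
    ring

lemma Phi_PhiInv (T : Triple m) {ε : ℝ} (hε : 0 < ε) (p : Phase m) :
    Phi T ε (PhiInv T ε p) = p := by
  have := (sqrt_rate_pos T).ne'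
  apply Phase.ext_parts
  · simp [smul_smul, hε.ne']
  · simp only [PhiInv_apply, zPart_vec, inner_unitVec, Phi_apply, xPart_vec, inner_smul_right]
    field_simp
    ring

lemma norm_sq_Phi (T : Triple m) (ε : ℝ) (p : Phase m) : ‖Phi T ε p‖ ^ 2 = normSqEps T ε p := by
  rw [norm_sq_eq_parts, Phi_apply, xPart_vec, zPart_vec, norm_smul, mul_pow, mul_pow,
    Real.norm_eq_abs, sq_abs, inv_pow, Real.sq_sqrt (rate_pos' T).le, normSqEps, rate]

/-- The key identity is `⟪β, Phi p⟫ = ζ`: the terms of `Q` involving `ζ` form a multiple of `(b/ε,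
1)`, which `Phi` maps to `β`, so they become a multiple of the rank-one projection `ββᵀ`. -/
lemma Phi_Q (T : Triple m) {ε : ℝ} (hε : 0 < ε) (t : ℝ) (p : Phase m) :
    Phi T ε (Q T ε t p) = opP T ε t (Phi T ε p) := by
  have hs := (sqrt_rate_pos T).ne'
  have e1 : zPart (gamma0 T t) = prof T t := rfl
  have e2 : ⟪unitVec T, Phi T ε p⟫ = zPart p := congrArg zPart (PhiInv_Phi T hε p)
  rw [opP_apply, opB_apply, e2]
  apply Phase.ext_parts
  · simp only [Phi_apply, Q, e1, xPart_vec, xPart_add, xPart_smul, opA_apply, act_smul, unitVec,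
      smul_add, smul_smul, mul_inv_cancel₀ hε.ne', inv_mul_cancel₀ hε.ne', one_smul]
    congr 2
    field_simp
  · simp only [Phi_apply, Q, e1, xPart_vec, zPart_vec, zPart_add, zPart_smul, opA_apply, unitVec,
      inner_add_right, inner_smul_right, real_inner_self_eq_norm_sq]
    have h2 : √(rate T) ^ 2 = 1 - ‖T.b‖ ^ 2 := Real.sq_sqrt (rate_pos' T).le
    have h3 : ‖T.b‖ ^ 2 = 1 - √(rate T) ^ 2 := by rw [h2]; ring
    rw [h3]
    field_simp
    ring

/-- `F` such that the gradient equation with parameter `ε` reads `γ̇ = -F(γ)`. -/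
def field (T : Triple m) (ε : ℝ) (p : Phase m) : Phase m :=
  vec (ε⁻¹ • (act T.A (xPart p) - (1 - zPart p ^ 2) • T.b) - xPart (R T ε p))
    (⟪act T.A (xPart p), T.b⟫ - (1 - zPart p ^ 2) - zPart (R T ε p))

/-- `Phi T ε` cancels the coupling `⟪Ax, b⟫` in the `z`-equation. The error enters through `Phi T
1`, since the factor `ε⁻¹` in the `x`-part of `R` is absorbed. -/
lemma Phi_field (T : Triple m) {ε : ℝ} (hε : 0 < ε) (p : Phase m) :
    Phi T ε (field T ε p) =
      opA T p - (1 - zPart p ^ 2) • unitVec T - Phi T 1 (scaledR T ε p) := by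
  have hs := (sqrt_rate_pos T).ne'
  apply Phase.ext_parts
  · simp only [Phi_apply, field, R, xPart_vec, xPart_sub, xPart_smul, opA_apply, unitVec,
      smul_sub, smul_smul, mul_inv_cancel₀ hε.ne', one_smul, mul_inv_cancel_left₀ hε.ne']
  · simp only [Phi_apply, field, R, xPart_vec, zPart_vec, zPart_sub, zPart_smul, opA_apply,
      unitVec, inner_sub_right, inner_smul_right, real_inner_self_eq_norm_sq]
    have h2 : √(rate T) ^ 2 = 1 - ‖T.b‖ ^ 2 := Real.sq_sqrt (rate_pos' T).le
    have h3 : ‖T.b‖ ^ 2 = 1 - √(rate T) ^ 2 := by rw [h2]; ring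
    rw [h3, real_inner_comm T.b]
    field_simp
    ring

/-! ### The limit solution -/

lemma gamma0_eq (T : Triple m) (t : ℝ) : gamma0 T t =
    (1 - prof T t ^ 2) • vec (act T.A⁻¹ T.b) 0 + prof T t • vec 0 1 := by
  have h3 : (Real.cosh ((1 - ‖T.b‖ ^ 2) * t) ^ 2)⁻¹ = 1 - prof T t ^ 2 := by
    have := (Real.cosh_pos ((1 - ‖T.b‖ ^ 2) * t)).ne'
    rw [prof, rate, Real.tanh_eq_sinh_div_cosh]
    field_simp
    linarith [Real.cosh_sq ((1 - ‖T.b‖ ^ 2) * t)]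
  apply Phase.ext_parts
  · rw [xPart_gamma0, h3]
    simp
  · rw [zPart_gamma0]
    simp [prof, rate]

lemma xPart_gamma0' (T : Triple m) (t : ℝ) :
    xPart (gamma0 T t) = (1 - prof T t ^ 2) • act T.A⁻¹ T.b := by
  rw [gamma0_eq]; simp

lemma zPart_gamma0' (T : Triple m) (t : ℝ) : zPart (gamma0 T t) = prof T t := rfl

lemma contDiff_gamma0 (T : Triple m) : ContDiff ℝ ∞ (gamma0 T) := by
  rw [show gamma0 T = _ from funext (gamma0_eq T)]
  have := contDiff_prof T
  fun_prop

lemma deriv_gamma0 (T : Triple m) (t : ℝ) : deriv (gamma0 T) t =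
    (rate T * (1 - prof T t ^ 2)) • vec ((-2 * prof T t) • act T.A⁻¹ T.b) 1 := by
  have h1 := hasDerivAt_prof T t
  have h2 := ((h1.pow 2).const_sub 1).smul_const (vec (act T.A⁻¹ T.b) 0)
  have h3 := h2.add (h1.smul_const (vec (0 : XSpace m) 1))
  rw [show gamma0 T = _ from funext (gamma0_eq T)]
  refine h3.deriv.trans ?_
  apply Phase.ext_parts
  · simp only [xPart_add, xPart_smul, xPart_vec, smul_zero, add_zero, smul_smul]
    congr 1
    norm_num
    ring
  · simp

/-! ### The nonlinearity -/

/-- The nonlinear part of the equation around `γ₀`, in the coordinates `Phi T ε`. -/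
def nl (T : Triple m) (ε t : ℝ) (p : Phase m) : Phase m :=
  Phi T ε (field T ε (gamma0 T t + p) - Q T ε t p)

/-- All terms linear in `p` coming from the main part of `field` cancel against `Q`; only the
quadratic term `ζ² β` and the variation of the error survive. -/
lemma nl_sub (T : Triple m) {ε : ℝ} (hε : 0 < ε) (t : ℝ) (p q : Phase m) :
    nl T ε t p - nl T ε t q = (zPart p ^ 2 - zPart q ^ 2) • unitVec T
      - Phi T 1 (scaledR T ε (gamma0 T t + p) - scaledR T ε (gamma0 T t + q)) := by
  have e2 : ∀ p, ⟪unitVec T, Phi T ε p⟫ = zPart p := fun p => congrArg zPart (PhiInv_Phi T hε p)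
  have e3 : ∀ p, ε⁻¹ • opA T (Phi T ε p) = opA T p := fun p => by
    apply Phase.ext_parts
    · simp [act_smul, smul_smul, hε.ne']
    · simp
  rw [nl, nl, map_sub, map_sub, Phi_field T hε, Phi_field T hε, Phi_Q T hε, Phi_Q T hε, opP_apply,
    opP_apply, e3, e3, opB_apply, opB_apply, e2, e2, map_add, map_add, map_sub (Phi T 1),
    zPart_add, zPart_add, zPart_gamma0']
  module

/-- `γ₀` solves the equations of the limit `ε = 0`, namely `Ax = (1 - z²) b` and `ż = c (1 - z²)`.
The residual therefore consists of the neglected `x`-velocity and the error term. -/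
lemma nl_zero_add (T : Triple m) {ε : ℝ} (hε : 0 < ε) (t : ℝ) :
    nl T ε t 0 + Phi T ε (deriv (gamma0 T) t) =
      Phi T ε (vec (xPart (deriv (gamma0 T) t)) 0) - Phi T 1 (scaledR T ε (gamma0 T t)) := by
  have hQ : Q T ε t 0 = 0 := by
    apply Phase.ext_parts <;> simp [Q, act]
  have hA : opA T (gamma0 T t) = (1 - prof T t ^ 2) • vec T.b 0 := by
    apply Phase.ext_parts
    · simp [xPart_gamma0', act_smul, act_act_inv T.A_inv]
    · simp
  rw [nl, add_zero, hQ, sub_zero, Phi_field T hε, hA, zPart_gamma0']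
  have hs := (sqrt_rate_pos T).ne'
  have hr : √(rate T) ^ 2 = rate T := Real.sq_sqrt (rate_pos' T).le
  have hz : zPart (deriv (gamma0 T) t) = rate T * (1 - prof T t ^ 2) := by
    rw [deriv_gamma0]; simp
  have key : (1 - prof T t ^ 2) • vec T.b 0 - (1 - prof T t ^ 2) • unitVec T
      + Phi T ε (deriv (gamma0 T) t) = Phi T ε (vec (xPart (deriv (gamma0 T) t)) 0) := by
    apply Phase.ext_parts
    · simp [unitVec]
    · simp only [Phi_apply, zPart_add, zPart_sub, zPart_smul, zPart_vec, unitVec, xPart_vec, hz]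
      rw [← hr, Real.sqrt_sq (Real.sqrt_nonneg _)]
      field_simp
      ring
  rw [← key]
  abel

/-- The functional is the defect of `γ₀ + η` in `γ̇ = -field(γ)`. The expansion around `γ₀` closes
up because `A (γ₀)_x = (1 - z²) b` and `ż = c (1 - z²)`. -/
lemma functionalFun_eq (T : Triple m) (ε : ℝ) (η : W12 m) (t : ℝ) :
    functionalFun T ε η t = dot η t + deriv (gamma0 T) t + field T ε (gamma0 T t + fn η t) := by
  have hA : act T.A (xPart (gamma0 T t)) = (1 - prof T t ^ 2) • T.b := by
    simp [xPart_gamma0', act_smul, act_act_inv T.A_inv]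
  have hz : zPart (deriv (gamma0 T) t) = rate T * (1 - prof T t ^ 2) := by
    rw [deriv_gamma0]; simp
  apply Phase.ext_parts
  · simp only [functionalFun, field, Q, xPart_add, xPart_sub, xPart_smul, xPart_vec, zPart_add,
      zPart_gamma0', act_add, hA]
    module
  · simp only [functionalFun, field, Q, xPart_add, zPart_add, zPart_sub, zPart_smul, zPart_vec,
      zPart_gamma0', act_add, hA, hz, inner_add_left, inner_smul_left, real_inner_self_eq_norm_sq,
      conj_trivial, rate]
    rw [real_inner_comm T.b]
    ring

/-! ### Lipschitz estimates -/

lemma exists_lipschitz_closedBall {E F : Type*} [NormedAddCommGroup E] [NormedSpace ℝ E]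
    [FiniteDimensional ℝ E] [NormedAddCommGroup F] [NormedSpace ℝ F] {f : E → F}
    (hf : ContDiff ℝ 1 f) (r : ℝ) :
    ∃ M > 0, ∀ p q, ‖p‖ ≤ r → ‖q‖ ≤ r → ‖f p - f q‖ ≤ M * ‖p - q‖ := by
  have : ProperSpace E := FiniteDimensional.proper ℝ E
  obtain ⟨M, hM⟩ := (isCompact_closedBall (0 : E) r).exists_bound_of_continuousOn
    (hf.continuous_fderiv (by simp)).continuousOn
  refine ⟨|M| + 1, by positivity, fun p q hp hq => ?_⟩
  exact (convex_closedBall (0 : E) r).norm_image_sub_le_of_norm_fderiv_le (𝕜 := ℝ)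
    (fun x _ => hf.differentiable (by simp) x)
    (fun x hx => (hM x hx).trans (by linarith [le_abs_self M]))
    (mem_closedBall_zero_iff.2 hq) (mem_closedBall_zero_iff.2 hp)

/-- The first variable is `ε`, not `ε²`, since smoothness is assumed in that variable. Comparison
with the origin, where `h` vanishes, then gives a bound of order `ε`. -/
lemma exists_h_lipschitz (T : Triple m) (r : ℝ) : ∃ M > 0, ∀ q q' : ℝ × Phase m,
    ‖q‖ ≤ r → ‖q'‖ ≤ r → ∀ v, ‖act (T.h (q.1 ^ 2) q.2) v - act (T.h (q'.1 ^ 2) q'.2) v‖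
      ≤ M * ‖q - q'‖ * ‖v‖ := by
  choose M hM0 hM using fun i j => exists_lipschitz_closedBall ((T.h_smooth i j).of_le (by simp)) r
  refine ⟨(∑ i, ∑ j, M i j) + 1, ?_, fun q q' hq hq' v => ?_⟩
  · have : 0 ≤ ∑ i, ∑ j, M i j :=
      Finset.sum_nonneg fun i _ => Finset.sum_nonneg fun j _ => (hM0 i j).le
    linarith
  · rw [← sub_act]
    refine (norm_act_le _ v).trans (mul_le_mul_of_nonneg_right ?_ (norm_nonneg v))
    have : ∑ i, ∑ j, |(T.h (q.1 ^ 2) q.2 - T.h (q'.1 ^ 2) q'.2) i j|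
        ≤ (∑ i, ∑ j, M i j) * ‖q - q'‖ := by
      rw [Finset.sum_mul]
      refine Finset.sum_le_sum fun i _ => ?_
      rw [Finset.sum_mul]
      exact Finset.sum_le_sum fun j _ => hM i j q q' hq hq'
    linarith [norm_nonneg (q - q')]

/-- The rescaled point `(ε² x, ε z)`. -/
def rescale (ε : ℝ) (p : Phase m) : Phase m := vec (ε ^ 2 • xPart p) (ε * zPart p)

lemma scaledR_eq (T : Triple m) (ε : ℝ) (p : Phase m) :
    scaledR T ε p = -act (T.h (ε ^ 2) (rescale ε p)) (gradVec T p) := rfl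

lemma norm_rescale_sub_le {ε : ℝ} (hε : 0 < ε) (hε1 : ε ≤ 1) (p q : Phase m) :
    ‖rescale ε p - rescale ε q‖ ≤ ε * ‖p - q‖ := by
  refine le_of_sq_le_sq ?_ (by positivity)
  rw [mul_pow, norm_sq_eq_parts, norm_sq_eq_parts (p - q)]
  simp only [rescale, xPart_sub, zPart_sub, xPart_vec, zPart_vec]
  rw [← smul_sub, ← mul_sub, norm_smul, mul_pow, mul_pow, Real.norm_eq_abs, sq_abs, mul_add]
  refine add_le_add ?_ le_rfl
  refine mul_le_mul_of_nonneg_right ?_ (by positivity)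
  exact pow_le_pow_left₀ (by positivity) (by nlinarith) 2

lemma norm_rescale_le {ε K : ℝ} (hε : 0 < ε) (hε1 : ε ≤ 1) {p : Phase m}
    (hx : √ε * ‖xPart p‖ ≤ K) (hz : |zPart p| ≤ K) : ‖rescale ε p‖ ≤ 2 * K * ε := by
  refine (norm_le_parts _).trans ?_
  simp only [rescale, xPart_vec, zPart_vec]
  rw [norm_smul, abs_mul, abs_of_pos hε, Real.norm_of_nonneg (sq_nonneg ε)]
  have h1 : ε ≤ √ε := Real.le_sqrt_of_sq_le (by nlinarith)
  have h2 : ε * ‖xPart p‖ ≤ K :=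
    (mul_le_mul_of_nonneg_right h1 (norm_nonneg _)).trans hx
  nlinarith

/-- On bounded regions `scaledR` is `O(ε)` times the gradient, and it is Lipschitz with constant
`O(√ε)`. -/
lemma exists_scaledR_bound (T : Triple m) {K : ℝ} (hK : 0 < K) :
    ∃ L > 0, ∀ ε : ℝ, 0 < ε → ε ≤ 1 → ∀ p : Phase m, √ε * ‖xPart p‖ ≤ K → |zPart p| ≤ K →
      ‖scaledR T ε p‖ ≤ L * ε * ‖gradVec T p‖ ∧
      ∀ q : Phase m, √ε * ‖xPart q‖ ≤ K → |zPart q| ≤ K →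
        ‖scaledR T ε p - scaledR T ε q‖ ≤ L * √ε * ‖p - q‖ := by
  obtain ⟨M, hM0, hM⟩ := exists_h_lipschitz T (1 + 2 * K)
  set α := ∑ i, ∑ j, |T.A i j| with hα
  have hα0 : 0 ≤ α := Finset.sum_nonneg fun i _ => Finset.sum_nonneg fun j _ => abs_nonneg _
  set L := M * (1 + 2 * K) + M * (α * K + (K ^ 2 + 1)) + M * (1 + 2 * K) * (α + 2 * K) with hL
  have hb : ∀ ε : ℝ, 0 < ε → ε ≤ 1 → ∀ p : Phase m, √ε * ‖xPart p‖ ≤ K → |zPart p| ≤ K →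
      ‖(ε, rescale ε p)‖ ≤ (1 + 2 * K) * ε ∧ ‖(ε, rescale ε p)‖ ≤ 1 + 2 * K ∧
      ∀ v, ‖act (T.h (ε ^ 2) (rescale ε p)) v‖ ≤ M * ((1 + 2 * K) * ε) * ‖v‖ := by
    intro ε hε hε1 p hx hz
    have h1 : ‖(ε, rescale ε p)‖ ≤ (1 + 2 * K) * ε := by
      rw [Prod.norm_def]
      refine max_le ?_ ?_
      · change ‖ε‖ ≤ _
        rw [Real.norm_of_nonneg hε.le]
        nlinarith
      · exact (norm_rescale_le hε hε1 hx hz).trans (by nlinarith)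
    have h2 : ‖(ε, rescale ε p)‖ ≤ 1 + 2 * K := h1.trans (by nlinarith)
    refine ⟨h1, h2, fun v => ?_⟩
    have h3 := hM (ε, rescale ε p) 0 h2 (by rw [norm_zero]; positivity) v
    have h0 : T.h ((0 : ℝ × Phase m).1 ^ 2) (0 : ℝ × Phase m).2 = 0 := by
      simp [T.h_zero]
    have h4 : act (0 : Matrix (Fin m ⊕ Unit) (Fin m ⊕ Unit) ℝ) v = 0 := by
      ext i; simp [act]
    rw [h0, h4, sub_zero, sub_zero] at h3
    exact h3.trans (mul_le_mul_of_nonneg_right (mul_le_mul_of_nonneg_left h1 hM0.le)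
      (norm_nonneg v))
  refine ⟨L, by positivity, fun ε hε hε1 p hx hz => ⟨?_, fun q hx' hz' => ?_⟩⟩
  · rw [scaledR_eq, norm_neg]
    refine ((hb ε hε hε1 p hx hz).2.2 _).trans ?_
    rw [← mul_assoc]
    refine mul_le_mul_of_nonneg_right (mul_le_mul_of_nonneg_right ?_ hε.le) (norm_nonneg _)
    rw [hL]
    have h1 : 0 ≤ M * (α * K + (K ^ 2 + 1)) := by positivity
    have h2 : 0 ≤ M * (1 + 2 * K) * (α + 2 * K) := by positivity
    linarith
  · obtain ⟨-, h2, -⟩ := hb ε hε hε1 p hx hz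
    obtain ⟨-, h2', h3'⟩ := hb ε hε hε1 q hx' hz'
    have hs : ε ≤ √ε := Real.le_sqrt_of_sq_le (by nlinarith)
    have hss : √ε * √ε = ε := Real.mul_self_sqrt hε.le
    have hs1 : √ε ≤ 1 := Real.sqrt_le_one.2 hε1
    have e : scaledR T ε p - scaledR T ε q =
        -((act (T.h (ε ^ 2) (rescale ε p)) (gradVec T p)
          - act (T.h (ε ^ 2) (rescale ε q)) (gradVec T p))
          + act (T.h (ε ^ 2) (rescale ε q)) (gradVec T p - gradVec T q)) := by
      rw [scaledR_eq, scaledR_eq, act_sub]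
      abel
    -- Since `‖x‖` may be as large as `K/√ε`, the gradient is bounded only after multiplication by
    -- `√ε`.
    have g1 : √ε * ‖gradVec T p‖ ≤ α * K + (K ^ 2 + 1) := by
      have h4 : ‖gradVec T p‖ ≤ α * ‖xPart p‖ + (K ^ 2 + 1) := by
        refine (norm_le_parts _).trans (add_le_add (norm_act_le _ _) ?_)
        refine (abs_sub _ _).trans ?_
        rw [abs_pow, abs_one]
        have := pow_le_pow_left₀ (abs_nonneg _) hz 2
        linarith
      calc √ε * ‖gradVec T p‖ ≤ √ε * (α * ‖xPart p‖ + (K ^ 2 + 1)) :=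
            mul_le_mul_of_nonneg_left h4 (Real.sqrt_nonneg _)
        _ = α * (√ε * ‖xPart p‖) + √ε * (K ^ 2 + 1) := by ring
        _ ≤ α * K + 1 * (K ^ 2 + 1) := add_le_add (mul_le_mul_of_nonneg_left hx hα0)
            (mul_le_mul_of_nonneg_right hs1 (by positivity))
        _ = _ := by ring
    have g2 : ‖gradVec T p - gradVec T q‖ ≤ (α + 2 * K) * ‖p - q‖ := by
      refine (norm_le_parts _).trans ?_
      have h5 : xPart (gradVec T p - gradVec T q) = act T.A (xPart (p - q)) := by
        rw [xPart_sub, xPart_sub, act_sub]; rfl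
      have h6 : zPart (gradVec T p - gradVec T q) = (zPart p + zPart q) * zPart (p - q) := by
        rw [zPart_sub, zPart_sub, gradVec, gradVec, zPart_vec, zPart_vec]; ring
      rw [h5, h6, abs_mul, add_mul]
      refine add_le_add ((norm_act_le _ _).trans
        (mul_le_mul_of_nonneg_left (norm_xPart_le _) hα0)) ?_
      refine mul_le_mul ?_ (abs_zPart_le _) (abs_nonneg _) (by positivity)
      exact (abs_add_le _ _).trans (by linarith)
    have h7 := hM (ε, rescale ε p) (ε, rescale ε q) h2 h2' (gradVec T p)
    have h8 : ‖((ε, rescale ε p) : ℝ × Phase m) - (ε, rescale ε q)‖ ≤ ε * ‖p - q‖ := by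
      rw [Prod.mk_sub_mk, sub_self, Prod.norm_def]
      refine max_le ?_ (norm_rescale_sub_le hε hε1 p q)
      change ‖(0 : ℝ)‖ ≤ _
      rw [norm_zero]
      positivity
    rw [e, norm_neg]
    refine (norm_add_le _ _).trans ?_
    -- Rescaling contributes `ε = √ε √ε` to the variation of `h`: one factor compensates the size of
    -- the gradient, the other is the Lipschitz gain.
    have t1 : ‖act (T.h (ε ^ 2) (rescale ε p)) (gradVec T p)
          - act (T.h (ε ^ 2) (rescale ε q)) (gradVec T p)‖
        ≤ M * (α * K + (K ^ 2 + 1)) * √ε * ‖p - q‖ := by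
      refine h7.trans ?_
      calc M * ‖((ε, rescale ε p) : ℝ × Phase m) - (ε, rescale ε q)‖ * ‖gradVec T p‖
          ≤ M * (ε * ‖p - q‖) * ‖gradVec T p‖ :=
            mul_le_mul_of_nonneg_right (mul_le_mul_of_nonneg_left h8 hM0.le) (norm_nonneg _)
        _ = M * (√ε * √ε * ‖p - q‖) * ‖gradVec T p‖ := by rw [hss]
        _ = M * (√ε * ‖gradVec T p‖) * √ε * ‖p - q‖ := by ring
        _ ≤ _ := by gcongr
    have t2 : ‖act (T.h (ε ^ 2) (rescale ε q)) (gradVec T p - gradVec T q)‖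
        ≤ M * (1 + 2 * K) * (α + 2 * K) * √ε * ‖p - q‖ := by
      refine (h3' _).trans ?_
      calc M * ((1 + 2 * K) * ε) * ‖gradVec T p - gradVec T q‖
          ≤ M * ((1 + 2 * K) * √ε) * ((α + 2 * K) * ‖p - q‖) := by gcongr
        _ = _ := by ring
    have t3 : 0 ≤ M * (1 + 2 * K) * √ε * ‖p - q‖ := by positivity
    rw [hL]
    linarith

/-- The region in which the nonlinearity is controlled. -/
def region (m : ℕ) (K ε : ℝ) : Set (Phase m) := {p | √ε * ‖xPart p‖ ≤ K ∧ |zPart p| ≤ K * √ε}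

/-- The quadratic term has slope `|ζ + ζ'| ≤ 2K√ε`, and the error term has slope `O(√ε)` around the
bounded curve `γ₀`. The norms are unweighted, hence the need for the unweighted bound in
`exists_solutionOp`. -/
lemma exists_nl_lipschitz (T : Triple m) {K : ℝ} (hK : 0 < K) :
    ∃ L > 0, ∀ ε : ℝ, 0 < ε → ε ≤ 1 → ∀ (t : ℝ), ∀ p ∈ region m K ε, ∀ q ∈ region m K ε,
      ‖nl T ε t p - nl T ε t q‖ ≤ L * √ε * ‖p - q‖ := by
  obtain ⟨B, hB⟩ := gamma0_bounded T
  have hB0 : 0 ≤ B := (norm_nonneg _).trans (hB 0)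
  obtain ⟨L, hL0, hL⟩ := exists_scaledR_bound T (K := B + K) (by positivity)
  refine ⟨2 * K + ‖Phi T 1‖ * L, by positivity, fun ε hε hε1 t p hp q hq => ?_⟩
  have hs1 : √ε ≤ 1 := Real.sqrt_le_one.2 hε1
  have hr : ∀ p ∈ region m K ε, √ε * ‖xPart (gamma0 T t + p)‖ ≤ B + K ∧
      |zPart (gamma0 T t + p)| ≤ B + K := by
    intro p hp
    constructor
    · have h1 : ‖xPart (gamma0 T t + p)‖ ≤ B + ‖xPart p‖ := by
        rw [xPart_add]
        exact (norm_add_le _ _).trans (add_le_add ((norm_xPart_le _).trans (hB t)) le_rfl)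
      have h2 := mul_le_mul_of_nonneg_left h1 (Real.sqrt_nonneg ε)
      have h3 : √ε * B ≤ B := mul_le_of_le_one_left hB0 hs1
      have h4 : √ε * ‖xPart p‖ ≤ K := hp.1
      rw [mul_add] at h2
      linarith
    · rw [zPart_add]
      refine (abs_add_le _ _).trans (add_le_add ((abs_zPart_le _).trans (hB t)) ?_)
      exact hp.2.trans (mul_le_of_le_one_right hK.le hs1)
  have h1 := (hL ε hε hε1 _ (hr p hp).1 (hr p hp).2).2 _ (hr q hq).1 (hr q hq).2
  rw [add_sub_add_left_eq_sub] at h1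
  rw [nl_sub T hε]
  refine (norm_sub_le _ _).trans ?_
  rw [norm_smul, norm_unitVec, mul_one, add_mul, add_mul]
  refine add_le_add ?_ ?_
  · have e : zPart p ^ 2 - zPart q ^ 2 = (zPart p + zPart q) * zPart (p - q) := by
      rw [zPart_sub]; ring
    rw [e, norm_mul]
    refine mul_le_mul ?_ (abs_zPart_le _) (norm_nonneg _) (by positivity)
    exact (abs_add_le _ _).trans (by linarith [hp.2, hq.2])
  · refine ((Phi T 1).le_opNorm _).trans ?_
    rw [mul_assoc, mul_assoc]
    refine mul_le_mul_of_nonneg_left ?_ (norm_nonneg _)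
    linarith

/-- Along `γ₀` the gradient is `(1 - tanh²)(b, -1)` and the `x`-velocity is also a bounded multiple
of `1 - tanh²`. Hence the residual is `ε` times a fixed `L²` function. -/
lemma exists_nl_zero_bound (T : Triple m) :
    ∃ L > 0, ∀ ε : ℝ, 0 < ε → ε ≤ 1 → ∀ t : ℝ,
      ‖nl T ε t 0 + Phi T ε (deriv (gamma0 T) t)‖ ≤ L * ε * (1 - prof T t ^ 2) := by
  obtain ⟨B, hB⟩ := gamma0_bounded T
  have hB0 : 0 ≤ B := (norm_nonneg _).trans (hB 0)
  obtain ⟨L, hL0, hL⟩ := exists_scaledR_bound T (K := B + 1) (by positivity)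
  set w : XSpace m := act T.A⁻¹ T.b
  set D := ‖Phi T 1‖ * (2 * rate T * ‖w‖) + ‖Phi T 1‖ * L * ‖vec T.b (-1)‖ + 1
  have hr := rate_pos' T
  refine ⟨D, by positivity, fun ε hε hε1 t => ?_⟩
  have hp : 0 ≤ 1 - prof T t ^ 2 := by
    have := abs_prof_le T t
    rw [sub_nonneg, ← sq_abs]
    exact pow_le_one₀ (abs_nonneg _) this
  have hx : √ε * ‖xPart (gamma0 T t)‖ ≤ B + 1 := by
    have h1 := (norm_xPart_le _).trans (hB t)
    have hs1 : √ε ≤ 1 := Real.sqrt_le_one.2 hε1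
    have h2 : √ε * ‖xPart (gamma0 T t)‖ ≤ ‖xPart (gamma0 T t)‖ :=
      mul_le_of_le_one_left (norm_nonneg _) hs1
    linarith
  have h1 := (hL ε hε hε1 _ hx (((abs_zPart_le _).trans (hB t)).trans (by linarith))).1
  have hg : gradVec T (gamma0 T t) = (1 - prof T t ^ 2) • vec T.b (-1) := by
    apply Phase.ext_parts
    · simp [gradVec, xPart_gamma0', act_smul, act_act_inv T.A_inv]
    · simp [gradVec, zPart_gamma0']
  rw [hg, norm_smul, Real.norm_of_nonneg hp] at h1
  have h2 : Phi T ε (vec (xPart (deriv (gamma0 T) t)) 0)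
      = ε • Phi T 1 (vec (xPart (deriv (gamma0 T) t)) 0) := by
    apply Phase.ext_parts
    · simp
    · simp
      ring
  have h3 : ‖(vec (xPart (deriv (gamma0 T) t)) 0 : Phase m)‖
      ≤ 2 * rate T * ‖w‖ * (1 - prof T t ^ 2) := by
    refine (norm_le_parts _).trans ?_
    rw [xPart_vec, zPart_vec, abs_zero, add_zero, deriv_gamma0, xPart_smul, xPart_vec, norm_smul,
      norm_smul, Real.norm_of_nonneg (mul_nonneg hr.le hp), norm_mul, norm_neg,
      Real.norm_eq_abs, Real.norm_eq_abs, abs_two]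
    have := abs_prof_le T t
    have h4 : 0 ≤ rate T * (1 - prof T t ^ 2) * ‖w‖ :=
      mul_nonneg (mul_nonneg hr.le hp) (norm_nonneg w)
    change rate T * (1 - prof T t ^ 2) * (2 * |prof T t| * ‖w‖) ≤ _
    have h5 := mul_le_of_le_one_right h4 this
    linarith
  rw [nl_zero_add T hε, h2]
  refine (norm_sub_le _ _).trans ?_
  rw [norm_smul, Real.norm_of_nonneg hε.le]
  have h5 := ((Phi T 1).le_opNorm _).trans (mul_le_mul_of_nonneg_left h3 (norm_nonneg (Phi T 1)))
  have h6 := ((Phi T 1).le_opNorm (scaledR T ε (gamma0 T t))).trans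
    (mul_le_mul_of_nonneg_left h1 (norm_nonneg (Phi T 1)))
  have h7 := mul_le_mul_of_nonneg_left h5 hε.le
  have h8 : 0 ≤ ε * (1 - prof T t ^ 2) := mul_nonneg hε.le hp
  simp only [D]
  linarith

/-! ### Existence -/

lemma exists_mapW12 (L : Phase m →L[ℝ] Phase m) : ∃ M : W12 m →ₗ[ℝ] W12 m, ∀ η,
    incl (M η) = mulOp _ (EssBdd.const L) (incl η) ∧
      wderiv (M η) = mulOp _ (EssBdd.const L) (wderiv η) := by
  choose M h1 h2 using exists_map_W12 (m := m) L
  refine ⟨{ toFun := M, map_add' := fun f g => ?_, map_smul' := fun c f => ?_ },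
    fun η => ⟨h1 η, h2 η⟩⟩
  · apply W12_ext
    · rw [h1, map_add, map_add, map_add, h1, h1]
    · rw [h2, map_add, map_add, map_add, h2, h2]
  · apply W12_ext
    · rw [h1, map_smul, map_smul, map_smul, h1, RingHom.id_apply]
    · rw [h2, map_smul, map_smul, map_smul, h2, RingHom.id_apply]

lemma normW12Eps_eq (T : Triple m) {ε : ℝ} (hε : 0 < ε) {η Y : W12 m}
    (h1 : incl η = mulOp _ (EssBdd.const (PhiInv T ε)) (incl Y))
    (h2 : wderiv η = mulOp _ (EssBdd.const (PhiInv T ε)) (wderiv Y)) :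
    normW12Eps T ε η = ‖Y‖ := by
  have key : ∀ f g : L2 m, f = mulOp _ (EssBdd.const (PhiInv T ε)) g →
      ∫ t, normSqEps T ε (f t) = ‖g‖ ^ 2 := by
    intro f g hfg
    rw [norm_sq_eq_integral_of_ae (f := g) ae_eq_rfl]
    refine integral_congr_ae ?_
    filter_upwards [coeFn_mulOp (EssBdd.const (PhiInv T ε)) g] with t ht
    rw [hfg, ← norm_sq_Phi, ht, Phi_PhiInv T hε]
  rw [normW12Eps, ← incl_coe, ← wderiv_coe, key _ _ h1, key _ _ h2, add_comm, ← W12_norm_sq,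
    Real.sqrt_sq (norm_nonneg Y)]

/-- `PhiInv` divides the `x`-part by `ε`; the hypothesis provides exactly this factor. The `z`-part
costs nothing because `β` is a unit vector. -/
lemma norm_mulOp_PhiInv_le (T : Triple m) {ε : ℝ} (hε : 0 < ε) (f : L2 m) {c : ℝ}
    (hc : 0 ≤ c) (h : ∫ t, ‖xPart (f t)‖ ^ 2 ≤ (ε * c) ^ 2) :
    ‖mulOp _ (EssBdd.const (PhiInv T ε)) f‖ ≤ c + ‖f‖ := by
  refine le_of_sq_le_sq ?_ (add_nonneg hc (norm_nonneg f))
  rw [norm_sq_eq_integral_of_ae (coeFn_mulOp _ f)]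
  have hf := norm_sq_eq_integral_of_ae (f := f) ae_eq_rfl
  have i0 : Integrable fun t => ‖f t‖ ^ 2 :=
    (memLp_two_iff_integrable_sq_norm (Lp.memLp f).1).1 (Lp.memLp f)
  have i1 : Integrable fun t => ‖xPart (f t)‖ ^ 2 :=
    (memLp_two_iff_integrable_sq_norm (memLp_xPart (Lp.memLp f)).1).1 (memLp_xPart (Lp.memLp f))
  have h1 : ∫ t, ‖PhiInv T ε (f t)‖ ^ 2
      ≤ ∫ t, (ε⁻¹ ^ 2 * ‖xPart (f t)‖ ^ 2 + ‖f t‖ ^ 2) := by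
    refine integral_mono_of_nonneg (Eventually.of_forall fun t => by positivity)
      ((i1.const_mul _).add i0) (Eventually.of_forall fun t => ?_)
    simp only [PhiInv_apply, norm_sq_eq_parts (vec _ _), xPart_vec, zPart_vec, norm_smul, mul_pow,
      Real.norm_eq_abs, sq_abs]
    refine add_le_add le_rfl ?_
    rw [← sq_abs]
    refine pow_le_pow_left₀ (abs_nonneg _) ?_ 2
    exact (abs_real_inner_le_norm _ _).trans (by rw [norm_unitVec, one_mul])
  rw [integral_add (i1.const_mul _) i0, integral_const_mul, ← hf] at h1
  have h2 : ε⁻¹ ^ 2 * ∫ t, ‖xPart (f t)‖ ^ 2 ≤ c ^ 2 := by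
    refine (mul_le_mul_of_nonneg_left h (by positivity)).trans (le_of_eq ?_)
    field_simp
  refine h1.trans ?_
  have := norm_nonneg f
  generalize ‖f‖ = n at *
  nlinarith

lemma norm_incl_le (η : W12 m) : ‖incl η‖ ≤ ‖η‖ := by
  refine le_of_sq_le_sq ?_ (norm_nonneg _)
  rw [W12_norm_sq]
  exact le_add_of_nonneg_right (sq_nonneg _)

/-- A right inverse of the linearisation at `γ₀`, with uniform estimates. -/
theorem exists_solutionOp (T : Triple m) : ∃ C > 0, ∃ ε₀ > 0, ∀ ε : ℝ, 0 < ε → ε < ε₀ →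
    ∃ S : L2 m →ₗ[ℝ] W12 m, ∀ g,
      (∀ᵐ t, Phi T ε (dot (S g) t) + opP T ε t (Phi T ε (fn (S g) t)) = g t) ∧
      (S g).1.fst ∈ Set.range (adjointOp T ε) ∧ normW12Eps T ε (S g) ≤ C * ‖g‖ ∧
      (∀ᵐ t, ε * ‖xPart (fn (S g) t)‖ ≤ C * ‖g‖ ∧ |zPart (fn (S g) t)| ≤ C * ‖g‖) ∧
      ‖incl (S g)‖ ≤ C * ‖g‖ := by
  obtain ⟨C, hC, ε₀, hε₀, H⟩ := exists_uniform_rightInverse T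
  refine ⟨C + C, by positivity, ε₀, hε₀, fun ε hε hε' => ?_⟩
  obtain ⟨S, hS⟩ := H ε hε hε'
  obtain ⟨M, hM⟩ := exists_mapW12 (PhiInv T ε)
  refine ⟨M ∘ₗ S, fun g => ?_⟩
  obtain ⟨h1, ⟨v, hv⟩, h3, h4⟩ := hS g
  obtain ⟨m1, m2⟩ := hM (S g)
  rw [LinearMap.comp_apply]
  have hCg : 0 ≤ C * ‖g‖ := mul_nonneg hC.le (norm_nonneg g)
  have hle : C * ‖g‖ ≤ (C + C) * ‖g‖ := by
    rw [add_mul]; exact le_add_of_nonneg_left hCg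
  have e1 : ∀ᵐ t, fn (M (S g)) t = PhiInv T ε (fn (S g) t) := by
    rw [← incl_coe, m1]
    exact coeFn_mulOp _ _
  have e2 : ∀ᵐ t, dot (M (S g)) t = PhiInv T ε (dot (S g) t) := by
    rw [← wderiv_coe, m2]
    exact coeFn_mulOp _ _
  refine ⟨?_, ?_, ?_, ?_, ?_⟩
  · have h5 : ∀ᵐ t, dot (S g) t + opP T ε t (fn (S g) t) = g t := by
      have := Lp.coeFn_add (wderiv (S g)) (mulOp _ (essBdd_opP T ε) (incl (S g)))
      rw [h1] at this
      filter_upwards [this, coeFn_mulOp (essBdd_opP T ε) (incl (S g))] with t t1 t2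
      rw [t1, Pi.add_apply, t2]
      rfl
    filter_upwards [e1, e2, h5] with t t1 t2 t3
    rw [t1, t2, Phi_PhiInv T hε, Phi_PhiInv T hε, t3]
  · obtain ⟨v1, v2⟩ := hM v
    refine ⟨M v, ?_⟩
    apply Lp.ext
    have e3 : ∀ᵐ t, fn (M v) t = PhiInv T ε (fn v t) := by
      rw [← incl_coe, v1]
      exact coeFn_mulOp _ _
    have e4 : ∀ᵐ t, dot (M v) t = PhiInv T ε (dot v t) := by
      rw [← wderiv_coe, v2]
      exact coeFn_mulOp _ _
    have e5 : ∀ᵐ t, fn (S g) t = -dot v t + opP T ε t (fn v t) := by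
      rw [← incl_coe, hv]
      filter_upwards [Lp.coeFn_add (-wderiv v) (mulOp _ (essBdd_opP T ε) (incl v)),
        Lp.coeFn_neg (wderiv v), coeFn_mulOp (essBdd_opP T ε) (incl v)] with t t1 t2 t3
      rw [t1, Pi.add_apply, t2, t3]
      rfl
    filter_upwards [e1, e3, e4, e5, MemLp.coeFn_toLp
      ((memLp_dot (M v)).neg.add (memLp_Q T ε (memLp_fn (M v))))] with t t1 t3 t4 t5 t6
    refine t6.trans ?_
    change _ = fn (M (S g)) t
    rw [t1, t5, map_add, map_neg]
    change -dot (M v) t + Q T ε t (fn (M v) t) = _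
    rw [t3, t4, ← PhiInv_Phi T hε (Q T ε t _), Phi_Q T hε, Phi_PhiInv T hε]
  · rw [normW12Eps_eq T hε m1 m2]
    exact h3.trans hle
  · filter_upwards [e1, ae_norm_le (S g)] with t t1 t2
    have t3 := t2.trans h3
    rw [t1, PhiInv_apply, xPart_vec, zPart_vec, norm_smul, norm_inv, Real.norm_of_nonneg hε.le,
      mul_inv_cancel_left₀ hε.ne']
    refine ⟨((norm_xPart_le _).trans t3).trans hle, ?_⟩
    refine ((abs_real_inner_le_norm _ _).trans ?_).trans (t3.trans hle)
    rw [norm_unitVec, one_mul]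
  · rw [m1, add_mul]
    refine (norm_mulOp_PhiInv_le T hε (incl (S g)) hCg ?_).trans (add_le_add le_rfl ?_)
    · refine h4.trans (le_of_eq ?_)
      ring
    · exact (norm_incl_le _).trans h3

lemma exists_fixedPoint_closedBall {X : Type*} [NormedAddCommGroup X] [CompleteSpace X]
    (N : X → X) {r : ℝ} (hr : 0 ≤ r) (h0 : ‖N 0‖ ≤ r / 2)
    (hN : ∀ x y, ‖x‖ ≤ r → ‖y‖ ≤ r → ‖N x - N y‖ ≤ 1 / 2 * ‖x - y‖) :
    ∃ x, ‖x‖ ≤ r ∧ N x = x := by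
  have hmaps : Set.MapsTo N (Metric.closedBall 0 r) (Metric.closedBall 0 r) := by
    intro x hx
    rw [mem_closedBall_zero_iff] at hx ⊢
    have h1 := hN x 0 hx (by rwa [norm_zero])
    rw [sub_zero] at h1
    have h2 := norm_sub_norm_le (N x) (N 0)
    linarith
  have hc : ContractingWith (1 / 2 : NNReal) hmaps.restrict := by
    refine ⟨by rw [← NNReal.coe_lt_coe]; norm_num, LipschitzWith.of_dist_le_mul fun x y => ?_⟩
    have := hN x y (mem_closedBall_zero_iff.1 x.2) (mem_closedBall_zero_iff.1 y.2)
    rw [← dist_eq_norm, ← dist_eq_norm] at this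
    push_cast
    exact this
  have hs : IsComplete (Metric.closedBall (0 : X) r) := Metric.isClosed_closedBall.isComplete
  obtain ⟨x, hx, hfix, -⟩ := hc.exists_fixedPoint' hs hmaps
    (Metric.mem_closedBall_self hr) (edist_ne_top _ _)
  exact ⟨x, mem_closedBall_zero_iff.1 hx, hfix⟩

lemma Phi_functionalFun (T : Triple m) {ε : ℝ} (hε : 0 < ε) (η : W12 m) (t : ℝ) :
    Phi T ε (functionalFun T ε η t) = Phi T ε (dot η t) + opP T ε t (Phi T ε (fn η t))
      + (nl T ε t (fn η t) + Phi T ε (deriv (gamma0 T) t)) := by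
  rw [functionalFun_eq, map_add, map_add, nl, map_sub, Phi_Q T hε]
  abel

lemma exists_memLp_one_sub_prof_sq (T : Triple m) :
    ∃ s : Lp ℝ 2 (volume : Measure ℝ), s =ᵐ[volume] fun t => 1 - prof T t ^ 2 := by
  have h3 : (fun t => 1 - prof T t ^ 2)
      = fun t => (Real.cosh ((1 - ‖T.b‖ ^ 2) * t) ^ 2)⁻¹ := by
    funext t
    have := (Real.cosh_pos ((1 - ‖T.b‖ ^ 2) * t)).ne'
    rw [prof, rate, Real.tanh_eq_sinh_div_cosh]
    field_simp
    linarith [Real.cosh_sq ((1 - ‖T.b‖ ^ 2) * t)]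
  rw [h3]
  exact ⟨_, (memLp_sech (rate_pos T)).coeFn_toLp⟩

lemma mem_region_of_le {K ε : ℝ} (hε : 0 < ε) (hε1 : ε ≤ 1) (hK : 0 ≤ K) {p : Phase m}
    (h : ε * ‖xPart p‖ ≤ K * ε ∧ |zPart p| ≤ K * ε) : p ∈ region m K ε := by
  have hs1 : √ε ≤ 1 := Real.sqrt_le_one.2 hε1
  have hs : ε ≤ √ε := Real.le_sqrt_of_sq_le (by nlinarith)
  constructor
  · have : ‖xPart p‖ ≤ K := le_of_mul_le_mul_left (by linarith [h.1]) hε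
    exact (mul_le_of_le_one_left (norm_nonneg _) hs1).trans this
  · exact h.2.trans (mul_le_mul_of_nonneg_left hs hK)

lemma toReal_eLpNorm_top_le {E : Type*} [NormedAddCommGroup E] {f : ℝ → E} {c : ℝ} (hc : 0 ≤ c)
    (h : ∀ᵐ t, ‖f t‖ ≤ c) : (eLpNorm f ⊤ (volume : Measure ℝ)).toReal ≤ c := by
  refine ENNReal.toReal_le_of_le_ofReal hc ?_
  rw [eLpNorm_exponent_top]
  exact eLpNormEssSup_le_of_ae_bound h

/-- This fixes the threshold for `ε` at which the Lipschitz constant `L√ε`, composed with a solution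
operator of norm `C`, becomes a contraction factor `1/2`. -/
lemma mul_sqrt_mul_le {L C ε : ℝ} (hL : 0 < L) (hC : 0 < C) (hε : ε ≤ ((2 * (L * C)) ^ 2)⁻¹) :
    L * √ε * C ≤ 1 / 2 := by
  have h1 : √ε ≤ (2 * (L * C))⁻¹ := by
    refine Real.sqrt_le_iff.2 ⟨by positivity, ?_⟩
    rwa [inv_pow]
  have h2 := mul_le_mul_of_nonneg_right h1 (by positivity : 0 ≤ L * C)
  have h3 : (2 * (L * C))⁻¹ * (L * C) = 1 / 2 := by field_simp
  linarith

lemma mulOp_Phi_injective (T : Triple m) {ε : ℝ} (hε : 0 < ε) :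
    Function.Injective (mulOp _ (EssBdd.const (Phi T ε))) := by
  intro f g h
  apply Lp.ext
  have h1 := coeFn_mulOp (EssBdd.const (Phi T ε)) f
  rw [h] at h1
  filter_upwards [h1, coeFn_mulOp (EssBdd.const (Phi T ε)) g] with t t1 t2
  rw [← PhiInv_Phi T hε (f t), ← t1, t2, PhiInv_Phi T hε]

/-- Zeros of the functional satisfying all the estimates. -/
theorem exists_zero (T : Triple m) : ∃ C > 0, ∃ ε₀ > 0, ∀ ε : ℝ, 0 < ε → ε < ε₀ →
    ∃ η : W12 m, functional T ε η = 0 ∧ η.1.fst ∈ Set.range (adjointOp T ε) ∧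
      normW12Eps T ε η + √ε * normLinftyEps ε η ≤ C * ε := by
  obtain ⟨C, hC, ε₀, hε₀, H⟩ := exists_solutionOp T
  obtain ⟨L₀, hL₀, HL₀⟩ := exists_nl_zero_bound T
  obtain ⟨s, hs⟩ := exists_memLp_one_sub_prof_sq T
  -- The ball has radius `Kε`, at least twice the size of the residual of `γ₀`; the summand `1` only
  -- ensures `K > 0`.
  set K := 2 * (L₀ * ‖s‖ + 1) with hK
  have hK0 : 0 < K := by positivity
  obtain ⟨L, hL, HL⟩ := exists_nl_lipschitz T (K := C * K) (by positivity)
  -- One `CK` is for the `W^{1,2}_ε` norm, and one for each of the two terms of the sup norm, with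
  -- `√ε ≤ 1`.
  refine ⟨3 * (C * K), by positivity, min ε₀ (min 1 ((2 * (L * C)) ^ 2)⁻¹), by positivity,
    fun ε hε hε' => ?_⟩
  rw [lt_min_iff, lt_min_iff] at hε'
  obtain ⟨hε1, hε2, hε3⟩ := hε'
  have hsq := mul_sqrt_mul_le hL hC hε3.le
  obtain ⟨S, hS⟩ := H ε hε hε1
  -- The unknown is the right-hand side `g`, with `η = S g`, so every candidate lies in the image of
  -- the adjoint. As `S` inverts the linear part, `N g` is minus the nonlinear remainder, and fixed
  -- points are zeros of the functional.
  let N : L2 m → L2 m := fun g =>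
    g - mulOp _ (EssBdd.const (Phi T ε)) (functional T ε (S g))
  have hN : ∀ g, ∀ᵐ t, N g t = -(nl T ε t (fn (S g) t) + Phi T ε (deriv (gamma0 T) t)) := by
    intro g
    filter_upwards [Lp.coeFn_sub g (mulOp _ (EssBdd.const (Phi T ε)) (functional T ε (S g))),
      coeFn_mulOp (EssBdd.const (Phi T ε)) (functional T ε (S g)),
      (memLp_functionalFun T ε (S g)).coeFn_toLp, (hS g).1] with t t1 t2 t3 t4
    refine t1.trans ?_
    rw [Pi.sub_apply, t2]
    change g t - Phi T ε ((memLp_functionalFun T ε (S g)).toLp _ t) = _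
    rw [t3, Phi_functionalFun T hε, t4]
    abel
  have hreg : ∀ g : L2 m, ‖g‖ ≤ K * ε → ∀ᵐ t, fn (S g) t ∈ region m (C * K) ε := by
    intro g hg
    filter_upwards [(hS g).2.2.2.1] with t ht
    have h1 : C * ‖g‖ ≤ C * K * ε := by
      rw [mul_assoc]; exact mul_le_mul_of_nonneg_left hg hC.le
    exact mem_region_of_le hε hε2.le (by positivity) ⟨ht.1.trans h1, ht.2.trans h1⟩
  have hN0 : ‖N 0‖ ≤ K * ε / 2 := by
    have h1 : ‖N 0‖ ≤ L₀ * ε * ‖s‖ := by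
      refine Lp.norm_le_mul_norm_of_ae_le_mul ?_
      have h0 : ∀ᵐ t, fn (S 0) t = 0 := by
        rw [map_zero]
        exact Lp.coeFn_zero (Phase m) 2 (volume : Measure ℝ)
      filter_upwards [hN 0, h0, hs] with t t1 t2 t3
      rw [t1, t2, t3, norm_neg]
      exact (HL₀ ε hε hε2.le t).trans (mul_le_mul_of_nonneg_left (le_abs_self _) (by positivity))
    refine h1.trans ?_
    rw [hK]
    linarith
  have hNl : ∀ f g, ‖f‖ ≤ K * ε → ‖g‖ ≤ K * ε → ‖N f - N g‖ ≤ 1 / 2 * ‖f - g‖ := by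
    intro f g hf hg
    have h1 : ‖N f - N g‖ ≤ L * √ε * ‖incl (S (f - g))‖ := by
      refine Lp.norm_le_mul_norm_of_ae_le_mul ?_
      have h0 : ∀ᵐ t, incl (S (f - g)) t = fn (S f) t - fn (S g) t := by
        rw [map_sub, map_sub]
        exact Lp.coeFn_sub _ _
      filter_upwards [Lp.coeFn_sub (N f) (N g), hN f, hN g, hreg f hf, hreg g hg, h0]
        with t t1 t2 t3 t4 t5 t6
      rw [t1, Pi.sub_apply, t2, t3, t6, neg_sub_neg, add_sub_add_right_eq_sub, norm_sub_rev]
      exact HL ε hε hε2.le t _ t4 _ t5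
    have h2 := mul_le_mul_of_nonneg_left (hS (f - g)).2.2.2.2
      (by positivity : 0 ≤ L * √ε)
    refine (h1.trans h2).trans ?_
    rw [← mul_assoc]
    exact mul_le_mul_of_nonneg_right hsq (norm_nonneg _)
  obtain ⟨g, hg, hfix⟩ := exists_fixedPoint_closedBall N (by positivity) hN0 hNl
  have hCg : C * ‖g‖ ≤ C * K * ε := by
    rw [mul_assoc]; exact mul_le_mul_of_nonneg_left hg hC.le
  obtain ⟨-, h2, h3, h4, -⟩ := hS g
  refine ⟨S g, ?_, h2, ?_⟩
  · have h5 : mulOp _ (EssBdd.const (Phi T ε)) (functional T ε (S g)) = 0 := sub_eq_self.1 hfix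
    exact mulOp_Phi_injective T hε (h5.trans (map_zero _).symm)
  · have hcg0 : 0 ≤ C * ‖g‖ := mul_nonneg hC.le (norm_nonneg g)
    have x1 : ε * (eLpNorm (fun t => xPart (fn (S g) t)) ⊤ (volume : Measure ℝ)).toReal
        ≤ C * ‖g‖ := by
      have : (eLpNorm (fun t => xPart (fn (S g) t)) ⊤ (volume : Measure ℝ)).toReal
          ≤ C * ‖g‖ / ε := by
        refine toReal_eLpNorm_top_le (div_nonneg hcg0 hε.le) ?_
        filter_upwards [h4] with t ht
        rw [le_div_iff₀ hε, mul_comm]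
        exact ht.1
      have h7 := mul_le_mul_of_nonneg_left this hε.le
      rwa [mul_div_cancel₀ _ hε.ne'] at h7
    have x2 : (eLpNorm (fun t => zPart (fn (S g) t)) ⊤ (volume : Measure ℝ)).toReal
        ≤ C * ‖g‖ := toReal_eLpNorm_top_le hcg0 (by filter_upwards [h4] with t ht using ht.2)
    have x3 : normLinftyEps ε (S g) ≤ 2 * (C * K * ε) := by
      rw [normLinftyEps]; linarith
    have x4 : √ε * normLinftyEps ε (S g) ≤ 1 * (2 * (C * K * ε)) :=
      mul_le_mul (Real.sqrt_le_one.2 hε2.le) x3 (by unfold normLinftyEps; positivity) zero_le_one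
    linarith

/-! ### Regularity -/

lemma contDiff_vec {E : Type*} [NormedAddCommGroup E] [NormedSpace ℝ E] {f : E → XSpace m}
    {g : E → ℝ} (hf : ContDiff ℝ ∞ f) (hg : ContDiff ℝ ∞ g) :
    ContDiff ℝ ∞ fun e => vec (f e) (g e) := by
  refine (contDiff_piLp 2).2 fun i => ?_
  rcases i with i | i
  · exact (contDiff_piLp 2).1 hf i
  · exact hg

lemma contDiff_xPart : ContDiff ℝ ∞ (xPart : Phase m → XSpace m) :=
  (contDiff_piLp 2).2 fun i => (contDiff_piLp 2).1 (contDiff_id (𝕜 := ℝ) (E := Phase m)) (Sum.inl i)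

lemma contDiff_zPart : ContDiff ℝ ∞ (zPart : Phase m → ℝ) :=
  (contDiff_piLp 2).1 (contDiff_id (𝕜 := ℝ) (E := Phase m)) (Sum.inr ())

lemma contDiff_act {E ι : Type} [NormedAddCommGroup E] [NormedSpace ℝ E] [Fintype ι]
    [DecidableEq ι] {M : E → Matrix ι ι ℝ} {f : E → EuclideanSpace ℝ ι}
    (hM : ∀ i j, ContDiff ℝ ∞ fun e => M e i j) (hf : ContDiff ℝ ∞ f) :
    ContDiff ℝ ∞ fun e => act (M e) (f e) := by
  refine (contDiff_piLp 2).2 fun i => ?_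
  exact ContDiff.sum fun j _ => (hM i j).mul ((contDiff_piLp 2).1 hf j)

lemma contDiff_gradVec (T : Triple m) : ContDiff ℝ ∞ (gradVec T) :=
  contDiff_vec (contDiff_act (fun _ _ => contDiff_const) contDiff_xPart)
    ((contDiff_zPart.pow 2).sub contDiff_const)

lemma contDiff_scaledR (T : Triple m) (ε : ℝ) : ContDiff ℝ ∞ (scaledR T ε) := by
  refine (contDiff_act (fun i j => ?_) (contDiff_gradVec T)).neg
  have h1 : ContDiff ℝ ∞ fun p : Phase m => ε ^ 2 • xPart p := contDiff_xPart.const_smul _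
  have h2 : ContDiff ℝ ∞ fun p : Phase m => ε * zPart p := contDiff_const.mul contDiff_zPart
  exact (T.h_smooth i j).comp (contDiff_const.prodMk (contDiff_vec h1 h2) :
    ContDiff ℝ ∞ fun p : Phase m => (ε, vec (ε ^ 2 • xPart p) (ε * zPart p)))

lemma contDiff_R (T : Triple m) (ε : ℝ) : ContDiff ℝ ∞ (R T ε) := by
  have h1 : ContDiff ℝ ∞ fun p : Phase m => ε⁻¹ • xPart (scaledR T ε p) :=
    (contDiff_xPart.comp (contDiff_scaledR T ε)).const_smul _
  exact contDiff_vec h1 (contDiff_zPart.comp (contDiff_scaledR T ε))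

lemma contDiff_field (T : Triple m) (ε : ℝ) : ContDiff ℝ ∞ (field T ε) := by
  have h1 : ContDiff ℝ ∞ fun p : Phase m => act T.A (xPart p) :=
    contDiff_act (fun _ _ => contDiff_const) contDiff_xPart
  have h2 : ContDiff ℝ ∞ fun p : Phase m => 1 - zPart p ^ 2 :=
    contDiff_const.sub (contDiff_zPart.pow 2)
  have h3 : ContDiff ℝ ∞ fun p => xPart (R T ε p) := contDiff_xPart.comp (contDiff_R T ε)
  have h4 : ContDiff ℝ ∞ fun p => zPart (R T ε p) := contDiff_zPart.comp (contDiff_R T ε)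
  exact contDiff_vec (f := fun p => ε⁻¹ • (act T.A (xPart p) - (1 - zPart p ^ 2) • T.b)
      - xPart (R T ε p)) (by fun_prop)
    (((h1.inner ℝ contDiff_const).sub h2).sub h4)

/-- Solutions of smooth autonomous equations are smooth. -/
lemma contDiff_of_autonomous {E : Type*} [NormedAddCommGroup E] [NormedSpace ℝ E] {f : E → E}
    (hf : ContDiff ℝ ∞ f) {γ : ℝ → E} (hγ : ∀ t, HasDerivAt γ (f (γ t)) t) : ContDiff ℝ ∞ γ := by
  refine contDiff_infty.2 fun n => ?_
  induction n with
  | zero =>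
    exact contDiff_zero.2 (continuous_iff_continuousAt.2 fun t => (hγ t).continuousAt)
  | succ n ih =>
    push_cast
    rw [contDiff_succ_iff_deriv]
    refine ⟨fun t => (hγ t).differentiableAt, by simp, ?_⟩
    rw [show deriv γ = fun t => f (γ t) from funext fun t => (hγ t).deriv]
    exact (hf.of_le (by exact_mod_cast le_top)).comp ih

lemma IsPrimitive.hasDerivAt_of_continuous {E : Type} [NormedAddCommGroup E] [NormedSpace ℝ E]
    [CompleteSpace E] {U w : ℝ → E} (h : IsPrimitive U w) (hw : Continuous w) (t : ℝ) :
    HasDerivAt U (w t) t := by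
  rw [h.eq_add 0]
  exact (intervalIntegral.integral_hasDerivAt_right (hw.intervalIntegrable _ _)
    (hw.stronglyMeasurableAtFilter _ _) hw.continuousAt).add_const _

lemma tendsto_tanh_atTop : Tendsto Real.tanh atTop (𝓝 1) := by
  have h : Real.tanh = fun x => (1 - Real.exp (-x) * Real.exp (-x))
      / (1 + Real.exp (-x) * Real.exp (-x)) := by
    funext x
    rw [Real.tanh_eq_sinh_div_cosh, Real.sinh_eq, Real.cosh_eq, Real.exp_neg]
    have := Real.exp_pos x
    field_simp
  have h0 : Tendsto (fun x => Real.exp (-x)) atTop (𝓝 0) := Real.tendsto_exp_neg_atTop_nhds_zero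
  have h1 := ((h0.mul h0).const_sub 1).div ((h0.mul h0).const_add 1) (by norm_num)
  rw [h]
  simp only [mul_zero, sub_zero, add_zero, div_one] at h1
  exact h1

lemma tendsto_tanh_atBot : Tendsto Real.tanh atBot (𝓝 (-1)) := by
  have h := (tendsto_tanh_atTop.comp tendsto_neg_atBot_atTop).neg
  refine h.congr fun x => ?_
  simp

lemma tendsto_gamma0 (T : Triple m) {l : Filter ℝ} {a : ℝ} (ha : a ^ 2 = 1)
    (h : Tendsto (prof T) l (𝓝 a)) : Tendsto (gamma0 T) l (𝓝 (vec 0 a)) := by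
  rw [show gamma0 T = _ from funext (gamma0_eq T)]
  have h1 := (((h.pow 2).const_sub 1).smul_const (vec (act T.A⁻¹ T.b) 0)).add
    (h.smul_const (vec (0 : XSpace m) 1))
  convert h1 using 2
  apply Phase.ext_parts <;> simp [ha]

lemma isSmoothSolution_of_hasDerivAt (T : Triple m) {ε : ℝ} (hε : 0 < ε) {γ : ℝ → Phase m}
    (hγ : ∀ t, HasDerivAt γ (-field T ε (γ t)) t) (h1 : Tendsto γ atTop (𝓝 (vec 0 1)))
    (h2 : Tendsto γ atBot (𝓝 (vec 0 (-1)))) : IsSmoothSolution T ε γ where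
  smooth := contDiff_of_autonomous (contDiff_field T ε).neg hγ
  eq_x t := by
    rw [(hγ t).deriv, xPart_neg, field, xPart_vec, smul_neg, smul_sub, smul_smul,
      mul_inv_cancel₀ hε.ne', one_smul]
    abel
  eq_z t := by
    rw [(hγ t).deriv, zPart_neg, field, zPart_vec]
    ring
  lim_top := h1
  lim_bot := h2

/-- The weak derivative of `η` agrees almost everywhere with a continuous function of its continuous
representative, which is therefore `C¹` and solves an autonomous smooth equation. The limits are
those of `γ₀`, because the representative decays. -/
theorem exists_smooth_of_functional_eq_zero (T : Triple m) {ε : ℝ} (hε : 0 < ε) {η : W12 m}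
    (h : functional T ε η = 0) : ∃ γ : ℝ → Phase m, IsSmoothSolution T ε γ ∧
      γ =ᵐ[volume] fun t => gamma0 T t + fn η t := by
  obtain ⟨U, hU, hp⟩ := exists_rep η
  obtain ⟨d1, d2, -⟩ := rep_decay η hU hp
  have hγ0 : Continuous (gamma0 T) := (contDiff_gamma0 T).continuous
  have hd0 : Continuous (deriv (gamma0 T)) := (contDiff_gamma0 T).continuous_deriv (by simp)
  have h1 : dot η =ᵐ[volume]
      fun t => -field T ε (gamma0 T t + U t) - deriv (gamma0 T) t := by
    have h2 := (memLp_functionalFun T ε η).coeFn_toLp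
    change functional T ε η =ᵐ[volume] _ at h2
    rw [h] at h2
    filter_upwards [h2, hU, Lp.coeFn_zero (Phase m) 2 (volume : Measure ℝ)] with t t1 t2 t3
    rw [t3, Pi.zero_apply, functionalFun_eq, t2] at t1
    rw [eq_comm, add_eq_zero_iff_eq_neg] at t1
    rw [eq_sub_iff_add_eq, t1]
  have hw := ((contDiff_field T ε).continuous.comp (hγ0.add hp.continuous)).neg.sub hd0
  have hder := (hp.congr_ae h1).hasDerivAt_of_continuous hw
  have hr := rate_pos' T
  refine ⟨fun t => gamma0 T t + U t, isSmoothSolution_of_hasDerivAt T hε (fun t => ?_) ?_ ?_, ?_⟩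
  · have := (((contDiff_gamma0 T).differentiable (by simp)) t).hasDerivAt.add (hder t)
    refine this.congr_deriv ?_
    abel
  · simpa using (tendsto_gamma0 T (by norm_num)
      (tendsto_tanh_atTop.comp (tendsto_id.const_mul_atTop hr))).add d1
  · simpa using (tendsto_gamma0 T (by norm_num)
      (tendsto_tanh_atBot.comp (tendsto_id.const_mul_atBot hr))).add d2
  · filter_upwards [hU] with t ht
    rw [ht]

/-! ### Transversality -/

lemma essBdd_fderiv_field (T : Triple m) (ε : ℝ) (η : W12 m) :
    EssBdd fun t => fderiv ℝ (field T ε) (gamma0 T t + fn η t) where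
  meas := ((contDiff_field T ε).continuous_fderiv (by simp)).comp_aestronglyMeasurable
    ((continuous_gamma0 T).aestronglyMeasurable.add (memLp_fn η).1)
  bdd := by
    obtain ⟨B, hB⟩ := gamma0_bounded T
    obtain ⟨M, hM⟩ := (isCompact_closedBall (0 : Phase m) (B + ‖η‖)).exists_bound_of_continuousOn
      ((contDiff_field T ε).continuous_fderiv (by simp)).continuousOn
    refine ⟨M, ?_⟩
    filter_upwards [ae_norm_le η] with t ht
    exact hM _ (mem_closedBall_zero_iff.2 ((norm_add_le _ _).trans (add_le_add (hB t) ht)))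

/-- The mean value inequality for `f - fderiv ℝ f p` on the ball of radius `‖v‖` about `p`, where
the derivative varies by at most `M‖v‖`. -/
lemma exists_quadratic_remainder {E F : Type*} [NormedAddCommGroup E] [NormedSpace ℝ E]
    [FiniteDimensional ℝ E] [NormedAddCommGroup F] [NormedSpace ℝ F] {f : E → F}
    (hf : ContDiff ℝ ∞ f) (r : ℝ) : ∃ M > 0, ∀ p v, ‖p‖ ≤ r → ‖v‖ ≤ 1 →
      ‖f (p + v) - f p - fderiv ℝ f p v‖ ≤ M * ‖v‖ * ‖v‖ := by
  obtain ⟨M, hM0, hM⟩ := exists_lipschitz_closedBall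
    ((contDiff_infty_iff_fderiv.1 hf).2.of_le (by simp)) (r + 1)
  refine ⟨M, hM0, fun p v hp hv => ?_⟩
  have h := (convex_closedBall p ‖v‖).norm_image_sub_le_of_norm_fderiv_le' (𝕜 := ℝ) (f := f)
    (φ := fderiv ℝ f p) (C := M * ‖v‖) (x := p) (y := p + v)
    (fun x _ => hf.differentiable (by simp) x) (fun x hx => ?_)
    (Metric.mem_closedBall_self (norm_nonneg v)) (by simp)
  · rwa [add_sub_cancel_left] at h
  · rw [mem_closedBall_iff_norm] at hx
    refine (hM x p ?_ (by linarith)).trans (mul_le_mul_of_nonneg_left hx hM0.le)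
    have := norm_sub_norm_le x p
    linarith

/-- The linearisation of the functional. -/
def linearisation (T : Triple m) (ε : ℝ) (η : W12 m) : W12 m →L[ℝ] L2 m :=
  wderiv + (mulOp _ (essBdd_fderiv_field T ε η)).comp incl

lemma coeFn_linearisation (T : Triple m) (ε : ℝ) (η v : W12 m) : linearisation T ε η v =ᵐ[volume]
    fun t => dot v t + fderiv ℝ (field T ε) (gamma0 T t + fn η t) (fn v t) := by
  filter_upwards [Lp.coeFn_add (wderiv v) (mulOp _ (essBdd_fderiv_field T ε η) (incl v)),
    coeFn_mulOp (essBdd_fderiv_field T ε η) (incl v)] with t t1 t2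
  refine t1.trans ?_
  rw [Pi.add_apply, t2]
  rfl

/-- Of the two factors of `v` in the pointwise quadratic remainder, one is bounded in the sup norm
by the Sobolev embedding and the other is kept in `L²`. -/
lemma exists_functional_remainder (T : Triple m) (ε : ℝ) (η : W12 m) : ∃ M > 0, ∀ v : W12 m,
    ‖v‖ ≤ 1 → ‖functional T ε (η + v) - functional T ε η - linearisation T ε η v‖
      ≤ M * ‖v‖ * ‖v‖ := by
  obtain ⟨B, hB⟩ := gamma0_bounded T
  obtain ⟨M, hM0, hM⟩ := exists_quadratic_remainder (contDiff_field T ε) (B + ‖η‖)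
  refine ⟨M, hM0, fun v hv => ?_⟩
  have h1 : ‖functional T ε (η + v) - functional T ε η - linearisation T ε η v‖
      ≤ M * ‖v‖ * ‖incl v‖ := by
    refine Lp.norm_le_mul_norm_of_ae_le_mul ?_
    have a1 : ∀ᵐ t, fn (η + v) t = fn η t + fn v t := Lp.coeFn_add _ _
    have a2 : ∀ᵐ t, dot (η + v) t = dot η t + dot v t := Lp.coeFn_add _ _
    filter_upwards [Lp.coeFn_sub (functional T ε (η + v) - functional T ε η)
        (linearisation T ε η v), Lp.coeFn_sub (functional T ε (η + v)) (functional T ε η),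
      (memLp_functionalFun T ε (η + v)).coeFn_toLp, (memLp_functionalFun T ε η).coeFn_toLp,
      coeFn_linearisation T ε η v, a1, a2, ae_norm_le η, ae_norm_le v]
      with t t1 t2 t3 t4 t5 t6 t7 t8 t9
    have e : (functional T ε (η + v) - functional T ε η - linearisation T ε η v : L2 m) t =
        field T ε (gamma0 T t + fn η t + fn v t) - field T ε (gamma0 T t + fn η t)
          - fderiv ℝ (field T ε) (gamma0 T t + fn η t) (fn v t) := by
      rw [t1, Pi.sub_apply, t2, Pi.sub_apply, t5]
      change (memLp_functionalFun T ε (η + v)).toLp _ t - (memLp_functionalFun T ε η).toLp _ t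
        - _ = _
      rw [t3, t4, functionalFun_eq, functionalFun_eq, t6, t7, ← add_assoc (gamma0 T t)]
      abel
    rw [e]
    refine (hM _ _ ((norm_add_le _ _).trans (add_le_add (hB t) t8)) (t9.trans hv)).trans ?_
    exact mul_le_mul_of_nonneg_right (mul_le_mul_of_nonneg_left t9 hM0.le) (norm_nonneg _)
  exact h1.trans (mul_le_mul_of_nonneg_left (norm_incl_le v) (by positivity))

theorem hasFDerivAt_functional (T : Triple m) (ε : ℝ) (η : W12 m) :
    HasFDerivAt (functional T ε) (linearisation T ε η) η := by
  obtain ⟨M, hM0, hM⟩ := exists_functional_remainder T ε η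
  rw [hasFDerivAt_iff_isLittleO_nhds_zero, Asymptotics.isLittleO_iff]
  intro c hc
  have h : ∀ᶠ v : W12 m in 𝓝 0, ‖v‖ < min 1 (c / M) := by
    have := Metric.ball_mem_nhds (0 : W12 m) (lt_min one_pos (div_pos hc hM0))
    filter_upwards [this] with v hv
    exact mem_ball_zero_iff.1 hv
  filter_upwards [h] with v hv
  refine (hM v (hv.le.trans (min_le_left _ _))).trans ?_
  refine mul_le_mul_of_nonneg_right ?_ (norm_nonneg v)
  have h2 := hv.le.trans (min_le_right _ _)
  rwa [le_div_iff₀ hM0, mul_comm] at h2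

lemma hasFDerivAt_nl (T : Triple m) {ε : ℝ} (hε : 0 < ε) (t : ℝ) (p : Phase m) :
    HasFDerivAt (nl T ε t) ((Phi T ε).comp (fderiv ℝ (field T ε) (gamma0 T t + p))
      - (opP T ε t).comp (Phi T ε)) p := by
  have e : nl T ε t = fun p => Phi T ε (field T ε (gamma0 T t + p)) - opP T ε t (Phi T ε p) := by
    funext p
    rw [nl, map_sub, Phi_Q T hε]
  rw [e]
  have h1 : HasFDerivAt (field T ε) (fderiv ℝ (field T ε) (gamma0 T t + p)) (gamma0 T t + p) :=
    ((contDiff_field T ε).differentiable (by simp) _).hasFDerivAt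
  have h2 : HasFDerivAt (fun p => field T ε (gamma0 T t + p))
      (fderiv ℝ (field T ε) (gamma0 T t + p)) p := by
    have := h1.comp p ((hasFDerivAt_id p).const_add (gamma0 T t))
    rwa [ContinuousLinearMap.comp_id] at this
  exact ((Phi T ε).hasFDerivAt.comp p h2).sub ((opP T ε t).comp (Phi T ε)).hasFDerivAt

lemma region_mem_nhds {K K' ε : ℝ} (hε : 0 < ε) (hK : K < K') {p : Phase m}
    (hp : p ∈ region m K ε) : region m K' ε ∈ 𝓝 p := by
  have hs : 0 < √ε := Real.sqrt_pos.2 hε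
  have h1 : Continuous fun p : Phase m => √ε * ‖xPart p‖ := by
    have := continuous_xPart (m := m)
    fun_prop
  have h2 : Continuous fun p : Phase m => |zPart p| := (continuous_zPart (m := m)).abs
  have g1 := h1.continuousAt.eventually_lt (continuousAt_const (y := K')) (hp.1.trans_lt hK)
  have g2 := h2.continuousAt.eventually_lt (continuousAt_const (y := K' * √ε))
    (hp.2.trans_lt (mul_lt_mul_of_pos_right hK hs))
  filter_upwards [g1, g2] with q q1 q2
  exact ⟨q1.le, q2.le⟩

/-- A Lipschitz constant valid near a point bounds the derivative there; enlarging `K` to `K + 1`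
makes the region a neighbourhood of each of its former points. -/
lemma exists_fderiv_nl_bound (T : Triple m) {K : ℝ} (hK : 0 < K) :
    ∃ L > 0, ∀ ε : ℝ, 0 < ε → ε ≤ 1 → ∀ (t : ℝ), ∀ p ∈ region m K ε,
      ‖(Phi T ε).comp (fderiv ℝ (field T ε) (gamma0 T t + p))
        - (opP T ε t).comp (Phi T ε)‖ ≤ L * √ε := by
  obtain ⟨L, hL, H⟩ := exists_nl_lipschitz T (K := K + 1) (by positivity)
  refine ⟨L, hL, fun ε hε hε1 t p hp => ?_⟩
  refine (hasFDerivAt_nl T hε t p).le_of_lip' (by positivity) ?_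
  have h1 := region_mem_nhds hε (lt_add_one K) hp
  filter_upwards [h1] with q hq
  exact H ε hε hε1 t q hq p (mem_of_mem_nhds h1)

/-- The bound `K` guarantees that the essential supremum is finite, as `toReal` would send `⊤` to
`0`. -/
lemma ae_norm_le_toReal_eLpNorm {E : Type*} [NormedAddCommGroup E] {f : ℝ → E} {K : ℝ}
    (h : ∀ᵐ t, ‖f t‖ ≤ K) : ∀ᵐ t, ‖f t‖ ≤ (eLpNorm f ⊤ (volume : Measure ℝ)).toReal := by
  have hfin : eLpNorm f ⊤ (volume : Measure ℝ) ≠ ⊤ := by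
    rw [eLpNorm_exponent_top]
    exact ((eLpNormEssSup_le_of_ae_bound h).trans_lt ENNReal.ofReal_lt_top).ne
  filter_upwards [enorm_ae_le_eLpNormEssSup f (volume : Measure ℝ)] with t ht
  rw [← eLpNorm_exponent_top] at ht
  rw [← toReal_enorm]
  exact ENNReal.toReal_mono hfin ht

/-- Dividing `√ε ‖η‖_{L^∞_ε} ≤ Cε` by `√ε` gives `ε‖ξ‖ + |ζ| ≤ C√ε`, from which both conditions of
`region` follow. -/
lemma ae_mem_region (T : Triple m) {C ε : ℝ} (hε : 0 < ε) {η : W12 m}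
    (h : normW12Eps T ε η + √ε * normLinftyEps ε η ≤ C * ε) :
    ∀ᵐ t, fn η t ∈ region m C ε := by
  have hs : 0 < √ε := Real.sqrt_pos.2 hε
  have hss : √ε * √ε = ε := Real.mul_self_sqrt hε.le
  have h1 : 0 ≤ normW12Eps T ε η := Real.sqrt_nonneg _
  have h2 : normLinftyEps ε η ≤ C * √ε := by
    refine le_of_mul_le_mul_left ?_ hs
    have : √ε * (C * √ε) = C * ε := by
      calc √ε * (C * √ε) = C * (√ε * √ε) := by ring
        _ = C * ε := by rw [hss]
    linarith
  have b := ae_norm_le η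
  filter_upwards [ae_norm_le_toReal_eLpNorm (f := fun t => xPart (fn η t)) (K := ‖η‖)
      (by filter_upwards [b] with t ht using (norm_xPart_le _).trans ht),
    ae_norm_le_toReal_eLpNorm (f := fun t => zPart (fn η t)) (K := ‖η‖)
      (by filter_upwards [b] with t ht using (abs_zPart_le _).trans ht)] with t t1 t2
  unfold normLinftyEps at h2
  have t3 := mul_le_mul_of_nonneg_left t1 hε.le
  have t4 : 0 ≤ ε * ‖xPart (fn η t)‖ := by positivity
  constructor
  · refine le_of_mul_le_mul_left ?_ hs
    rw [← mul_assoc, hss]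
    have t5 := norm_nonneg (zPart (fn η t))
    linarith
  · rw [← Real.norm_eq_abs]
    linarith

theorem exists_surjective_linearisation (T : Triple m) {K : ℝ} (hK : 0 < K) :
    ∃ ε₀ > 0, ∀ ε : ℝ, 0 < ε → ε < ε₀ → ∀ η : W12 m, (∀ᵐ t, fn η t ∈ region m K ε) →
      Function.Surjective (linearisation T ε η) := by
  obtain ⟨C, hC, ε₀, hε₀, H⟩ := exists_solutionOp T
  obtain ⟨L, hL, HL⟩ := exists_fderiv_nl_bound T hK
  refine ⟨min ε₀ (min 1 ((2 * (L * C)) ^ 2)⁻¹), by positivity, fun ε hε hε' η hη y => ?_⟩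
  rw [lt_min_iff, lt_min_iff] at hε'
  obtain ⟨hε1, hε2, hε3⟩ := hε'
  have hsq := mul_sqrt_mul_le hL hC hε3.le
  obtain ⟨S, hS⟩ := H ε hε hε1
  let f : L2 m := mulOp _ (EssBdd.const (Phi T ε)) y
  let N : L2 m → L2 m := fun g =>
    f - (mulOp _ (EssBdd.const (Phi T ε)) (linearisation T ε η (S g)) - g)
  have hD : ∀ g, ∀ᵐ t, mulOp _ (EssBdd.const (Phi T ε)) (linearisation T ε η (S g)) t =
      g t + ((Phi T ε).comp (fderiv ℝ (field T ε) (gamma0 T t + fn η t))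
        - (opP T ε t).comp (Phi T ε)) (fn (S g) t) := by
    intro g
    filter_upwards [coeFn_mulOp (EssBdd.const (Phi T ε)) (linearisation T ε η (S g)),
      coeFn_linearisation T ε η (S g), (hS g).1] with t t1 t2 t3
    rw [t1, t2, ← t3, map_add]
    simp only [sub_apply, ContinuousLinearMap.comp_apply]
    abel
  have hlin : ∀ x, ‖mulOp _ (EssBdd.const (Phi T ε)) (linearisation T ε η (S x)) - x‖
      ≤ 1 / 2 * ‖x‖ := by
    intro x
    have h1 : ‖mulOp _ (EssBdd.const (Phi T ε)) (linearisation T ε η (S x)) - x‖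
        ≤ L * √ε * ‖incl (S x)‖ := by
      refine Lp.norm_le_mul_norm_of_ae_le_mul ?_
      filter_upwards [hD x, hη,
        Lp.coeFn_sub (mulOp _ (EssBdd.const (Phi T ε)) (linearisation T ε η (S x))) x]
        with t t1 t2 t3
      rw [t3, Pi.sub_apply, t1, add_sub_cancel_left]
      exact ContinuousLinearMap.le_of_opNorm_le _ (HL ε hε hε2.le t _ t2) _
    refine (h1.trans (mul_le_mul_of_nonneg_left (hS x).2.2.2.2 (by positivity))).trans ?_
    rw [← mul_assoc]
    exact mul_le_mul_of_nonneg_right hsq (norm_nonneg _)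
  -- Here `N 0 = f` and `N` contracts on the whole space by linearity, so radius `2‖f‖` meets the
  -- condition on `N 0`; a fixed point solves `Phi (dF (S g)) = f`, with `dF` the linearisation.
  obtain ⟨g, -, hfix⟩ := exists_fixedPoint_closedBall N (r := 2 * ‖f‖) (by positivity) (by
      simp only [N, map_zero, sub_zero]
      linarith) (fun x x' _ _ => by
      have h := hlin (x' - x)
      rw [norm_sub_rev x' x] at h
      refine le_of_eq_of_le (congrArg _ ?_) h
      simp only [N, map_sub]
      abel)
  refine ⟨S g, ?_⟩
  have h5 : mulOp _ (EssBdd.const (Phi T ε)) (linearisation T ε η (S g)) = f := by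
    have h6 : f - (mulOp _ (EssBdd.const (Phi T ε)) (linearisation T ε η (S g)) - g) = g := hfix
    rw [sub_sub_eq_add_sub, sub_eq_iff_eq_add] at h6
    exact (add_left_cancel (h6.symm.trans (add_comm f g))).symm ▸ rfl
  exact mulOp_Phi_injective T hε h5

end

end BirthDeath

/-! ### Existence and transversality combined -/

theorem corollary3p15 (m : ℕ) (T : BirthDeath.Triple m) :
    (∃ C > 0, ∃ ε₀ > 0, ∀ ε : ℝ, 0 < ε → ε < ε₀ →
      ∃ η : BirthDeath.W12 m, BirthDeath.IsNearbySolution T C ε η) ∧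
    (∀ C > 0, ∃ ε₀ > 0, ∀ ε : ℝ, 0 < ε → ε < ε₀ →
      ∀ η : BirthDeath.W12 m, BirthDeath.IsNearbySolution T C ε η →
        DifferentiableAt ℝ (BirthDeath.functional T ε) η ∧
        Function.Surjective (fderiv ℝ (BirthDeath.functional T ε) η)) := by
  constructor
  · obtain ⟨C, hC, ε₀, hε₀, H⟩ := BirthDeath.exists_zero T
    refine ⟨C, hC, ε₀, hε₀, fun ε hε hε' => ?_⟩
    obtain ⟨η, h1, h2, h3⟩ := H ε hε hε'
    exact ⟨η, BirthDeath.exists_smooth_of_functional_eq_zero T hε h1, h2, h3⟩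
  · intro C hC
    obtain ⟨ε₀, hε₀, H⟩ := BirthDeath.exists_surjective_linearisation T hC
    refine ⟨ε₀, hε₀, fun ε hε hε' η hη => ?_⟩
    have h := BirthDeath.hasFDerivAt_functional T ε η
    refine ⟨h.differentiableAt, ?_⟩
    rw [h.fderiv]
    exact H ε hε hε' η (BirthDeath.ae_mem_region T hε hη.bound)
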